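/- **The algorithm.** HT-OSTM is a software transactional memory for hash-table objects; each object has $m$ buckets, and $\mathrm{hash}(o,k)\in\{1,\dots,m\}$ is the slot of key $k$ of object $o$. A bucket is a *lazy red-blue list*: nodes $\langle key, value, marked, max\_ts.\{insert,delete,lookup\}, RL, BL\rangle$, each with a reentrant lock, between a head with key $-\infty$ and a tail with key $+\infty$. The red links $RL$ connect all nodes, the blue links $BL$ only the nodes whose keys are present; initially all buckets contain only head and tail. Threads are asynchronous: an execution is any finite interleaving of atomic events, each making at most one access (read, write, lock, unlock, node creation, get&inc) to the mutable shared memory; there is no fairness assumption and there may be any number of transactions. A transaction calls its methods one after the other: first STM_begin, then any of STM_insert, STM_delete, STM_lookup, STM_tryC; nothing follows an abort or the response of STM_tryC. Each transaction has a timestamp $ts$ and a local log with at most one entry (operation, value) per pair $\langle o,k\rangle$. * STM_begin: $ts\leftarrow$ get&inc of a shared counter. * STM_insert$(o,k,v)$: set the log entry of $\langle o,k\rangle$ to (insert, $v$); return ok. * STM_lookup$(o,k)$ and STM_delete$(o,k)$ ("rv-methods"): if $\langle o,k\rangle$ is in the log, return its value (nil if the entry is a delete); a delete then sets the entry to (delete,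 nil). Otherwise run *search* below. If it aborts, return abort. Otherwise let $bc, rc$ be the nodes found. If $bc.key=k$, write $ts$ to $bc.max\_ts.lookup$ and read $v\leftarrow bc.value$. Else if $rc.key=k$, write $ts$ to $rc.max\_ts.lookup$ and $v\leftarrow$ nil. Else create a marked node with key $k$, link it into the red list between $rp$ and $rc$, write $ts$ to its $max\_ts.lookup$, and $v\leftarrow$ nil. Release the locks, log (lookup, $v$) or (delete, nil), and return $v$. * *search*: walk from the head along $BL$ to consecutive $bp,bc$ with $bp.key<k\le bc.key$, then from $bp$ along $RL$ to consecutive $rp,rc$ with $rp.key<k\le rc.key$, without locks. Lock $bp,rp,rc,bc$. *Validate*: if $bp$ or $bc$ is marked, or $bp.BL\ne bc$, or $rp.RL\neq rc$, release the four locks and search again. Otherwise, if $bc$ (or else $rc$) has key $k$ and $ts$ is smaller than its $max\_ts.insert$ or $max\_ts.delete$ or, if the caller is STM_tryC, its $max\_ts.lookup$, release all locks and abort. * STM_tryC: take the update (insert and delete) entries of the log in increasing order of keys. First *search* for all of them, keeping the locks. Then treat them one by one. Intra-transaction validation: if $bp$ is marked or $bp.BL\neq bc$, replace (unlock the old, lock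 the new) $bp$ by $bp'.BL$ or by $bp'$, according as the preceding entry of the same bucket, with predecessors $bp',rp'$, is an insert or a delete; then if $rp.RL\ne rc$, replace $rp$ by $rp'.RL$. An insert of $v$ writes $bc.value\leftarrow v$ if $bc.key=k$; else if $rc.key=k$, writes $rc.value\leftarrow v$, unmarks $rc$ and links it into the blue list between $bp$ and $bc$; else creates a locked node with $k,v$ and links it into both lists; it also writes $ts$ to $max\_ts.insert$ of that node. A delete with $bc.key=k$ marks $bc$, sets $bp.BL\leftarrow bc.BL$, and writes $ts$ to $bc.max\_ts.delete$; otherwise it does nothing. Finally release all locks and return ok. **Linearization points (LP).** For STM_begin the get&inc; for STM_insert the update of the log; for an rv-method that accesses the shared memory, the first unlock of the final release of its locks; for STM_tryC the first unlock of its final release of locks. An aborted method is linearized at the first unlock after its validation has returned abort. A method that never unlocks (an rv-method answered from the log, an STM_tryC without updates) is linearized at its local step on the log. **Legality.** Let $S$ be a sequential history, i.e. a sequence of complete methods. A non-aborted lookup or delete $M$ on $\langle o,k\rangle$ of a transaction $T_i$ with return value $v$ (possibly nil) is legal in $S$ if: * (LR1) if $T_i$ has an earlier method on $\langle o,k\rangle$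 and $P$ is the last such: $v=v'$ if $P$ inserts $v'$ or is a lookup that returned $v'$, and $v=$ nil if $P$ is a delete; * (LR2) if there is no such method and $v\ne$ nil: some transaction $T_p$, whose last update method (insert or delete) on $\langle o,k\rangle$ inserts $v$, committed (its STM_tryC returned ok) before $M$, and no transaction having an update method on $\langle o,k\rangle$ committed after $T_p$ and before $M$; * (LR3) if there is no such method and $v=$ nil: the same with "is a delete" in place of "inserts $v$", where $T_p$ may also be an initial transaction that deletes all keys and commits before everything else. $S$ is *legal* if all its non-aborted lookups and deletes are legal. **Theorem.** For every hash function and every finite concurrent execution $E$ of HT-OSTM there is a sequential history $S$ such that 1. every method has at most one linearization point in $E$, and it lies between the invocation and the response of the method (strictly after the former and, if the method has responded, strictly before the latter); 2. the methods of $S$ are exactly the methods of $E$ that have reached their linearization point, each once and in the order of these points; 3. $S$ is equivalent to a completion of the method-level history $H$ of $E$ (the invocations and responses in $E$): it has the same invocations, with the same arguments, and the same responses as the history that is obtained from $H$ by appending responses to some of the pending invocations and removing the other pending invocations; 4. $S$ respects the method real-time order: if the response of a method $a$ precedes the invocation of a method $b$ in $H$ and $b$ is in $S$, then $a$ is in $S$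 and precedes $b$ there; 5. $S$ is legal. That is, the methods of HT-OSTM are linearizable, with the linearization points above. -/

import Mathlib

namespace HTOSTM

/-! ### Shared memory: hash tables whose buckets are lazy red-blue lists -/

/-- Names of transactions. -/
abbrev Tx : Type := ℕ

/-- A bucket: a hash-table object together with one of its `m` slots. -/
abbrev Bucket (Obj : Type*) (m : ℕ) : Type _ := Obj × Fin m

/-- Node keys, including the sentinel keys `-∞` (heads) and `+∞` (tails). -/
abbrev XKey (K : Type*) : Type _ := WithBot (WithTop K)

/-- An ordinary key as a node key. -/
def XKey.of {K : Type*} (k : K) : XKey K := ((k : WithTop K) : WithBot (WithTop K))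

/-- References to nodes: the two immutable sentinels of each bucket, and allocated nodes. -/
inductive Addr (B : Type*) where
  | head (b : B)
  | tail (b : B)
  | node (n : ℕ)
  deriving DecidableEq

/-- A node `⟨key, value, marked, max_ts, rl, bl⟩`; `none` is the null value or null pointer.
Its lock is kept separately in `Shared`. -/
structure Node (K V B : Type*) where
  key : XKey K
  value : Option V
  marked : Bool
  tsInsert : ℕ
  tsDelete : ℕ
  tsLookup : ℕ
  rl : Option (Addr B)
  bl : Option (Addr B)

/-- The shared memory. `fresh` is the next unused node name, `counter` is `sh_cntr`, and
`lockOf a` is the owner and the hold count of the (reentrant) lock of node `a`. -/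
structure Shared (K V B : Type*) where
  mem : Addr B → Node K V B
  fresh : ℕ
  lockOf : Addr B → Option (Tx × ℕ)
  counter : ℕ

/-- Initially every bucket consists of its two sentinels, all locks are free and all
timestamps are zero. -/
def Shared.init (K V B : Type*) : Shared K V B where
  mem
    | .head b => ⟨⊥, none, false, 0, 0, 0, some (.tail b), some (.tail b)⟩
    | .tail _ => ⟨⊤, none, false, 0, 0, 0, none, none⟩
    | .node _ => ⟨⊤, none, false, 0, 0, 0, none, none⟩
  fresh := 0
  lockOf _ := none
  counter := 0

/-- Modify one node. -/
def Shared.modify {K V B : Type*} [DecidableEq B] (s : Shared K V B) (a : Addr B)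
    (f : Node K V B → Node K V B) : Shared K V B :=
  { s with mem := Function.update s.mem a (f (s.mem a)) }

/-- Create a new node with contents `x`; its name is `.node s.fresh`. -/
def Shared.alloc {K V B : Type*} [DecidableEq B] (s : Shared K V B) (x : Node K V B) :
    Shared K V B :=
  { s with mem := Function.update s.mem (.node s.fresh) x, fresh := s.fresh + 1 }

/-- `a.lock()` by `t`; `none` means that `t` has to wait. -/
def Shared.lock {K V B : Type*} [DecidableEq B] (s : Shared K V B) (t : Tx) (a : Addr B) :
    Option (Shared K V B) :=
  match s.lockOf a with
  | none => some { s with lockOf := Function.update s.lockOf a (some (t, 1)) }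
  | some (u, n) =>
    if u = t then some { s with lockOf := Function.update s.lockOf a (some (t, n + 1)) } else none

/-- `a.unlock()` by `t`: one hold is given up, and the lock is free when none is left. -/
def Shared.unlock {K V B : Type*} [DecidableEq B] (s : Shared K V B) (t : Tx) (a : Addr B) :
    Shared K V B :=
  match s.lockOf a with
  | none => s
  | some (u, n) =>
    if u = t then
      { s with lockOf := Function.update s.lockOf a (if n ≤ 1 then none else some (t, n - 1)) }
    else s

/-! ### Methods, events and histories -/

/-- The exported methods with their arguments. -/
inductive Op (Obj K V : Type*) where
  | stmBegin
  | insert (o : Obj) (k : K) (v : V)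
  | delete (o : Obj) (k : K)
  | lookup (o : Obj) (k : K)
  | tryC

/-- Responses: the timestamp handed out by `STM_begin`, `ok`, the value or nil (`none`)
returned by a lookup or a delete, and the abort response. -/
inductive Resp (V : Type*) where
  | begun (ts : ℕ)
  | ok
  | val (v : Option V)
  | abort

/-- The name `(i, j)` of the `j`-th method of transaction `T_i`. -/
abbrev MId : Type := Tx × ℕ

/-- Atomic events. -/
inductive Act (Obj K V B : Type*) where
  | inv (op : Op Obj K V)
  | rsp (op : Op Obj K V) (r : Resp V)
  | getInc
  | local
  | new (a : Addr B)
  | read (a : Addr B)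
  | write (a : Addr B)
  | lock (a : Addr B)
  | unlock (a : Addr B)

/-- An event of the method `mid`; `lp` tells whether it is the linearization point of `mid`. -/
structure Event (Obj K V B : Type*) where
  mid : MId
  act : Act Obj K V B
  lp : Bool

/-! ### Thread-local data -/

inductive Opn where
  | insert
  | delete
  | lookup
  deriving DecidableEq

/-- A log entry for the pair `⟨obj, key⟩`. -/
structure Entry (Obj K V : Type*) where
  obj : Obj
  key : K
  opn : Opn
  value : Option V

/-- A location: `preds = ⟨bp, rp⟩` and `currs = ⟨rc, bc⟩` (b for blue and r for red). -/
structure Loc (B : Type*) where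
  bp : Addr B
  rp : Addr B
  rc : Addr B
  bc : Addr B

/-- The order in which the locks of a location are acquired and released. -/
def Loc.nodes {B : Type*} (c : Loc B) : List (Addr B) := [c.bp, c.rp, c.rc, c.bc]

/-- A log entry together with the location that `tryC` found for it, and the node, if any,
that was created for it. -/
structure Located (Obj K V B : Type*) where
  ent : Entry Obj K V
  loc : Loc B
  node : Option (Addr B)

/-- The log entry for `⟨o, k⟩`, if there is one. -/
def findInLL {Obj K V : Type*} [DecidableEq Obj] [DecidableEq K] (log : List (Entry Obj K V))
    (o : Obj) (k : K) : Option (Entry Obj K V) :=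
  log.find? fun e => decide (e.obj = o ∧ e.key = k)

/-- Replace the entry for the pair of `e`, or add `e` if there is none. -/
def setLL {Obj K V : Type*} [DecidableEq Obj] [DecidableEq K] (log : List (Entry Obj K V))
    (e : Entry Obj K V) : List (Entry Obj K V) :=
  if (findInLL log e.obj e.key).isSome then
    log.map fun e' => if e'.obj = e.obj ∧ e'.key = e.key then e else e'
  else log ++ [e]

/-- The value that a later lookup or delete of the same transaction finds in the log. -/
def Entry.seen {Obj K V : Type*} (e : Entry Obj K V) : Option V :=
  match e.opn with
  | .delete => none
  | _ => e.value

/-- The update entries of the log in increasing order of their keys. -/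
def orderedLL {Obj K V : Type*} [LinearOrder K] (log : List (Entry Obj K V)) :
    List (Entry Obj K V) :=
  (log.filter fun e => decide (e.opn ≠ .lookup)).insertionSort fun e e' => e.key ≤ e'.key

/-- The caller of `rblSearch`: a lookup or delete on `⟨o, k⟩`, or `tryC` for its entry `e`,
with the entries already located and those still to be located. -/
inductive Caller (Obj K V B : Type*) where
  | rv (o : Obj) (k : K)
  | tryC (located : List (Located Obj K V B)) (e : Entry Obj K V) (rest : List (Entry Obj K V))

/-- The pair `⟨obj, key⟩` that is searched for. -/
def Caller.target {Obj K V B : Type*} : Caller Obj K V B → Obj × K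
  | .rv o k => (o, k)
  | .tryC _ e _ => (e.obj, e.key)

/-- The single reads of `methodValidation` (the first four) and of `transValidation`. -/
inductive Check where
  | bpMarked
  | bcMarked
  | bpBlue
  | rpRed
  | tsInsert
  | tsDelete
  | tsLookup

/-- What follows a release of locks. -/
inductive Cont (Obj K V B : Type*) where
  | retry (c : Caller Obj K V B)
  | rv (v : Option V)
  | committed
  | aborted

/-- Program points inside the second loop of `tryC`. -/
inductive Phase (B : Type*) where
  /- `intraTransValidation` -/
  | chkMarked
  | chkBlue
  | bpUnlock
  | bpLoad
  | bpLock
  | chkRed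
  | rpUnlock
  | rpLoad
  | rpLock
  /- the case distinction on the operation and on the keys of the blue and red curr -/
  | apply
  /- insert, key in the blue list -/
  | insValue
  | insStamp
  /- insert, key in the red list only -/
  | redValue
  | redUnmark
  | redBlue
  | redLink
  | redStamp
  /- insert, key in neither list -/
  | newNode
  | newRed (a : Addr B)
  | newBlue (a : Addr B)
  | newStamp (a : Addr B)
  | newField
  /- delete, key in the blue list -/
  | delMark
  | delLoad
  | delLink (x : Option (Addr B))
  | delStamp

/-- Program points. -/
inductive PC (Obj K V B : Type*) where
  | unborn
  | ready
  | finished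
  | invoked
  | respond (r : Resp V)
  /- `rblSearch` -/
  | search (c : Caller Obj K V B)
  | blueWalk (c : Caller Obj K V B) (bp bc : Addr B)
  | redStart (c : Caller Obj K V B) (bp bc : Addr B)
  | redWalk (c : Caller Obj K V B) (loc : Loc B)
  | acquire (c : Caller Obj K V B) (loc : Loc B) (todo : List (Addr B))
  | validate (c : Caller Obj K V B) (loc : Loc B) (todo : List Check)
  | release (lp : Bool) (todo : List (Addr B)) (k : Cont Obj K V B)
  /- `commonLu&Del` -/
  | rvStamp (loc : Loc B) (a : Addr B) (blue : Bool)
  | rvValue (loc : Loc B)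
  | rvNew (loc : Loc B)
  | rvLink (loc : Loc B) (a : Addr B)
  | rvLog (v : Option V)
  /- second loop of `tryC`: entries done, current entry, entries to come -/
  | commit (done : List (Located Obj K V B)) (cur : Located Obj K V B)
      (rest : List (Located Obj K V B)) (ph : Phase B)

/-- The local state of a transaction: program point, number and name of the current method,
timestamp and log. -/
structure Local (Obj K V B : Type*) where
  pc : PC Obj K V B
  idx : ℕ
  op : Op Obj K V
  ts : ℕ
  log : List (Entry Obj K V)

/-! ### The code -/

section Code

variable {Obj K V : Type*} [DecidableEq Obj] [LinearOrder K] {m : ℕ}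

/-- The bucket of a pair `⟨o, k⟩`. -/
def bucket (hash : Obj → K → Fin m) (o : Obj) (k : K) : Bucket Obj m := (o, hash o k)

/-- `get_aptcurr`: the current node that carries the key, if any. -/
def aptCurr (s : Shared K V (Bucket Obj m)) (loc : Loc (Bucket Obj m)) (k : K) :
    Option (Addr (Bucket Obj m)) :=
  if (s.mem loc.bc).key = XKey.of k then some loc.bc
  else if (s.mem loc.rc).key = XKey.of k then some loc.rc
  else none

/-- The reads of `validation`, in order. Timestamps are compared only if there is a node with
the key; those of lookups only if the caller is `tryC`. -/
def checks (s : Shared K V (Bucket Obj m)) (c : Caller Obj K V (Bucket Obj m))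
    (loc : Loc (Bucket Obj m)) : List Check :=
  [.bpMarked, .bcMarked, .bpBlue, .rpRed] ++
    if (aptCurr s loc c.target.2).isSome then
      match c with
      | .rv _ _ => [.tsInsert, .tsDelete]
      | .tryC _ _ _ => [.tsInsert, .tsDelete, .tsLookup]
    else []

/-- The latest entry before the current one, in the same bucket. -/
def prevInBucket (hash : Obj → K → Fin m) (done : List (Located Obj K V (Bucket Obj m)))
    (cur : Located Obj K V (Bucket Obj m)) : Option (Located Obj K V (Bucket Obj m)) :=
  done.reverse.find? fun p =>
    decide (bucket hash p.ent.obj p.ent.key = bucket hash cur.ent.obj cur.ent.key)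

/-- The locks given up by `releaseOrderedLocks`, in order. -/
def orderedLocks (les : List (Located Obj K V (Bucket Obj m))) : List (Addr (Bucket Obj m)) :=
  les.flatMap fun p => [p.loc.bp, p.loc.rp] ++ p.node.toList ++ [p.loc.rc, p.loc.bc]

/-- The locks held by `tryC` for the entries located before the current one. -/
def Caller.heldBefore : Caller Obj K V (Bucket Obj m) → List (Addr (Bucket Obj m))
  | .rv _ _ => []
  | .tryC located _ _ => orderedLocks located

/-- Start the second loop of `tryC` for the next entry, or release all locks. -/
def advance (done : List (Located Obj K V (Bucket Obj m))) :
    List (Located Obj K V (Bucket Obj m)) → PC Obj K V (Bucket Obj m)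
  | [] => .release true (orderedLocks done) .committed
  | p :: rest => .commit done p rest .chkMarked

/-- The program point after a release of locks. -/
def Cont.pc : Cont Obj K V (Bucket Obj m) → PC Obj K V (Bucket Obj m)
  | .retry c => .search c
  | .rv v => .rvLog v
  | .committed => .respond .ok
  | .aborted => .respond .abort

/-- The result of a step: new program point, new shared memory, the event, and whether the
event is the linearization point. -/
abbrev Outcome (Obj K V : Type*) (m : ℕ) : Type _ :=
  PC Obj K V (Bucket Obj m) × Shared K V (Bucket Obj m) × Act Obj K V (Bucket Obj m) × Bool

/-- One step of `rblSearch` while it walks along the list. Keys never change, so that the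
comparison of a key is done together with the following access. -/
def searchStep (hash : Obj → K → Fin m) (s : Shared K V (Bucket Obj m)) :
    PC Obj K V (Bucket Obj m) → Option (Outcome Obj K V m)
  | .search c =>
    let h := Addr.head (bucket hash c.target.1 c.target.2)
    match (s.mem h).bl with
    | some a => some (.blueWalk c h a, s, .read h, false)
    | none => none
  | .blueWalk c bp bc =>
    if (s.mem bc).key < XKey.of c.target.2 then
      match (s.mem bc).bl with
      | some a => some (.blueWalk c bc a, s, .read bc, false)
      | none => none
    else some (.redStart c bp bc, s, .read bc, false)
  | .redStart c bp bc =>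
    match (s.mem bp).rl with
    | some a => some (.redWalk c ⟨bp, bp, a, bc⟩, s, .read bp, false)
    | none => none
  | .redWalk c loc =>
    if (s.mem loc.rc).key < XKey.of c.target.2 then
      match (s.mem loc.rc).rl with
      | some a => some (.redWalk c { loc with rp := loc.rc, rc := a }, s, .read loc.rc, false)
      | none => none
    else some (.acquire c loc loc.nodes, s, .read loc.rc, false)
  | _ => none

/-- One read of `validation` by a transaction with timestamp `ts`. A failed check of the
location leads to a retry, a failed comparison of timestamps to an abort. -/
def checkStep (s : Shared K V (Bucket Obj m)) (ts : ℕ) (c : Caller Obj K V (Bucket Obj m))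
    (loc : Loc (Bucket Obj m)) (ch : Check) (todo : List Check) : Outcome Obj K V m :=
  let go : PC Obj K V (Bucket Obj m) := .validate c loc todo
  let retry : PC Obj K V (Bucket Obj m) := .release false loc.nodes (.retry c)
  let abort : PC Obj K V (Bucket Obj m) := .release true (loc.nodes ++ c.heldBefore) .aborted
  let a := (aptCurr s loc c.target.2).getD loc.bc
  match ch with
  | .bpMarked => (if (s.mem loc.bp).marked then retry else go, s, .read loc.bp, false)
  | .bcMarked => (if (s.mem loc.bc).marked then retry else go, s, .read loc.bc, false)
  | .bpBlue => (if (s.mem loc.bp).bl ≠ some loc.bc then retry else go, s, .read loc.bp, false)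
  | .rpRed => (if (s.mem loc.rp).rl ≠ some loc.rc then retry else go, s, .read loc.rp, false)
  | .tsInsert => (if ts < (s.mem a).tsInsert then abort else go, s, .read a, false)
  | .tsDelete => (if ts < (s.mem a).tsDelete then abort else go, s, .read a, false)
  | .tsLookup => (if ts < (s.mem a).tsLookup then abort else go, s, .read a, false)

/-- The program point after a successful `rblSearch`. -/
def located (s : Shared K V (Bucket Obj m)) (loc : Loc (Bucket Obj m)) :
    Caller Obj K V (Bucket Obj m) → PC Obj K V (Bucket Obj m)
  | .rv _ k =>
    if (s.mem loc.bc).key = XKey.of k then .rvStamp loc loc.bc true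
    else if (s.mem loc.rc).key = XKey.of k then .rvStamp loc loc.rc false
    else .rvNew loc
  | .tryC done e [] => advance [] (done ++ [⟨e, loc, none⟩])
  | .tryC done e (e' :: rest) => .search (.tryC (done ++ [⟨e, loc, none⟩]) e' rest)

/-- One step of the second loop of `tryC` for the entry `cur`, by transaction `t` with
timestamp `ts`. A new node is initialized in one step while it is still private. -/
def commitStep (hash : Obj → K → Fin m) (t : Tx) (ts : ℕ) (s : Shared K V (Bucket Obj m))
    (done : List (Located Obj K V (Bucket Obj m))) (cur : Located Obj K V (Bucket Obj m))
    (rest : List (Located Obj K V (Bucket Obj m))) (ph : Phase (Bucket Obj m)) :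
    Option (Outcome Obj K V m) :=
  let loc := cur.loc
  let k := XKey.of cur.ent.key
  let at_ (ph : Phase (Bucket Obj m)) : PC Obj K V (Bucket Obj m) := .commit done cur rest ph
  let next : PC Obj K V (Bucket Obj m) := advance (done ++ [cur]) rest
  match ph with
  | .chkMarked =>
    some (at_ (if (s.mem loc.bp).marked then .bpUnlock else .chkBlue), s, .read loc.bp, false)
  | .chkBlue =>
    some (at_ (if (s.mem loc.bp).bl ≠ some loc.bc then .bpUnlock else .chkRed), s,
      .read loc.bp, false)
  | .bpUnlock => some (at_ .bpLoad, s.unlock t loc.bp, .unlock loc.bp, false)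
  | .bpLoad =>
    match prevInBucket hash done cur with
    | none => none
    | some p =>
      if p.ent.opn = .insert then
        match (s.mem p.loc.bp).bl with
        | some a =>
          some (.commit done { cur with loc := { loc with bp := a } } rest .bpLock, s,
            .read p.loc.bp, false)
        | none => none
      else
        some (.commit done { cur with loc := { loc with bp := p.loc.bp } } rest .bpLock, s,
          .local, false)
  | .bpLock => (s.lock t loc.bp).map fun s' => (at_ .chkRed, s', .lock loc.bp, false)
  | .chkRed =>
    some (at_ (if (s.mem loc.rp).rl ≠ some loc.rc then .rpUnlock else .apply), s,
      .read loc.rp, false)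
  | .rpUnlock => some (at_ .rpLoad, s.unlock t loc.rp, .unlock loc.rp, false)
  | .rpLoad =>
    match prevInBucket hash done cur with
    | none => none
    | some p =>
      match (s.mem p.loc.rp).rl with
      | some a =>
        some (.commit done { cur with loc := { loc with rp := a } } rest .rpLock, s,
          .read p.loc.rp, false)
      | none => none
  | .rpLock => (s.lock t loc.rp).map fun s' => (at_ .apply, s', .lock loc.rp, false)
  | .apply =>
    let pc :=
      if cur.ent.opn = .insert then
        if (s.mem loc.bc).key = k then at_ .insValue
        else if (s.mem loc.rc).key = k then at_ .redValue
        else at_ .newNode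
      else if (s.mem loc.bc).key = k then at_ .delMark
      else next
    some (pc, s, .read loc.bc, false)
  | .insValue =>
    some (at_ .insStamp, s.modify loc.bc fun x => { x with value := cur.ent.value },
      .write loc.bc, false)
  | .insStamp =>
    some (next, s.modify loc.bc fun x => { x with tsInsert := ts }, .write loc.bc, false)
  | .redValue =>
    some (at_ .redUnmark, s.modify loc.rc fun x => { x with value := cur.ent.value },
      .write loc.rc, false)
  | .redUnmark =>
    some (at_ .redBlue, s.modify loc.rc fun x => { x with marked := false }, .write loc.rc, false)
  | .redBlue =>
    some (at_ .redLink, s.modify loc.rc fun x => { x with bl := some loc.bc },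
      .write loc.rc, false)
  | .redLink =>
    some (at_ .redStamp, s.modify loc.bp fun x => { x with bl := some loc.rc },
      .write loc.bp, false)
  | .redStamp =>
    some (next, s.modify loc.rc fun x => { x with tsInsert := ts }, .write loc.rc, false)
  | .newNode =>
    let a : Addr (Bucket Obj m) := .node s.fresh
    let s' := s.alloc ⟨k, cur.ent.value, false, 0, 0, 0, some loc.rc, some loc.bc⟩
    (s'.lock t a).map fun s'' => (at_ (.newRed a), s'', .new a, false)
  | .newRed a =>
    some (at_ (.newBlue a), s.modify loc.rp fun x => { x with rl := some a }, .write loc.rp, false)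
  | .newBlue a =>
    some (at_ (.newStamp a), s.modify loc.bp fun x => { x with bl := some a },
      .write loc.bp, false)
  | .newStamp a =>
    some (at_ .newField, s.modify a fun x => { x with tsInsert := ts }, .write a, false)
  | .newField =>
    some (advance (done ++ [{ cur with node := (s.mem loc.bp).bl }]) rest, s,
      .read loc.bp, false)
  | .delMark =>
    some (at_ .delLoad, s.modify loc.bc fun x => { x with marked := true }, .write loc.bc, false)
  | .delLoad => some (at_ (.delLink (s.mem loc.bc).bl), s, .read loc.bc, false)
  | .delLink x =>
    some (at_ .delStamp, s.modify loc.bp fun y => { y with bl := x }, .write loc.bp, false)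
  | .delStamp =>
    some (next, s.modify loc.bc fun x => { x with tsDelete := ts }, .write loc.bc, false)

/-- The next step of transaction `t` inside a method, if there is one: new local state, new
shared memory, the event, and whether the event is the linearization point of the method.
Every step makes at most one access to the mutable shared memory; a wait for a lock and the
dereference of a null pointer are represented by `none`. -/
def step (hash : Obj → K → Fin m) (t : Tx) (l : Local Obj K V (Bucket Obj m))
    (s : Shared K V (Bucket Obj m)) :
    Option (Local Obj K V (Bucket Obj m) × Shared K V (Bucket Obj m) ×
      Act Obj K V (Bucket Obj m) × Bool) :=
  let lift (o : Outcome Obj K V m) := ({ l with pc := o.1 }, o.2)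
  match l.pc with
  | .unborn => none
  | .ready => none
  | .finished => none
  | .invoked =>
    match l.op with
    | .stmBegin =>
      some ({ l with ts := s.counter, pc := .respond (.begun s.counter) },
        { s with counter := s.counter + 1 }, .getInc, true)
    | .insert o k v =>
      some ({ l with log := setLL l.log ⟨o, k, .insert, some v⟩, pc := .respond .ok }, s,
        .local, true)
    | .lookup o k =>
      match findInLL l.log o k with
      | some e => some ({ l with pc := .respond (.val e.seen) }, s, .local, true)
      | none => some ({ l with pc := .search (.rv o k) }, s, .local, false)
    | .delete o k =>
      match findInLL l.log o k with
      | some e =>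
        some ({ l with log := setLL l.log ⟨o, k, .delete, none⟩, pc := .respond (.val e.seen) },
          s, .local, true)
      | none => some ({ l with pc := .search (.rv o k) }, s, .local, false)
    | .tryC =>
      match orderedLL l.log with
      | [] => some ({ l with pc := .respond .ok }, s, .local, true)
      | e :: rest => some ({ l with pc := .search (.tryC [] e rest) }, s, .local, false)
  | .respond r =>
    let pc : PC Obj K V (Bucket Obj m) :=
      match r, l.op with
      | .abort, _ => .finished
      | _, .tryC => .finished
      | _, _ => .ready
    some ({ l with pc := pc, idx := l.idx + 1 }, s, .rsp l.op r, false)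
  | .search c => (searchStep hash s (.search c)).map lift
  | .blueWalk c bp bc => (searchStep hash s (.blueWalk c bp bc)).map lift
  | .redStart c bp bc => (searchStep hash s (.redStart c bp bc)).map lift
  | .redWalk c loc => (searchStep hash s (.redWalk c loc)).map lift
  | .acquire c loc [] => some (lift (.validate c loc (checks s c loc), s, .local, false))
  | .acquire c loc (a :: todo) =>
    (s.lock t a).map fun s' => lift (.acquire c loc todo, s', .lock a, false)
  | .validate c loc [] => some (lift (located s loc c, s, .read loc.bc, false))
  | .validate c loc (ch :: todo) => some (lift (checkStep s l.ts c loc ch todo))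
  | .release _ [] k => some (lift (k.pc, s, .local, false))
  | .release lp (a :: todo) k =>
    some (lift (.release false todo k, s.unlock t a, .unlock a, lp))
  | .rvStamp loc a blue =>
    some (lift (if blue then .rvValue loc else .release true loc.nodes (.rv none),
      s.modify a fun x => { x with tsLookup := l.ts }, .write a, false))
  | .rvValue loc =>
    some (lift (.release true loc.nodes (.rv (s.mem loc.bc).value), s, .read loc.bc, false))
  | .rvNew loc =>
    match l.op with
    | .lookup _ k | .delete _ k =>
      let a : Addr (Bucket Obj m) := .node s.fresh
      some (lift (.rvLink loc a, s.alloc ⟨XKey.of k, none, true, 0, 0, 0, some loc.rc, none⟩,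
        .new a, false))
    | _ => none
  | .rvLink loc a =>
    some (lift (.rvStamp loc a false, s.modify loc.rp fun x => { x with rl := some a },
      .write loc.rp, false))
  | .rvLog v =>
    match l.op with
    | .lookup o k =>
      some ({ l with log := setLL l.log ⟨o, k, .lookup, v⟩, pc := .respond (.val v) }, s,
        .local, false)
    | .delete o k =>
      some ({ l with log := setLL l.log ⟨o, k, .delete, none⟩, pc := .respond (.val v) }, s,
        .local, false)
    | _ => none
  | .commit done cur rest ph => (commitStep hash t l.ts s done cur rest ph).map lift

/-! ### Executions -/

/-- A global state: the shared memory and the local state of every transaction. -/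
structure Config (Obj K V : Type*) (m : ℕ) where
  shared : Shared K V (Bucket Obj m)
  loc : Tx → Local Obj K V (Bucket Obj m)

/-- The initial global state. -/
def Config.init (Obj K V : Type*) (m : ℕ) : Config Obj K V m where
  shared := Shared.init K V (Bucket Obj m)
  loc _ := ⟨.unborn, 0, .stmBegin, 0, []⟩

/-- A transaction first invokes `STM_begin`; then it may invoke any other method whenever it
has received the response of the previous one, until it is committed or aborted. -/
def CanInvoke : PC Obj K V (Bucket Obj m) → Op Obj K V → Prop
  | .unborn, .stmBegin => True
  | .ready, .insert _ _ _ => True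
  | .ready, .delete _ _ => True
  | .ready, .lookup _ _ => True
  | .ready, .tryC => True
  | _, _ => False

/-- One event changes the global state. -/
inductive Step (hash : Obj → K → Fin m) :
    Config Obj K V m → Event Obj K V (Bucket Obj m) → Config Obj K V m → Prop
  | invoke (c : Config Obj K V m) (t : Tx) (op : Op Obj K V) (h : CanInvoke (c.loc t).pc op) :
      Step hash c ⟨(t, (c.loc t).idx), .inv op, false⟩
        { c with loc := Function.update c.loc t { c.loc t with pc := .invoked, op := op } }
  | exec (c : Config Obj K V m) (t : Tx) (l' : Local Obj K V (Bucket Obj m))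
      (s' : Shared K V (Bucket Obj m)) (act : Act Obj K V (Bucket Obj m)) (lp : Bool)
      (h : step hash t (c.loc t) c.shared = some (l', s', act, lp)) :
      Step hash c ⟨(t, (c.loc t).idx), act, lp⟩ ⟨s', Function.update c.loc t l'⟩

/-- `Run hash E c`: the sequence of events `E` leads from the initial state to `c`. -/
inductive Run (hash : Obj → K → Fin m) :
    List (Event Obj K V (Bucket Obj m)) → Config Obj K V m → Prop
  | nil : Run hash [] (Config.init Obj K V m)
  | snoc (E : List (Event Obj K V (Bucket Obj m))) (c c' : Config Obj K V m)
      (e : Event Obj K V (Bucket Obj m)) (hE : Run hash E c) (he : Step hash c e c') :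
      Run hash (E ++ [e]) c'

/-- `E` is a (finite) concurrent execution of HT-OSTM. -/
def IsExecution (hash : Obj → K → Fin m) (E : List (Event Obj K V (Bucket Obj m))) : Prop :=
  ∃ c, Run hash E c

end Code

/-! ### Histories, equivalence and legality -/

section Histories

variable {Obj K V B : Type*}

/-- Invocations and responses of methods. -/
inductive HEvent (Obj K V : Type*) where
  | inv (mid : MId) (op : Op Obj K V)
  | rsp (mid : MId) (op : Op Obj K V) (r : Resp V)

def HEvent.mid : HEvent Obj K V → MId
  | .inv i _ => i
  | .rsp i _ _ => i

def HEvent.isRsp : HEvent Obj K V → Bool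
  | .inv _ _ => false
  | .rsp _ _ _ => true

/-- The history at method level of an execution. -/
def history (E : List (Event Obj K V B)) : List (HEvent Obj K V) :=
  E.filterMap fun e =>
    match e.act with
    | .inv op => some (.inv e.mid op)
    | .rsp op r => some (.rsp e.mid op r)
    | _ => none

/-- `e` is a response to an invocation that is pending in `H`. -/
def AnswersPending (H : List (HEvent Obj K V)) (e : HEvent Obj K V) : Prop :=
  ∃ i op r, e = .rsp i op r ∧ HEvent.inv i op ∈ H ∧ ∀ op' r', HEvent.rsp i op' r' ∉ H

/-- `H'` is a completion of `H`: responses to some pending invocations are appended, and the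
invocations that are then still pending are removed. -/
def IsCompletion (H H' : List (HEvent Obj K V)) : Prop :=
  ∃ R : List (HEvent Obj K V),
    (∀ e ∈ R, AnswersPending H e) ∧ (R.map HEvent.mid).Nodup ∧
    H' = (H ++ R).filter fun e => (H ++ R).any fun e' => e'.isRsp && decide (e'.mid = e.mid)

/-- A complete method. -/
structure Method (Obj K V : Type*) where
  mid : MId
  op : Op Obj K V
  resp : Resp V

/-- The transaction of a method. -/
def Method.tx (M : Method Obj K V) : Tx := M.mid.1

/-- The sequential history in which the methods of `S` are executed one after the other. In
what follows it is represented by `S` itself. -/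
def seqHistory (S : List (Method Obj K V)) : List (HEvent Obj K V) :=
  S.flatMap fun M => [.inv M.mid M.op, .rsp M.mid M.op M.resp]

/-- Method real-time order in a history: the response of `i` precedes the invocation of `j`. -/
def RealTime (H : List (HEvent Obj K V)) (i j : MId) : Prop :=
  ∃ (p q : ℕ) (op op' : Op Obj K V) (r : Resp V),
    p < q ∧ H[p]? = some (HEvent.rsp i op r) ∧ H[q]? = some (HEvent.inv j op')

/-- `M` operates on the pair `⟨o, k⟩`. -/
def Method.On (M : Method Obj K V) (o : Obj) (k : K) : Prop :=
  (∃ v, M.op = .insert o k v) ∨ M.op = .delete o k ∨ M.op = .lookup o k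

/-- `M` is an update method on the pair `⟨o, k⟩`. -/
def Method.IsUpdate (M : Method Obj K V) (o : Obj) (k : K) : Prop :=
  (∃ v, M.op = .insert o k v) ∨ M.op = .delete o k

/-- The transaction `x` has an update method on `⟨o, k⟩` in `S`. -/
def Updates (S : List (Method Obj K V)) (x : Tx) (o : Obj) (k : K) : Prop :=
  ∃ U ∈ S, U.tx = x ∧ U.IsUpdate o k

/-- The `c`-th method of `S` is the successful `tryC` of the transaction `x`. -/
def CommitsAt (S : List (Method Obj K V)) (x : Tx) (c : ℕ) : Prop :=
  ∃ C, S[c]? = some C ∧ C.tx = x ∧ C.op = .tryC ∧ C.resp = .ok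

/-- `P`, at position `j`, is the last method before position `i` by which the transaction `x`
operates on `⟨o, k⟩`. -/
def PrevOnKey (S : List (Method Obj K V)) (x : Tx) (o : Obj) (k : K) (i j : ℕ)
    (P : Method Obj K V) : Prop :=
  j < i ∧ S[j]? = some P ∧ P.tx = x ∧ P.On o k ∧
    ∀ j' Q, j < j' → j' < i → S[j']? = some Q → ¬ (Q.tx = x ∧ Q.On o k)

/-- LR1: the value `v` agrees with the preceding method `P` of the same transaction. -/
def LR1 (P : Method Obj K V) (v : Option V) : Prop :=
  (∀ o k v', P.op = .insert o k v' → v = some v') ∧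
  (∀ o k v', P.op = .lookup o k → P.resp = .val v' → v = v') ∧
  (∀ o k, P.op = .delete o k → v = none)

/-- `U` is the last update method of the transaction `x` on `⟨o, k⟩` in `S`. -/
def LastUpdate (S : List (Method Obj K V)) (x : Tx) (o : Obj) (k : K) (U : Method Obj K V) :
    Prop :=
  ∃ j, S[j]? = some U ∧ U.tx = x ∧ U.IsUpdate o k ∧
    ∀ (j' : ℕ) (Q : Method Obj K V), j < j' → S[j']? = some Q → ¬ (Q.tx = x ∧ Q.IsUpdate o k)

/-- LR2: a transaction whose last update method on `⟨o, k⟩` inserts `w` committed before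
position `i`, and no transaction that updates `⟨o, k⟩` committed in between. -/
def LR2 (S : List (Method Obj K V)) (o : Obj) (k : K) (w : V) (i : ℕ) : Prop :=
  ∃ p c I, LastUpdate S p o k I ∧ I.op = .insert o k w ∧ CommitsAt S p c ∧ c < i ∧
    ¬ ∃ x d, Updates S x o k ∧ CommitsAt S x d ∧ c < d ∧ d < i

/-- LR3: a transaction whose last update method on `⟨o, k⟩` is a delete committed before
position `i`, and no transaction that updates `⟨o, k⟩` committed in between. The second
alternative is the case that the former is the initial transaction, which deletes every key and
commits before everything else. -/
def LR3 (S : List (Method Obj K V)) (o : Obj) (k : K) (i : ℕ) : Prop :=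
  (∃ p c D, LastUpdate S p o k D ∧ D.op = .delete o k ∧ CommitsAt S p c ∧ c < i ∧
    ¬ ∃ x d, Updates S x o k ∧ CommitsAt S x d ∧ c < d ∧ d < i) ∨
  ¬ ∃ x d, Updates S x o k ∧ CommitsAt S x d ∧ d < i

/-- A sequential history is legal if all its lookups and deletes that are not aborted are. -/
def Legal (S : List (Method Obj K V)) : Prop :=
  ∀ i M o k v, S[i]? = some M → (M.op = .lookup o k ∨ M.op = .delete o k) → M.resp = .val v →
    (∀ j P, PrevOnKey S M.tx o k i j P → LR1 P v) ∧
    ((¬ ∃ j P, PrevOnKey S M.tx o k i j P) →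
      match v with
      | some w => LR2 S o k w i
      | none => LR3 S o k i)

/-- The sequential history `S` is the linearization of the execution `E` that is given by the
linearization points. -/
structure IsLinearization (E : List (Event Obj K V B)) (S : List (Method Obj K V)) : Prop where
  /-- Every linearization point lies between the invocation and the response of its method. -/
  within : ∀ (p : ℕ) (e : Event Obj K V B), E[p]? = some e → e.lp = true →
    (∃ (q : ℕ) (e' : Event Obj K V B) (op : Op Obj K V),
      q < p ∧ E[q]? = some e' ∧ e'.mid = e.mid ∧ e'.act = .inv op) ∧
    ∀ (q : ℕ) (e' : Event Obj K V B) (op : Op Obj K V) (r : Resp V),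
      E[q]? = some e' → e'.mid = e.mid → e'.act = .rsp op r → p < q
  /-- `S` consists of the methods that have a linearization point, each of which has exactly
  one, in the order of these points. -/
  order : (E.filter fun e => e.lp).map (fun e => e.mid) = S.map fun M => M.mid
  unique : (S.map fun M => M.mid).Nodup
  /-- `S` has the same invocations and responses as a completion of the history of `E`. -/
  equiv : ∃ H', IsCompletion (history E) H' ∧ (seqHistory S).Perm H'
  /-- `S` respects the method real-time order. -/
  realTime : ∀ i j, RealTime (history E) i j →
    (∃ M ∈ S, M.mid = j) → RealTime (seqHistory S) i j

end Histories

end HTOSTM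

set_option linter.unusedSectionVars false

namespace HTOSTM

section Heap

variable {Obj K V : Type*} [DecidableEq Obj] [LinearOrder K] {m : ℕ}

/-! ### Keys -/

theorem XKey.of_ne_top (k : K) : XKey.of k ≠ (⊤ : XKey K) := by
  intro h
  have h' : ((k : WithTop K) : WithBot (WithTop K)) = ((⊤ : WithTop K) : WithBot (WithTop K)) := h
  exact WithTop.coe_ne_top (WithBot.coe_injective h')

theorem XKey.bot_lt_of (k : K) : (⊥ : XKey K) < XKey.of k := WithBot.bot_lt_coe _

theorem XKey.of_lt_of {k k' : K} : XKey.of k < XKey.of k' ↔ k < k' := by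
  simp [XKey.of]

theorem XKey.of_inj {k k' : K} : XKey.of k = XKey.of k' ↔ k = k' := by
  simp [XKey.of]

/-! ### Ghost state and order-theoretic notions -/

/-- Auxiliary state: the bucket of every node, the set of nodes in the blue lists, and the
committed contents of the hash tables. -/
structure Ghost (Obj K V : Type*) (m : ℕ) where
  bkt : Addr (Bucket Obj m) → Option (Bucket Obj m)
  blue : Set (Addr (Bucket Obj m))
  abs : Obj → K → Option V

/-- `x` is a sentinel or an allocated node. -/
def Alloc (s : Shared K V (Bucket Obj m)) : Addr (Bucket Obj m) → Prop
  | .node n => n < s.fresh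
  | _ => True

/-- `x` is a node of the bucket `b`. -/
def NodeOf (g : Ghost Obj K V m) (s : Shared K V (Bucket Obj m)) (b : Option (Bucket Obj m))
    (x : Addr (Bucket Obj m)) : Prop :=
  Alloc s x ∧ g.bkt x = b

/-- `a` is the last blue node of the bucket `b` whose key is below `k`. -/
def IsPred (g : Ghost Obj K V m) (s : Shared K V (Bucket Obj m)) (b : Option (Bucket Obj m)) (k : K)
    (a : Addr (Bucket Obj m)) : Prop :=
  a ∈ g.blue ∧ g.bkt a = b ∧ (s.mem a).key < XKey.of k ∧
    ∀ z ∈ g.blue, g.bkt z = b → (s.mem z).key < XKey.of k → (s.mem z).key ≤ (s.mem a).key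

/-- `c` is the first blue node of the bucket `b` whose key is at least `k`. -/
def IsSucc (g : Ghost Obj K V m) (s : Shared K V (Bucket Obj m)) (b : Option (Bucket Obj m)) (k : K)
    (c : Addr (Bucket Obj m)) : Prop :=
  c ∈ g.blue ∧ g.bkt c = b ∧ XKey.of k ≤ (s.mem c).key ∧
    ∀ z ∈ g.blue, g.bkt z = b → XKey.of k ≤ (s.mem z).key → (s.mem c).key ≤ (s.mem z).key

/-- The blue lists are sorted, and pointers stay inside their bucket. -/
structure MemInv (g : Ghost Obj K V m) (s : Shared K V (Bucket Obj m)) : Prop where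
  head_mem : ∀ b, Addr.head b ∈ g.blue
  head_key : ∀ b, (s.mem (.head b)).key = ⊥
  head_bkt : ∀ b, g.bkt (.head b) = b
  alloc : ∀ x ∈ g.blue, Alloc s x
  inj : ∀ x ∈ g.blue, ∀ y ∈ g.blue, g.bkt x = g.bkt y → (s.mem x).key = (s.mem y).key → x = y
  next : ∀ x ∈ g.blue, ∀ y, (s.mem x).bl = some y →
    y ∈ g.blue ∧ g.bkt y = g.bkt x ∧ (s.mem x).key < (s.mem y).key ∧
      ∀ z ∈ g.blue, g.bkt z = g.bkt x → (s.mem x).key < (s.mem z).key →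
        (s.mem y).key ≤ (s.mem z).key
  total : ∀ x ∈ g.blue, (s.mem x).key ≠ ⊤ → ∃ y, (s.mem x).bl = some y
  rl : ∀ x, Alloc s x → ∀ y, (s.mem x).rl = some y → NodeOf g s (g.bkt x) y
  bl : ∀ x, Alloc s x → ∀ y, (s.mem x).bl = some y → NodeOf g s (g.bkt x) y

/-- `v` is the value that the blue list holds for `⟨o, k⟩`. -/
def Holds (hash : Obj → K → Fin m) (g : Ghost Obj K V m) (s : Shared K V (Bucket Obj m))
    (o : Obj) (k : K) (v : Option V) : Prop :=
  (∃ z ∈ g.blue, g.bkt z = bucket hash o k ∧ (s.mem z).key = XKey.of k ∧ (s.mem z).value = v) ∨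
  ((∀ z ∈ g.blue, g.bkt z = bucket hash o k → (s.mem z).key ≠ XKey.of k) ∧ v = none)

section Order

variable {g : Ghost Obj K V m} {s : Shared K V (Bucket Obj m)} {b : Option (Bucket Obj m)} {k : K}
  {a c : Addr (Bucket Obj m)}

theorem IsPred.eq (hm : MemInv g s) {a' : Addr (Bucket Obj m)} (h : IsPred g s b k a)
    (h' : IsPred g s b k a') : a = a' := by
  obtain ⟨h1, h2, h3, h4⟩ := h
  obtain ⟨h1', h2', h3', h4'⟩ := h'
  exact hm.inj _ h1 _ h1' (h2.trans h2'.symm)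
    (le_antisymm (h4' _ h1 h2 h3) (h4 _ h1' h2' h3'))

theorem IsPred.nodeOf (hm : MemInv g s) (h : IsPred g s b k a) : NodeOf g s b a :=
  ⟨hm.alloc _ h.1, h.2.1⟩

/-- Two adjacent blue nodes around `k`. -/
theorem isPred_isSucc_of_bl (hm : MemInv g s) (ha : a ∈ g.blue) (hb : g.bkt a = b)
    (hk : (s.mem a).key < XKey.of k) (hl : (s.mem a).bl = some c)
    (hc : XKey.of k ≤ (s.mem c).key) : IsPred g s b k a ∧ IsSucc g s b k c := by
  obtain ⟨h1, h2, h3, h4⟩ := hm.next a ha c hl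
  subst hb
  refine ⟨⟨ha, rfl, hk, fun z hz hzb hzk => ?_⟩, ⟨h1, h2, hc, fun z hz hzb hzk => ?_⟩⟩
  · by_contra hlt
    exact absurd (lt_of_le_of_lt (h4 z hz hzb (not_le.1 hlt)) hzk) (not_lt.2 hc)
  · exact h4 z hz hzb (lt_of_lt_of_le hk hzk)

theorem IsPred.bl (hm : MemInv g s) (ha : IsPred g s b k a) (hc : IsSucc g s b k c) :
    (s.mem a).bl = some c := by
  obtain ⟨y, hy⟩ := hm.total a ha.1 (fun h => by
    have := ha.2.2.1; rw [h] at this; exact absurd this (not_lt.2 le_top))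
  obtain ⟨h1, h2, h3, h4⟩ := hm.next a ha.1 y hy
  have hky : XKey.of k ≤ (s.mem y).key := by
    by_contra hlt
    exact absurd (ha.2.2.2 y h1 (h2.trans ha.2.1) (not_le.1 hlt)) (not_le.2 h3)
  have : y = c := hm.inj _ h1 _ hc.1 (h2.trans (ha.2.1.trans hc.2.1.symm)) (le_antisymm
    (h4 c hc.1 (hc.2.1.trans ha.2.1.symm) (lt_of_lt_of_le ha.2.2.1 hc.2.2.1))
    (hc.2.2.2 y h1 (h2.trans ha.2.1) hky))
  rw [hy, this]

/-- No blue node carries the key if the successor does not. -/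
theorem IsSucc.key_ne (hc : IsSucc g s b k c) (hk : (s.mem c).key ≠ XKey.of k) :
    ∀ z ∈ g.blue, g.bkt z = b → (s.mem z).key ≠ XKey.of k := fun z hz hb hzk =>
  hk (le_antisymm (hzk ▸ hc.2.2.2 z hz hb hzk.ge) hc.2.2.1)

end Order

/-! ### Changes of the blue lists around one key -/

/-- Between `(g, s)` and `(g', s')` the blue sets differ at most at nodes of the bucket `b` with
key `k`, and keys and buckets are the same. -/
structure SameBut (g : Ghost Obj K V m) (s : Shared K V (Bucket Obj m)) (g' : Ghost Obj K V m)
    (s' : Shared K V (Bucket Obj m)) (b : Option (Bucket Obj m)) (k : K) : Prop where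
  bkt : g'.bkt = g.bkt
  key : ∀ x, (s'.mem x).key = (s.mem x).key
  fresh : s'.fresh = s.fresh
  blue : ∀ x, ¬ (g.bkt x = b ∧ (s.mem x).key = XKey.of k) → (x ∈ g'.blue ↔ x ∈ g.blue)

section SameBut

variable {g g' : Ghost Obj K V m} {s s' : Shared K V (Bucket Obj m)} {b b' : Option (Bucket Obj m)}
  {k k' : K} {a c p : Addr (Bucket Obj m)}

theorem SameBut.alloc (h : SameBut g s g' s' b k) (x : Addr (Bucket Obj m)) :
    Alloc s' x ↔ Alloc s x := by
  cases x <;> simp [Alloc, h.fresh]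

theorem SameBut.nodeOf (h : SameBut g s g' s' b k) (x : Addr (Bucket Obj m)) :
    NodeOf g' s' b' x ↔ NodeOf g s b' x := by
  simp [NodeOf, h.alloc, h.bkt]

theorem SameBut.isPred_of_le (h : SameBut g s g' s' b k) (hk : b' = b → k' ≤ k)
    (ha : IsPred g s b' k' a) : IsPred g' s' b' k' a := by
  obtain ⟨h1, h2, h3, h4⟩ := ha
  have key : ∀ z, g.bkt z = b' → (s.mem z).key < XKey.of k' → (z ∈ g'.blue ↔ z ∈ g.blue) := by
    intro z hz hzk
    refine h.blue z fun ⟨e1, e2⟩ => ?_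
    rw [e2, XKey.of_lt_of] at hzk
    exact absurd (hk (hz.symm.trans e1)) (not_le.2 hzk)
  unfold IsPred
  simp only [h.key, h.bkt]
  exact ⟨(key a h2 h3).2 h1, h2, h3, fun z hz hzb hzk => h4 z ((key z hzb hzk).1 hz) hzb hzk⟩

theorem SameBut.isSucc_of_lt (h : SameBut g s g' s' b k) (hk : b' = b → k < k')
    (ha : IsSucc g s b' k' c) : IsSucc g' s' b' k' c := by
  obtain ⟨h1, h2, h3, h4⟩ := ha
  have key : ∀ z, g.bkt z = b' → XKey.of k' ≤ (s.mem z).key → (z ∈ g'.blue ↔ z ∈ g.blue) := by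
    intro z hz hzk
    refine h.blue z fun ⟨e1, e2⟩ => ?_
    rw [e2] at hzk
    exact absurd (XKey.of_lt_of.2 (hk (hz.symm.trans e1))) (not_lt.2 hzk)
  unfold IsSucc
  simp only [h.key, h.bkt]
  exact ⟨(key c h2 h3).2 h1, h2, h3, fun z hz hzb hzk => h4 z ((key z hzb hzk).1 hz) hzb hzk⟩

/-- The owner of a key different from `p`, the owner of the changed key, stays. -/
theorem SameBut.isPred_of_ne (hm : MemInv g s) (h : SameBut g s g' s' b k)
    (hp : IsPred g s b k p) (hne : a ≠ p) (hav : a ∈ g.blue → a ∈ g'.blue)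
    (ha : IsPred g s b' k' a) : IsPred g' s' b' k' a := by
  obtain ⟨h1, h2, h3, h4⟩ := ha
  unfold IsPred
  simp only [h.key, h.bkt]
  refine ⟨hav h1, h2, h3, fun z hz hzb hzk => ?_⟩
  by_cases hcase : g.bkt z = b ∧ (s.mem z).key = XKey.of k
  · obtain ⟨e1, e2⟩ := hcase
    have hbb : b' = b := hzb.symm.trans e1
    by_contra hlt
    rw [not_le, e2] at hlt
    have l1 := hp.2.2.2 a h1 (h2.trans hbb) hlt
    have l2 := h4 p hp.1 (hp.2.1.trans hbb.symm) (hp.2.2.1.trans (e2 ▸ hzk))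
    exact hne (hm.inj _ h1 _ hp.1 (h2.trans (hbb.trans hp.2.1.symm)) (le_antisymm l1 l2))
  · exact h4 z ((h.blue z hcase).1 hz) hzb hzk

theorem SameBut.isSucc_of_ne (hm : MemInv g s) (h : SameBut g s g' s' b k)
    (hp : IsPred g s b k p) (hne : a ≠ p) (hcv : c ∈ g.blue → c ∈ g'.blue)
    (ha : IsPred g s b' k' a) (hc : IsSucc g s b' k' c) : IsSucc g' s' b' k' c := by
  obtain ⟨h1, h2, h3, h4⟩ := hc
  unfold IsSucc
  simp only [h.key, h.bkt]
  refine ⟨hcv h1, h2, h3, fun z hz hzb hzk => ?_⟩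
  by_cases hcase : g.bkt z = b ∧ (s.mem z).key = XKey.of k
  · obtain ⟨e1, e2⟩ := hcase
    have hbb : b' = b := hzb.symm.trans e1
    by_contra hlt
    rw [not_le, e2] at hlt
    rw [e2] at hzk
    rcases lt_or_ge (s.mem p).key (XKey.of k') with hpk | hpk
    · have l1 := ha.2.2.2 p hp.1 (hp.2.1.trans hbb.symm) hpk
      have l2 := hp.2.2.2 a ha.1 (ha.2.1.trans hbb) (lt_of_lt_of_le ha.2.2.1 hzk)
      exact hne (hm.inj _ ha.1 _ hp.1 (ha.2.1.trans (hbb.trans hp.2.1.symm))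
        (le_antisymm l2 l1))
    · exact absurd (h4 p hp.1 (hp.2.1.trans hbb.symm) hpk) (not_le.2 (hp.2.2.1.trans hlt))
  · exact h4 z ((h.blue z hcase).1 hz) hzb hzk

/-- A blue node with the changed key or below it takes over the keys above. -/
theorem SameBut.isPred_of_frontier (h : SameBut g s g' s' b k) (hkk : k < k')
    {f : Addr (Bucket Obj m)} (hf : f ∈ g'.blue) (hfb : g.bkt f = b)
    (hfk : (s.mem f).key ≤ XKey.of k)
    (hfm : ∀ z ∈ g'.blue, g.bkt z = b → (s.mem z).key ≤ XKey.of k →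
      (s.mem z).key ≤ (s.mem f).key)
    (ha : IsPred g s b k' a) (hak : (s.mem a).key ≤ XKey.of k) : IsPred g' s' b k' f := by
  unfold IsPred
  simp only [h.key, h.bkt]
  refine ⟨hf, hfb, lt_of_le_of_lt hfk (XKey.of_lt_of.2 hkk), fun z hz hzb hzk => ?_⟩
  rcases le_or_gt (s.mem z).key (XKey.of k) with hle | hgt
  · exact hfm z hz hzb hle
  · have hz' : z ∈ g.blue := (h.blue z fun e => hgt.ne' e.2).1 hz
    exact absurd (ha.2.2.2 z hz' hzb hzk) (not_le.2 (lt_of_le_of_lt hak hgt))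

theorem SameBut.isPred_of_key_gt (h : SameBut g s g' s' b k)
    (ha : IsPred g s b k' a) (hak : XKey.of k < (s.mem a).key) : IsPred g' s' b k' a := by
  unfold IsPred
  simp only [h.key, h.bkt]
  refine ⟨(h.blue a fun e => hak.ne' e.2).2 ha.1, ha.2.1, ha.2.2.1, fun z hz hzb hzk => ?_⟩
  by_cases hzk' : (s.mem z).key = XKey.of k
  · exact hzk' ▸ hak.le
  · exact ha.2.2.2 z ((h.blue z fun e => hzk' e.2).1 hz) hzb hzk

end SameBut

/-! ### Linking and unlinking a blue node -/

section Link

variable {g : Ghost Obj K V m} {s s' : Shared K V (Bucket Obj m)} {b : Option (Bucket Obj m)}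
  {k : K} {p c x : Addr (Bucket Obj m)}

theorem MemInv.link (hm : MemInv g s) (hp : IsPred g s b k p) (hc : IsSucc g s b k c)
    (hck : (s.mem c).key ≠ XKey.of k) (hx : NodeOf g s b x) (hxk : (s.mem x).key = XKey.of k)
    (hxbl : (s.mem x).bl = some c) :
    MemInv { g with blue := insert x g.blue }
      (s.modify p fun y => { y with bl := some x }) := by
  have hno := hc.key_ne hck
  have hxp : x ≠ p := fun e => hp.2.2.1.ne (e ▸ hxk)
  have hkey : ∀ y, ((s.modify p fun y => { y with bl := some x }).mem y).key = (s.mem y).key := by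
    intro y
    by_cases e : y = p <;> simp [Shared.modify, e]
  have hrl : ∀ y, ((s.modify p fun y => { y with bl := some x }).mem y).rl = (s.mem y).rl := by
    intro y
    by_cases e : y = p <;> simp [Shared.modify, e]
  have hbl : ∀ y, y ≠ p →
      ((s.modify p fun y => { y with bl := some x }).mem y).bl = (s.mem y).bl := by
    intro y e
    simp [Shared.modify, e]
  have hblp : ((s.modify p fun y => { y with bl := some x }).mem p).bl = some x := by
    simp [Shared.modify]
  have hcgt : XKey.of k < (s.mem c).key := lt_of_le_of_ne hc.2.2.1 (Ne.symm hck)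
  refine ⟨fun b => Or.inr (hm.head_mem b), fun b => ?_, hm.head_bkt, ?_, ?_, ?_, ?_, ?_, ?_⟩
  · rw [hkey]; exact hm.head_key b
  · rintro y (rfl | hy)
    · exact hx.1
    · exact hm.alloc y hy
  · intro y hy z hz hyz hk
    rw [hkey, hkey] at hk
    rcases hy with rfl | hy <;> rcases hz with rfl | hz
    · rfl
    · exact absurd (hk.symm.trans hxk) (hno z hz (hyz.symm.trans hx.2))
    · exact absurd (hk.trans hxk) (hno y hy (hyz.trans hx.2))
    · exact hm.inj y hy z hz hyz hk
  · intro y hy w hw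
    simp only [hkey]
    by_cases hyp : y = p
    · subst hyp
      rw [hblp] at hw
      cases hw
      refine ⟨Or.inl rfl, hx.2.trans hp.2.1.symm, hxk ▸ hp.2.2.1, ?_⟩
      rintro z (rfl | hz) hzb hzk
      · exact le_rfl
      · rw [hxk]
        by_contra hlt
        exact absurd (hp.2.2.2 z hz (hzb.trans hp.2.1) (not_le.1 hlt)) (not_le.2 hzk)
    · rw [hbl y hyp] at hw
      by_cases hyx : y = x
      · subst hyx
        rw [hxbl] at hw
        cases hw
        refine ⟨Or.inr hc.1, hc.2.1.trans hx.2.symm, hxk ▸ hcgt, ?_⟩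
        rintro z (rfl | hz) hzb hzk
        · exact absurd hzk (lt_irrefl _)
        · exact hc.2.2.2 z hz (hzb.trans hx.2) (hxk ▸ hzk.le)
      · have hy' : y ∈ g.blue := hy.resolve_left hyx
        obtain ⟨h1, h2, h3, h4⟩ := hm.next y hy' w hw
        refine ⟨Or.inr h1, h2, h3, ?_⟩
        rintro z (rfl | hz) hzb hzk
        · have hyb : g.bkt y = b := hzb.symm.trans hx.2
          rw [hxk] at hzk ⊢
          have l1 := hp.2.2.2 y hy' hyb hzk
          have l2 : (s.mem y).key < (s.mem p).key := lt_of_le_of_ne l1 fun e =>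
            hyp (hm.inj y hy' p hp.1 (hyb.trans hp.2.1.symm) e)
          exact (h4 p hp.1 (hp.2.1.trans hyb.symm) l2).trans hp.2.2.1.le
        · exact h4 z hz hzb hzk
  · intro y hy hk
    rw [hkey] at hk
    by_cases hyp : y = p
    · exact ⟨x, hyp ▸ hblp⟩
    · rw [hbl y hyp]
      rcases hy with rfl | hy
      · exact ⟨c, hxbl⟩
      · exact hm.total y hy hk
  · intro y hy w hw
    rw [hrl] at hw
    exact hm.rl y hy w hw
  · intro y hy w hw
    by_cases hyp : y = p
    · subst hyp
      rw [hblp] at hw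
      cases hw
      exact ⟨hx.1, hx.2.trans hp.2.1.symm⟩
    · rw [hbl y hyp] at hw
      exact hm.bl y hy w hw

theorem MemInv.unlink (hm : MemInv g s) (hp : IsPred g s b k p) (hc : IsSucc g s b k c)
    (hck : (s.mem c).key = XKey.of k) :
    MemInv { g with blue := g.blue \ {c} }
      (s.modify p fun y => { y with bl := (s.mem c).bl }) := by
  have hpc : p ≠ c := fun e => hp.2.2.1.ne (e ▸ hck)
  set s' := s.modify p fun y => { y with bl := (s.mem c).bl } with hs'
  have hkey : ∀ y, (s'.mem y).key = (s.mem y).key := by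
    intro y
    by_cases e : y = p <;> simp [hs', Shared.modify, e]
  have hrl : ∀ y, (s'.mem y).rl = (s.mem y).rl := by
    intro y
    by_cases e : y = p <;> simp [hs', Shared.modify, e]
  have hbl : ∀ y, y ≠ p → (s'.mem y).bl = (s.mem y).bl := by
    intro y e
    simp [hs', Shared.modify, e]
  have hblp : (s'.mem p).bl = (s.mem c).bl := by
    simp [hs', Shared.modify]
  obtain ⟨w, hw⟩ := hm.total c hc.1 (hck ▸ XKey.of_ne_top k)
  obtain ⟨hw1, hw2, hw3, hw4⟩ := hm.next c hc.1 w hw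
  have hbpc := hp.bl hm hc
  obtain ⟨hn1, hn2, hn3, hn4⟩ := hm.next p hp.1 c hbpc
  refine ⟨fun b => ⟨hm.head_mem b, ?_⟩, fun b => ?_, hm.head_bkt, fun x hx => hm.alloc x hx.1,
    ?_, ?_, ?_, ?_, ?_⟩
  · rintro rfl
    rw [hm.head_key] at hck
    exact (XKey.bot_lt_of k).ne hck
  · rw [hkey]; exact hm.head_key b
  · intro y hy z hz hyz hk
    rw [hkey, hkey] at hk
    exact hm.inj y hy.1 z hz.1 hyz hk
  · intro y hy v hv
    simp only [hkey]
    by_cases hyp : y = p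
    · subst hyp
      rw [hblp, hw] at hv
      cases hv
      refine ⟨⟨hw1, fun e => hw3.ne (by rw [e])⟩, hw2.trans hn2, hn3.trans hw3, ?_⟩
      intro z hz hzb hzk
      refine hw4 z hz.1 (hzb.trans hn2.symm) (lt_of_le_of_ne (hn4 z hz.1 hzb hzk) fun e => ?_)
      exact hz.2 (hm.inj z hz.1 c hc.1 (hzb.trans hn2.symm) e.symm)
    · rw [hbl y hyp] at hv
      obtain ⟨h1, h2, h3, h4⟩ := hm.next y hy.1 v hv
      refine ⟨⟨h1, ?_⟩, h2, h3, fun z hz => h4 z hz.1⟩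
      rintro rfl
      have hyb : g.bkt y = g.bkt p := h2.symm.trans hn2
      rcases lt_trichotomy (s.mem y).key (s.mem p).key with hlt | heq | hgt
      · exact absurd (h4 p hp.1 hyb.symm hlt) (not_le.2 hn3)
      · exact hyp (hm.inj y hy.1 p hp.1 hyb heq)
      · exact absurd (hn4 y hy.1 hyb hgt) (not_le.2 h3)
  · intro y hy hk
    rw [hkey] at hk
    by_cases hyp : y = p
    · exact ⟨w, by rw [hyp, hblp, hw]⟩
    · rw [hbl y hyp]
      exact hm.total y hy.1 hk
  · intro y hy v hv
    rw [hrl] at hv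
    exact hm.rl y hy v hv
  · intro y hy v hv
    by_cases hyp : y = p
    · subst hyp
      rw [hblp] at hv
      have := hm.bl c (hm.alloc c hc.1) v hv
      exact ⟨this.1, this.2.trans hn2⟩
    · rw [hbl y hyp] at hv
      exact hm.bl y hy v hv

end Link

/-! ### Locks -/

/-- The number of holds of `t` on the lock of `a`. -/
def holds (s : Shared K V (Bucket Obj m)) (t : Tx) (a : Addr (Bucket Obj m)) : ℕ :=
  match s.lockOf a with
  | none => 0
  | some (u, n) => if u = t then n else 0

theorem holds_lock {s s' : Shared K V (Bucket Obj m)} {t : Tx} {a : Addr (Bucket Obj m)}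
    (h : s.lock t a = some s') (u : Tx) (x : Addr (Bucket Obj m)) :
    holds s' u x = holds s u x + if u = t ∧ x = a then 1 else 0 := by
  unfold Shared.lock at h
  split at h
  · next hn =>
    cases h
    by_cases hx : x = a
    · subst hx
      by_cases hu : u = t
      · subst hu; simp [holds, hn]
      · simp [holds, hn, Ne.symm hu, hu]
    · simp [holds, hx]
  · next v n hn =>
    split at h
    · next hv =>
      cases h
      subst hv
      by_cases hx : x = a
      · subst hx
        by_cases hu : u = v
        · subst hu; simp [holds, hn]
        · simp [holds, hn, Ne.symm hu, hu]
      · simp [holds, hx]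
    · cases h

theorem holds_unlock (s : Shared K V (Bucket Obj m)) (t : Tx) (a : Addr (Bucket Obj m))
    (u : Tx) (x : Addr (Bucket Obj m)) :
    holds (s.unlock t a) u x = holds s u x - if u = t ∧ x = a then 1 else 0 := by
  unfold Shared.unlock
  split
  · next hn =>
    by_cases hx : x = a
    · subst hx; simp [holds, hn]
    · simp [holds, hx]
  · next v n hn =>
    split
    · next hv =>
      subst hv
      by_cases hx : x = a
      · subst hx
        by_cases hu : u = v
        · subst hu
          by_cases h1 : n ≤ 1
          · simp [holds, hn, h1]
          · simp [holds, hn, h1]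
        · by_cases h1 : n ≤ 1
          · simp [holds, hn, h1, Ne.symm hu]
          · simp [holds, hn, h1, Ne.symm hu, hu]
      · simp [holds, hx]
    · next hv =>
      by_cases hx : x = a
      · subst hx
        by_cases hu : u = t
        · subst hu; simp [holds, hn, hv]
        · simp [hu]
      · simp [hx]

theorem holds_exclusive {s : Shared K V (Bucket Obj m)} {t u : Tx} {a : Addr (Bucket Obj m)}
    (ht : 0 < holds s t a) (hu : 0 < holds s u a) : t = u := by
  unfold holds at ht hu
  split at ht
  · omega
  · next v n hn =>
    rw [hn] at hu
    simp only at hu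
    split_ifs at ht hu with h1 h2
    · exact h1.symm.trans h2
    all_goals omega

theorem lock_eq {s s' : Shared K V (Bucket Obj m)} {t : Tx} {a : Addr (Bucket Obj m)}
    (h : s.lock t a = some s') : s'.mem = s.mem ∧ s'.fresh = s.fresh := by
  unfold Shared.lock at h
  split at h
  · cases h; simp
  · split at h
    · cases h; simp
    · cases h

theorem unlock_eq (s : Shared K V (Bucket Obj m)) (t : Tx) (a : Addr (Bucket Obj m)) :
    (s.unlock t a).mem = s.mem ∧ (s.unlock t a).fresh = s.fresh := by
  unfold Shared.unlock
  split
  · simp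
  · split <;> simp

end Heap


section Local

variable {Obj K V : Type*} [DecidableEq Obj] [LinearOrder K] {m : ℕ}

/-! ### Locks held, nodes in transit and updates already visible at a program point -/

/-- The current entry has taken effect on the blue list. -/
def Phase.applied {B : Type*} : Phase B → Bool
  | .insStamp | .redStamp | .newStamp _ | .newField | .delStamp => true
  | _ => false

/-- The current entry together with the node that was created for it. -/
def procEntry (s : Shared K V (Bucket Obj m)) (cur : Located Obj K V (Bucket Obj m)) :
    Phase (Bucket Obj m) → Located Obj K V (Bucket Obj m)
  | .newStamp a => { cur with node := some a }
  | .newField => { cur with node := (s.mem cur.loc.bp).bl }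
  | _ => cur

/-- The locks held for the current entry. -/
def curHeld (s : Shared K V (Bucket Obj m)) (cur : Located Obj K V (Bucket Obj m)) :
    Phase (Bucket Obj m) → List (Addr (Bucket Obj m))
  | .bpLoad | .bpLock => [cur.loc.rp, cur.loc.rc, cur.loc.bc]
  | .rpLoad | .rpLock => [cur.loc.bp, cur.loc.rc, cur.loc.bc]
  | .newRed a | .newBlue a | .newStamp a =>
    [cur.loc.bp, cur.loc.rp] ++ [a] ++ [cur.loc.rc, cur.loc.bc]
  | .newField =>
    [cur.loc.bp, cur.loc.rp] ++ (s.mem cur.loc.bp).bl.toList ++ [cur.loc.rc, cur.loc.bc]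
  | _ => [cur.loc.bp, cur.loc.rp, cur.loc.rc, cur.loc.bc]

/-- The locks held after a release of locks. -/
def Cont.held : Cont Obj K V (Bucket Obj m) → List (Addr (Bucket Obj m))
  | .retry c => c.heldBefore
  | _ => []

/-- The locks held at a program point, with multiplicity. -/
def held (s : Shared K V (Bucket Obj m)) : PC Obj K V (Bucket Obj m) → List (Addr (Bucket Obj m))
  | .search c | .blueWalk c _ _ | .redStart c _ _ | .redWalk c _ => c.heldBefore
  | .acquire c loc todo => loc.nodes.diff todo ++ c.heldBefore
  | .validate c loc _ => loc.nodes ++ c.heldBefore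
  | .release _ todo k => todo ++ k.held
  | .rvStamp loc _ _ | .rvValue loc | .rvNew loc | .rvLink loc _ => loc.nodes
  | .commit done cur rest ph => orderedLocks done ++ curHeld s cur ph ++ orderedLocks rest
  | _ => []

/-- The node whose mark need not agree with its membership in the blue list. -/
def midPhase (cur : Located Obj K V (Bucket Obj m)) :
    Phase (Bucket Obj m) → Option (Addr (Bucket Obj m))
  | .redBlue | .redLink => some cur.loc.rc
  | .newRed a | .newBlue a => some a
  | .delLoad | .delLink _ => some cur.loc.bc
  | _ => none

def mid : PC Obj K V (Bucket Obj m) → Option (Addr (Bucket Obj m))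
  | .commit _ cur _ ph => midPhase cur ph
  | _ => none

/-- The updates that have taken effect on the blue lists, but are not yet committed. -/
def pend (log : List (Entry Obj K V)) : PC Obj K V (Bucket Obj m) → List (Entry Obj K V)
  | .commit done cur _ ph =>
    done.map Located.ent ++ if ph.applied then [cur.ent] else []
  | .release true _ .committed => orderedLL log
  | _ => []

/-! ### Local invariants -/

/-- The caller is a lookup or delete on a pair without log entry. -/
def RvOp (op : Op Obj K V) (log : List (Entry Obj K V)) (o : Obj) (k : K) : Prop :=
  (op = .lookup o k ∨ op = .delete o k) ∧ findInLL log o k = none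

/-- A location in the bucket of `⟨o, k⟩`. -/
structure LocOK (hash : Obj → K → Fin m) (g : Ghost Obj K V m) (s : Shared K V (Bucket Obj m))
    (o : Obj) (k : K) (loc : Loc (Bucket Obj m)) : Prop where
  bp : NodeOf g s (bucket hash o k) loc.bp
  rp : NodeOf g s (bucket hash o k) loc.rp
  rc : NodeOf g s (bucket hash o k) loc.rc
  bc : NodeOf g s (bucket hash o k) loc.bc
  key : (s.mem loc.bp).key < XKey.of k
  key_bc : XKey.of k ≤ (s.mem loc.bc).key

/-- The location is the place of `⟨o, k⟩` in the blue list. -/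
def Found (hash : Obj → K → Fin m) (g : Ghost Obj K V m) (s : Shared K V (Bucket Obj m))
    (o : Obj) (k : K) (loc : Loc (Bucket Obj m)) : Prop :=
  IsPred g s (bucket hash o k) k loc.bp ∧ IsSucc g s (bucket hash o k) k loc.bc

def CallerOK (hash : Obj → K → Fin m) (g : Ghost Obj K V m) (s : Shared K V (Bucket Obj m))
    (op : Op Obj K V) (log : List (Entry Obj K V)) : Caller Obj K V (Bucket Obj m) → Prop
  | .rv o k => RvOp op log o k
  | .tryC located e rest => op = .tryC ∧ orderedLL log = located.map Located.ent ++ e :: rest ∧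
      ∀ p ∈ located, LocOK hash g s p.ent.obj p.ent.key p.loc ∧
        Found hash g s p.ent.obj p.ent.key p.loc ∧ p.node = none

/-- `a` is the last node with a key up to that of the entry treated last in the bucket of `p`. -/
def Frontier (hash : Obj → K → Fin m) (g : Ghost Obj K V m) (s : Shared K V (Bucket Obj m))
    (done : List (Located Obj K V (Bucket Obj m))) (p : Located Obj K V (Bucket Obj m))
    (a : Addr (Bucket Obj m)) : Prop :=
  ∃ q, prevInBucket hash done p = some q ∧ (s.mem a).key ≤ XKey.of q.ent.key ∧
    q.loc.bp ∈ g.blue ∧ a ∈ orderedLocks done ∧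
    if q.ent.opn = .insert then (s.mem q.loc.bp).bl = some a else a = q.loc.bp

/-- The entries `done` have taken effect, the entries `rest` are still to come. -/
structure CommitOK (hash : Obj → K → Fin m) (g : Ghost Obj K V m) (s : Shared K V (Bucket Obj m))
    (op : Op Obj K V) (log : List (Entry Obj K V))
    (done rest : List (Located Obj K V (Bucket Obj m))) : Prop where
  op : op = .tryC
  log : orderedLL log = (done ++ rest).map Located.ent
  loc : ∀ p ∈ done ++ rest, LocOK hash g s p.ent.obj p.ent.key p.loc
  owned : ∀ p ∈ done, IsPred g s (bucket hash p.ent.obj p.ent.key) p.ent.key p.loc.bp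
  node : ∀ p ∈ rest, p.node = none
  succ : ∀ p ∈ rest, IsSucc g s (bucket hash p.ent.obj p.ent.key) p.ent.key p.loc.bc
  pred : ∀ p ∈ rest, ∃ a, IsPred g s (bucket hash p.ent.obj p.ent.key) p.ent.key a ∧
    (a = p.loc.bp ∨ Frontier hash g s done p a)

/-- The created or revived node `a` carries the key and value of the entry. -/
def FreshOK (hash : Obj → K → Fin m) (g : Ghost Obj K V m) (s : Shared K V (Bucket Obj m))
    (cur : Located Obj K V (Bucket Obj m)) (a : Addr (Bucket Obj m)) : Prop :=
  NodeOf g s (bucket hash cur.ent.obj cur.ent.key) a ∧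
    (s.mem a).key = XKey.of cur.ent.key ∧ (s.mem a).value = cur.ent.value

def PhaseOK (hash : Obj → K → Fin m) (g : Ghost Obj K V m) (s : Shared K V (Bucket Obj m))
    (done : List (Located Obj K V (Bucket Obj m))) (cur : Located Obj K V (Bucket Obj m))
    (ph : Phase (Bucket Obj m)) : Prop :=
  let b := bucket hash cur.ent.obj cur.ent.key
  let P := IsPred g s b cur.ent.key cur.loc.bp
  let k := XKey.of cur.ent.key
  match ph with
  | .chkMarked => True
  | .chkBlue => cur.loc.bp ∈ g.blue
  | .bpUnlock | .bpLoad => ∃ a, IsPred g s b cur.ent.key a ∧ Frontier hash g s done cur a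
  | .bpLock => P ∧ cur.loc.bp ∈ orderedLocks done
  | .chkRed | .rpUnlock | .rpLoad | .rpLock | .apply => P
  | .insValue => P ∧ cur.ent.opn = .insert ∧ (s.mem cur.loc.bc).key = k
  | .redValue =>
    P ∧ cur.ent.opn = .insert ∧ (s.mem cur.loc.bc).key ≠ k ∧ (s.mem cur.loc.rc).key = k
  | .redUnmark =>
    P ∧ cur.ent.opn = .insert ∧ (s.mem cur.loc.bc).key ≠ k ∧ FreshOK hash g s cur cur.loc.rc
  | .redBlue =>
    P ∧ cur.ent.opn = .insert ∧ (s.mem cur.loc.bc).key ≠ k ∧ FreshOK hash g s cur cur.loc.rc ∧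
      (s.mem cur.loc.rc).marked = false
  | .redLink =>
    P ∧ cur.ent.opn = .insert ∧ (s.mem cur.loc.bc).key ≠ k ∧ FreshOK hash g s cur cur.loc.rc ∧
      (s.mem cur.loc.rc).marked = false ∧ (s.mem cur.loc.rc).bl = some cur.loc.bc
  | .newNode => P ∧ cur.ent.opn = .insert ∧ (s.mem cur.loc.bc).key ≠ k
  | .newRed a | .newBlue a =>
    P ∧ cur.ent.opn = .insert ∧ (s.mem cur.loc.bc).key ≠ k ∧ FreshOK hash g s cur a ∧
      (s.mem a).marked = false ∧ (s.mem a).bl = some cur.loc.bc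
  | .newStamp a => (s.mem cur.loc.bp).bl = some a
  | .delMark => P ∧ cur.ent.opn ≠ .insert ∧ (s.mem cur.loc.bc).key = k
  | .delLoad =>
    P ∧ cur.ent.opn ≠ .insert ∧ (s.mem cur.loc.bc).key = k ∧ (s.mem cur.loc.bc).marked = true
  | .delLink x =>
    P ∧ cur.ent.opn ≠ .insert ∧ (s.mem cur.loc.bc).key = k ∧
      (s.mem cur.loc.bc).marked = true ∧ (s.mem cur.loc.bc).bl = x
  | .insStamp | .redStamp | .newField | .delStamp => True

/-- What follows a release of the locks `todo`. -/
def ContOK (hash : Obj → K → Fin m) (g : Ghost Obj K V m) (s : Shared K V (Bucket Obj m))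
    (op : Op Obj K V) (log : List (Entry Obj K V)) (lp : Bool) (todo : List (Addr (Bucket Obj m))) :
    Cont Obj K V (Bucket Obj m) → Prop
  | .retry c => lp = false ∧ CallerOK hash g s op log c
  | .rv v => lp = true → ∃ o k, RvOp op log o k ∧ v = g.abs o k ∧
      ∃ a ∈ todo, IsPred g s (bucket hash o k) k a
  | .committed => lp = true → op = .tryC ∧ ∀ e ∈ orderedLL log, ∃ a ∈ todo,
      IsPred g s (bucket hash e.obj e.key) e.key a
  | .aborted => True

def PCOK (hash : Obj → K → Fin m) (g : Ghost Obj K V m) (s : Shared K V (Bucket Obj m))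
    (op : Op Obj K V) (log : List (Entry Obj K V)) : PC Obj K V (Bucket Obj m) → Prop
  | .search c => CallerOK hash g s op log c
  | .blueWalk c bp bc => CallerOK hash g s op log c ∧
      NodeOf g s (bucket hash c.target.1 c.target.2) bp ∧
      NodeOf g s (bucket hash c.target.1 c.target.2) bc ∧ (s.mem bp).key < XKey.of c.target.2
  | .redStart c bp bc => CallerOK hash g s op log c ∧
      NodeOf g s (bucket hash c.target.1 c.target.2) bp ∧
      NodeOf g s (bucket hash c.target.1 c.target.2) bc ∧ (s.mem bp).key < XKey.of c.target.2 ∧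
      XKey.of c.target.2 ≤ (s.mem bc).key
  | .redWalk c loc => CallerOK hash g s op log c ∧ LocOK hash g s c.target.1 c.target.2 loc
  | .acquire c loc todo => CallerOK hash g s op log c ∧
      LocOK hash g s c.target.1 c.target.2 loc ∧ todo <:+ loc.nodes
  | .validate c loc todo => CallerOK hash g s op log c ∧
      LocOK hash g s c.target.1 c.target.2 loc ∧ (.bpMarked ∈ todo ∨ loc.bp ∈ g.blue) ∧
      (.bpBlue ∈ todo ∨ (s.mem loc.bp).bl = some loc.bc)
  | .release lp todo k => ContOK hash g s op log lp todo k
  | .rvStamp loc _ blue => ∃ o k, RvOp op log o k ∧ LocOK hash g s o k loc ∧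
      Found hash g s o k loc ∧ (blue = true ↔ (s.mem loc.bc).key = XKey.of k)
  | .rvValue loc => ∃ o k, RvOp op log o k ∧ LocOK hash g s o k loc ∧
      Found hash g s o k loc ∧ (s.mem loc.bc).key = XKey.of k
  | .rvNew loc => ∃ o k, RvOp op log o k ∧ LocOK hash g s o k loc ∧
      Found hash g s o k loc ∧ (s.mem loc.bc).key ≠ XKey.of k
  | .rvLink loc a => ∃ o k, RvOp op log o k ∧ LocOK hash g s o k loc ∧
      Found hash g s o k loc ∧ (s.mem loc.bc).key ≠ XKey.of k ∧
      NodeOf g s (bucket hash o k) a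
  | .commit done cur rest ph =>
      CommitOK hash g s op log (if ph.applied then done ++ [procEntry s cur ph] else done)
        (if ph.applied then rest else cur :: rest) ∧ PhaseOK hash g s done cur ph ∧ cur.node = none
  | _ => True

/-! ### Steps of other transactions -/

/-- From `(g, s)` to `(g', s')` nothing is changed that concerns the nodes in `P`. -/
structure Frame (hash : Obj → K → Fin m) (g : Ghost Obj K V m) (s : Shared K V (Bucket Obj m))
    (g' : Ghost Obj K V m) (s' : Shared K V (Bucket Obj m)) (P : Addr (Bucket Obj m) → Prop) :
    Prop where
  ext : ∀ x, Alloc s x →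
    Alloc s' x ∧ g'.bkt x = g.bkt x ∧ (s'.mem x).key = (s.mem x).key
  bl : ∀ x, P x → (s'.mem x).bl = (s.mem x).bl
  value : ∀ x, P x → (s'.mem x).value = (s.mem x).value
  marked : ∀ x, P x → (s'.mem x).marked = (s.mem x).marked
  blue : ∀ x, P x → x ∈ g.blue → x ∈ g'.blue
  pred : ∀ b k a, P a → IsPred g s b k a → IsPred g' s' b k a
  succ : ∀ b k a c, P a → P c → IsPred g s b k a → IsSucc g s b k c → IsSucc g' s' b k c
  abs : ∀ o k a, P a → IsPred g s (bucket hash o k) k a → g'.abs o k = g.abs o k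

section Frame

variable {hash : Obj → K → Fin m} {g g' : Ghost Obj K V m} {s s' : Shared K V (Bucket Obj m)}
  {P : Addr (Bucket Obj m) → Prop} {op : Op Obj K V} {log : List (Entry Obj K V)}

theorem Frame.nodeOf (h : Frame hash g s g' s' P) {b : Option (Bucket Obj m)} {x : Addr (Bucket Obj m)}
    (hx : NodeOf g s b x) : NodeOf g' s' b x :=
  ⟨(h.ext x hx.1).1, (h.ext x hx.1).2.1.trans hx.2⟩

theorem Frame.key (h : Frame hash g s g' s' P) {b : Option (Bucket Obj m)} {x : Addr (Bucket Obj m)}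
    (hx : NodeOf g s b x) : (s'.mem x).key = (s.mem x).key := (h.ext x hx.1).2.2

theorem LocOK.frame (h : Frame hash g s g' s' P) {o : Obj} {k : K} {loc : Loc (Bucket Obj m)}
    (hl : LocOK hash g s o k loc) : LocOK hash g' s' o k loc :=
  ⟨h.nodeOf hl.bp, h.nodeOf hl.rp, h.nodeOf hl.rc, h.nodeOf hl.bc,
    by rw [h.key hl.bp]; exact hl.key, by rw [h.key hl.bc]; exact hl.key_bc⟩

theorem Found.frame (h : Frame hash g s g' s' P) {o : Obj} {k : K} {loc : Loc (Bucket Obj m)}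
    (hbp : P loc.bp) (hbc : P loc.bc)
    (hl : Found hash g s o k loc) : Found hash g' s' o k loc :=
  ⟨h.pred _ _ _ hbp hl.1, h.succ _ _ _ _ hbp hbc hl.1 hl.2⟩

theorem mem_orderedLocks {les : List (Located Obj K V (Bucket Obj m))}
    {p : Located Obj K V (Bucket Obj m)} (hp : p ∈ les) {x : Addr (Bucket Obj m)}
    (hx : x ∈ p.loc.nodes) : x ∈ orderedLocks les := by
  refine List.mem_flatMap.2 ⟨p, hp, ?_⟩
  simp only [Loc.nodes, List.mem_cons, List.not_mem_nil, or_false] at hx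
  simp only [List.mem_append, List.mem_cons, List.not_mem_nil, or_false]
  tauto

theorem CallerOK.frame (h : Frame hash g s g' s' P) {c : Caller Obj K V (Bucket Obj m)}
    (hP : ∀ x ∈ c.heldBefore, P x) (hc : CallerOK hash g s op log c) :
    CallerOK hash g' s' op log c := by
  cases c with
  | rv o k => exact hc
  | tryC located e rest =>
    obtain ⟨h1, h2, h3⟩ := hc
    refine ⟨h1, h2, fun p hp => ⟨(h3 p hp).1.frame h, ?_, (h3 p hp).2.2⟩⟩
    exact (h3 p hp).2.1.frame h (hP _ (mem_orderedLocks hp (by simp [Loc.nodes])))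
      (hP _ (mem_orderedLocks hp (by simp [Loc.nodes])))

theorem mem_of_prevInBucket {done : List (Located Obj K V (Bucket Obj m))}
    {p q : Located Obj K V (Bucket Obj m)} (h : prevInBucket hash done p = some q) :
    q ∈ done ∧ bucket hash q.ent.obj q.ent.key = bucket hash p.ent.obj p.ent.key := by
  unfold prevInBucket at h
  refine ⟨List.mem_reverse.1 (List.mem_of_find?_eq_some h), ?_⟩
  have := List.find?_some h
  exact of_decide_eq_true this

theorem Frontier.frame (h : Frame hash g s g' s' P) {done : List (Located Obj K V (Bucket Obj m))}
    {p : Located Obj K V (Bucket Obj m)} {a : Addr (Bucket Obj m)}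
    (hP : ∀ x ∈ orderedLocks done, P x) (ha : Alloc s a) (hf : Frontier hash g s done p a) :
    Frontier hash g' s' done p a := by
  obtain ⟨q, h1, h2, h3, h4, h5⟩ := hf
  have hq := hP _ (mem_orderedLocks (mem_of_prevInBucket h1).1 (x := q.loc.bp) (by simp [Loc.nodes]))
  refine ⟨q, h1, ?_, h.blue _ hq h3, h4, ?_⟩
  · rw [(h.ext a ha).2.2]; exact h2
  · rw [h.bl _ hq]; exact h5

theorem CommitOK.frame (hm : MemInv g s) (h : Frame hash g s g' s' P)
    {done rest : List (Located Obj K V (Bucket Obj m))}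
    (hd : ∀ x ∈ orderedLocks done, P x)
    (hbp : ∀ p ∈ rest, p.loc.bp ∈ g.blue → P p.loc.bp ∨
      ∃ a, IsPred g s (bucket hash p.ent.obj p.ent.key) p.ent.key a ∧ Frontier hash g s done p a)
    (hbc : ∀ p ∈ rest, P p.loc.bc)
    (hc : CommitOK hash g s op log done rest) : CommitOK hash g' s' op log done rest := by
  have hpred : ∀ p ∈ rest, ∃ a, IsPred g s (bucket hash p.ent.obj p.ent.key) p.ent.key a ∧ P a ∧
      (a = p.loc.bp ∨ Frontier hash g s done p a) := by
    intro p hp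
    obtain ⟨a, ha, hor⟩ := hc.pred p hp
    rcases hor with rfl | hor
    · rcases hbp p hp ha.1 with h1 | ⟨a', ha', hf⟩
      · exact ⟨_, ha, h1, Or.inl rfl⟩
      · exact ⟨a', ha', hd _ hf.choose_spec.2.2.2.1, Or.inr hf⟩
    · exact ⟨a, ha, hd _ hor.choose_spec.2.2.2.1, Or.inr hor⟩
  refine ⟨hc.op, hc.log, fun p hp => (hc.loc p hp).frame h, fun p hp => ?_, hc.node, ?_, ?_⟩
  · exact h.pred _ _ _ (hd _ (mem_orderedLocks hp (by simp [Loc.nodes]))) (hc.owned p hp)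
  · intro p hp
    obtain ⟨a, ha, hPa, -⟩ := hpred p hp
    exact h.succ _ _ _ _ hPa (hbc p hp) ha (hc.succ p hp)
  · intro p hp
    obtain ⟨a, ha, hPa, hor⟩ := hpred p hp
    exact ⟨a, h.pred _ _ _ hPa ha, hor.imp id fun hf => hf.frame h hd (hm.alloc _ ha.1)⟩

theorem FreshOK.frame (h : Frame hash g s g' s' P) {cur : Located Obj K V (Bucket Obj m)}
    {a : Addr (Bucket Obj m)} (ha : P a) (hf : FreshOK hash g s cur a) :
    FreshOK hash g' s' cur a :=
  ⟨h.nodeOf hf.1, (h.key hf.1).trans hf.2.1, (h.value a ha).trans hf.2.2⟩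

end Frame

end Local


section Frame

variable {Obj K V : Type*} [DecidableEq Obj] [LinearOrder K] {m : ℕ}
variable {hash : Obj → K → Fin m} {g g' : Ghost Obj K V m} {s s' : Shared K V (Bucket Obj m)}
  {P : Addr (Bucket Obj m) → Prop} {op : Op Obj K V} {log : List (Entry Obj K V)}

theorem PhaseOK.frame (h : Frame hash g s g' s' P) (hm : MemInv g s)
    {done : List (Located Obj K V (Bucket Obj m))}
    {cur : Located Obj K V (Bucket Obj m)} {ph : Phase (Bucket Obj m)}
    (hl : LocOK hash g s cur.ent.obj cur.ent.key cur.loc)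
    (hd : ∀ x ∈ orderedLocks done, P x) (hP : ∀ x ∈ curHeld s cur ph, P x)
    (hc : PhaseOK hash g s done cur ph) : PhaseOK hash g' s' done cur ph := by
  have kbc := h.key hl.bc
  have krc := h.key hl.rc
  cases ph <;> simp only [PhaseOK, curHeld, List.mem_cons, List.not_mem_nil, or_false,
    forall_eq_or_imp, forall_eq, List.cons_append, List.nil_append, kbc, krc] at hc hP ⊢
  case chkBlue => exact h.blue _ hP.1 hc
  case bpUnlock =>
    obtain ⟨a, ha, hf⟩ := hc
    exact ⟨a, h.pred _ _ _ (hd _ hf.choose_spec.2.2.2.1) ha, hf.frame h hd (hm.alloc _ ha.1)⟩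
  case bpLoad =>
    obtain ⟨a, ha, hf⟩ := hc
    exact ⟨a, h.pred _ _ _ (hd _ hf.choose_spec.2.2.2.1) ha, hf.frame h hd (hm.alloc _ ha.1)⟩
  case bpLock => exact ⟨h.pred _ _ _ (hd _ hc.2) hc.1, hc.2⟩
  case chkRed | rpUnlock | rpLoad | rpLock | apply => exact h.pred _ _ _ hP.1 hc
  case insValue | redValue | newNode | delMark =>
    exact ⟨h.pred _ _ _ hP.1 hc.1, hc.2⟩
  case redUnmark =>
    exact ⟨h.pred _ _ _ hP.1 hc.1, hc.2.1, hc.2.2.1, hc.2.2.2.frame h hP.2.2.1⟩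
  case redBlue =>
    rw [h.marked _ hP.2.2.1]
    exact ⟨h.pred _ _ _ hP.1 hc.1, hc.2.1, hc.2.2.1, hc.2.2.2.1.frame h hP.2.2.1, hc.2.2.2.2⟩
  case redLink =>
    rw [h.marked _ hP.2.2.1, h.bl _ hP.2.2.1]
    exact ⟨h.pred _ _ _ hP.1 hc.1, hc.2.1, hc.2.2.1, hc.2.2.2.1.frame h hP.2.2.1, hc.2.2.2.2⟩
  case newRed a | newBlue a =>
    rw [h.marked _ hP.2.2.1, h.bl _ hP.2.2.1]
    exact ⟨h.pred _ _ _ hP.1 hc.1, hc.2.1, hc.2.2.1, hc.2.2.2.1.frame h hP.2.2.1, hc.2.2.2.2⟩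
  case newStamp a =>
    rw [h.bl _ hP.1]
    exact hc
  case delLoad =>
    rw [h.marked _ hP.2.2.2]
    exact ⟨h.pred _ _ _ hP.1 hc.1, hc.2⟩
  case delLink =>
    rw [h.marked _ hP.2.2.2, h.bl _ hP.2.2.2]
    exact ⟨h.pred _ _ _ hP.1 hc.1, hc.2⟩

theorem procEntry_ent (s : Shared K V (Bucket Obj m)) (cur : Located Obj K V (Bucket Obj m))
    (ph : Phase (Bucket Obj m)) : (procEntry s cur ph).ent = cur.ent := by
  cases ph <;> rfl

theorem procEntry_loc (s : Shared K V (Bucket Obj m)) (cur : Located Obj K V (Bucket Obj m))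
    (ph : Phase (Bucket Obj m)) : (procEntry s cur ph).loc = cur.loc := by
  cases ph <;> rfl

theorem orderedLocks_append (l l' : List (Located Obj K V (Bucket Obj m))) :
    orderedLocks (l ++ l') = orderedLocks l ++ orderedLocks l' := by
  simp [orderedLocks]

theorem PCOK.locOK_cur {done rest : List (Located Obj K V (Bucket Obj m))}
    {cur : Located Obj K V (Bucket Obj m)} {ph : Phase (Bucket Obj m)}
    (h : PCOK hash g s op log (.commit done cur rest ph)) :
    LocOK hash g s cur.ent.obj cur.ent.key cur.loc := by
  obtain ⟨h, -⟩ := h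
  cases hph : ph.applied <;> simp only [hph, if_true, if_false, Bool.false_eq_true] at h
  · exact h.loc cur (by simp)
  · have := h.loc (procEntry s cur ph) (by simp)
    rwa [procEntry_ent, procEntry_loc] at this

theorem held_frame (h : Frame hash g s g' s' P) {pc : PC Obj K V (Bucket Obj m)}
    (hP : ∀ x ∈ held s pc, P x) : held s' pc = held s pc := by
  cases pc <;> try rfl
  case commit done cur rest ph =>
    cases ph <;> try rfl
    simp only [held, curHeld, List.mem_append, List.mem_cons, or_imp, forall_and, forall_eq] at hP
    simp [held, curHeld, h.bl _ hP.1.2.1.1.1]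

theorem orderedLocks_procEntry {cur : Located Obj K V (Bucket Obj m)} {ph : Phase (Bucket Obj m)}
    (hph : ph.applied = true) (hn : cur.node = none) :
    orderedLocks [procEntry s cur ph] = curHeld s cur ph := by
  cases ph <;> simp [Phase.applied] at hph <;> simp [orderedLocks, procEntry, curHeld, hn]

theorem procEntry_frame (h : Frame hash g s g' s' P) {cur : Located Obj K V (Bucket Obj m)}
    {ph : Phase (Bucket Obj m)} (hph : ph.applied = true) (hP : ∀ x ∈ curHeld s cur ph, P x) :
    procEntry s' cur ph = procEntry s cur ph := by
  cases ph <;> simp [Phase.applied] at hph <;> try rfl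
  simp only [curHeld, List.mem_append, List.mem_cons, or_imp, forall_and, forall_eq] at hP
  simp [procEntry, h.bl _ hP.1.1.1]

theorem bc_mem_curHeld (s : Shared K V (Bucket Obj m)) (cur : Located Obj K V (Bucket Obj m))
    (ph : Phase (Bucket Obj m)) : cur.loc.bc ∈ curHeld s cur ph := by
  cases ph <;> simp [curHeld]

theorem PCOK.frame (h : Frame hash g s g' s' P) (hm : MemInv g s)
    {pc : PC Obj K V (Bucket Obj m)} (hP : ∀ x ∈ held s pc, P x)
    (hc : PCOK hash g s op log pc) : PCOK hash g' s' op log pc := by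
  cases pc with
  | unborn | ready | finished | invoked | respond | rvLog => trivial
  | search c => exact CallerOK.frame h hP hc
  | blueWalk c bp bc =>
    obtain ⟨h1, h2, h3, h4⟩ := hc
    exact ⟨h1.frame h hP, h.nodeOf h2, h.nodeOf h3, by rwa [h.key h2]⟩
  | redStart c bp bc =>
    obtain ⟨h1, h2, h3, h4, h5⟩ := hc
    exact ⟨h1.frame h hP, h.nodeOf h2, h.nodeOf h3, by rwa [h.key h2], by rwa [h.key h3]⟩
  | redWalk c loc => exact ⟨hc.1.frame h hP, hc.2.frame h⟩
  | acquire c loc todo =>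
    exact ⟨hc.1.frame h fun x hx => hP x (List.mem_append_right _ hx), hc.2.1.frame h, hc.2.2⟩
  | validate c loc todo =>
    have hbp : P loc.bp := hP _ (List.mem_append_left _ (by simp [Loc.nodes]))
    obtain ⟨h1, h2, h3, h4⟩ := hc
    refine ⟨h1.frame h fun x hx => hP x (List.mem_append_right _ hx), h2.frame h,
      h3.imp id (h.blue _ hbp), ?_⟩
    rw [h.bl _ hbp]; exact h4
  | release lp todo k =>
    cases k with
    | retry c => exact ⟨hc.1, hc.2.frame h fun x hx => hP x (List.mem_append_right _ hx)⟩
    | rv v =>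
      intro hlp
      obtain ⟨o, k, h1, h2, a, ha, hpa⟩ := hc hlp
      have hPa := hP a (List.mem_append_left _ ha)
      exact ⟨o, k, h1, h2.trans (h.abs _ _ a hPa hpa).symm, a, ha, h.pred _ _ _ hPa hpa⟩
    | committed =>
      intro hlp
      refine ⟨(hc hlp).1, fun e he => ?_⟩
      obtain ⟨a, ha, hpa⟩ := (hc hlp).2 e he
      exact ⟨a, ha, h.pred _ _ _ (hP a (List.mem_append_left _ ha)) hpa⟩
    | aborted => trivial
  | rvStamp loc a blue =>
    obtain ⟨o, k, h1, h2, h3, h4⟩ := hc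
    refine ⟨o, k, h1, h2.frame h, h3.frame h (hP _ ?_) (hP _ ?_), ?_⟩
    · simp [held, Loc.nodes]
    · simp [held, Loc.nodes]
    · rw [h.key h2.bc]; exact h4
  | rvValue loc =>
    obtain ⟨o, k, h1, h2, h3, h4⟩ := hc
    refine ⟨o, k, h1, h2.frame h, h3.frame h (hP _ ?_) (hP _ ?_), ?_⟩
    · simp [held, Loc.nodes]
    · simp [held, Loc.nodes]
    · rw [h.key h2.bc]; exact h4
  | rvNew loc =>
    obtain ⟨o, k, h1, h2, h3, h4⟩ := hc
    refine ⟨o, k, h1, h2.frame h, h3.frame h (hP _ ?_) (hP _ ?_), ?_⟩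
    · simp [held, Loc.nodes]
    · simp [held, Loc.nodes]
    · rw [h.key h2.bc]; exact h4
  | rvLink loc a =>
    obtain ⟨o, k, h1, h2, h3, h4, h5⟩ := hc
    refine ⟨o, k, h1, h2.frame h, h3.frame h (hP _ ?_) (hP _ ?_), ?_, h.nodeOf h5⟩
    · simp [held, Loc.nodes]
    · simp [held, Loc.nodes]
    · rw [h.key h2.bc]; exact h4
  | commit done cur rest ph =>
    have hloc := hc.locOK_cur
    have hd : ∀ x ∈ orderedLocks done, P x := fun x hx =>
      hP x (List.mem_append_left _ (List.mem_append_left _ hx))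
    have hcu : ∀ x ∈ curHeld s cur ph, P x := fun x hx =>
      hP x (List.mem_append_left _ (List.mem_append_right _ hx))
    have hr : ∀ x ∈ orderedLocks rest, P x := fun x hx => hP x (List.mem_append_right _ hx)
    have hr1 : ∀ p ∈ rest, P p.loc.bp := fun p hp => hr _ (mem_orderedLocks hp (by simp [Loc.nodes]))
    have hr2 : ∀ p ∈ rest, P p.loc.bc := fun p hp => hr _ (mem_orderedLocks hp (by simp [Loc.nodes]))
    obtain ⟨h1, h2, h3⟩ := hc
    refine ⟨?_, h2.frame h hm hloc hd hcu, h3⟩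
    cases hph : ph.applied <;> simp only [hph, if_true, if_false, Bool.false_eq_true] at h1 ⊢
    · refine h1.frame hm h hd ?_ ?_
      · intro p hp hb
        rcases List.mem_cons.1 hp with rfl | hp
        · cases ph <;> simp [Phase.applied] at hph
          case bpLoad => exact Or.inr h2
          case bpLock => exact Or.inl (hd _ h2.2)
          all_goals exact Or.inl (hcu _ (by simp [curHeld]))
        · exact Or.inl (hr1 p hp)
      · intro p hp
        rcases List.mem_cons.1 hp with rfl | hp
        · exact hcu _ (bc_mem_curHeld s p ph)
        · exact hr2 p hp
    · rw [procEntry_frame h hph hcu]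
      refine h1.frame hm h ?_ (fun p hp _ => Or.inl (hr1 p hp)) hr2
      intro x hx
      rw [orderedLocks_append, orderedLocks_procEntry hph h3] at hx
      exact (List.mem_append.1 hx).elim (hd x) (hcu x)

end Frame


section Invariant

variable {Obj K V : Type*} [DecidableEq Obj] [LinearOrder K] {m : ℕ}

/-- A log has at most one entry per pair. -/
def LogWF (log : List (Entry Obj K V)) : Prop :=
  log.Pairwise fun e e' => ¬ (e.obj = e'.obj ∧ e.key = e'.key)

theorem orderedLL_perm (log : List (Entry Obj K V)) :
    (orderedLL log).Perm (log.filter fun e => decide (e.opn ≠ .lookup)) :=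
  List.perm_insertionSort _ _

theorem mem_orderedLL {log : List (Entry Obj K V)} {e : Entry Obj K V} :
    e ∈ orderedLL log ↔ e ∈ log ∧ e.opn ≠ .lookup := by
  rw [(orderedLL_perm log).mem_iff]
  simp

theorem orderedLL_pairwise {log : List (Entry Obj K V)} (h : LogWF log) :
    (orderedLL log).Pairwise fun e e' => e.obj = e'.obj → e.key < e'.key := by
  have h1 : (orderedLL log).Pairwise fun e e' => e.key ≤ e'.key :=
    List.pairwise_insertionSort _ _
  have h2 : (orderedLL log).Pairwise fun e e' => ¬ (e.obj = e'.obj ∧ e.key = e'.key) := by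
    refine ((orderedLL_perm log).pairwise_iff ?_).2 (h.filter _)
    intro a b hab e
    exact hab ⟨e.1.symm, e.2.symm⟩
  exact (h1.and h2).imp fun hab e => lt_of_le_of_ne hab.1 fun e' => hab.2 ⟨e, e'⟩

/-- The blue lists hold the committed values, changed by the updates `pd` in progress. -/
def ValOK (hash : Obj → K → Fin m) (g : Ghost Obj K V m) (s : Shared K V (Bucket Obj m))
    (pd : Entry Obj K V → Prop) : Prop :=
  ∀ o k, (∀ e, pd e → e.obj = o → e.key = k → Holds hash g s o k e.seen) ∧
    ((∀ e, pd e → ¬ (e.obj = o ∧ e.key = k)) → Holds hash g s o k (g.abs o k))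

structure Inv (hash : Obj → K → Fin m) (c : Config Obj K V m) (g : Ghost Obj K V m) : Prop where
  mem : MemInv g c.shared
  lock : ∀ t a, holds c.shared t a = (held c.shared (c.loc t).pc).count a
  alloc : ∀ t, ∀ a ∈ held c.shared (c.loc t).pc, Alloc c.shared a
  pc : ∀ t, PCOK hash g c.shared (c.loc t).op (c.loc t).log (c.loc t).pc
  log : ∀ t, LogWF (c.loc t).log
  val : ValOK hash g c.shared fun e => ∃ t, e ∈ pend (c.loc t).log (c.loc t).pc
  mark : ∀ x, Alloc c.shared x → (∀ t, mid (c.loc t).pc ≠ some x) →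
    ((c.shared.mem x).marked = false ↔ x ∈ g.blue)

/-- Equality of memories up to timestamps and red links. -/
structure CoreEq (s s' : Shared K V (Bucket Obj m)) : Prop where
  key : ∀ x, (s'.mem x).key = (s.mem x).key
  value : ∀ x, (s'.mem x).value = (s.mem x).value
  marked : ∀ x, (s'.mem x).marked = (s.mem x).marked
  bl : ∀ x, (s'.mem x).bl = (s.mem x).bl
  fresh : s'.fresh = s.fresh

variable {hash : Obj → K → Fin m} {c : Config Obj K V m} {g g' : Ghost Obj K V m}
  {s s' : Shared K V (Bucket Obj m)} {t : Tx} {l' : Local Obj K V (Bucket Obj m)}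

theorem CoreEq.of_mem (h : s'.mem = s.mem ∧ s'.fresh = s.fresh) : CoreEq s s' := by
  constructor <;> simp [h.1, h.2]

theorem alloc_congr (h : s'.fresh = s.fresh) (x : Addr (Bucket Obj m)) :
    Alloc s' x ↔ Alloc s x := by
  cases x <;> simp [Alloc, h]

theorem isPred_congr (hk : ∀ x, (s'.mem x).key = (s.mem x).key) {b : Option (Bucket Obj m)} {k : K}
    {a : Addr (Bucket Obj m)} : IsPred g s' b k a ↔ IsPred g s b k a := by
  simp only [IsPred, hk]

theorem isSucc_congr (hk : ∀ x, (s'.mem x).key = (s.mem x).key) {b : Option (Bucket Obj m)} {k : K}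
    {a : Addr (Bucket Obj m)} : IsSucc g s' b k a ↔ IsSucc g s b k a := by
  simp only [IsSucc, hk]

theorem MemInv.congr (hm : MemInv g s) (hk : ∀ x, (s'.mem x).key = (s.mem x).key)
    (hb : ∀ x, (s'.mem x).bl = (s.mem x).bl) (hf : s'.fresh = s.fresh)
    (hrl : ∀ x, Alloc s x → ∀ y, (s'.mem x).rl = some y → NodeOf g s (g.bkt x) y) :
    MemInv g s' := by
  have hn : ∀ b x, NodeOf g s' b x ↔ NodeOf g s b x := by
    simp [NodeOf, alloc_congr hf]
  constructor
  · exact hm.head_mem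
  · simpa only [hk] using hm.head_key
  · exact hm.head_bkt
  · simpa only [alloc_congr hf] using hm.alloc
  · simpa only [hk] using hm.inj
  · simpa only [hk, hb] using hm.next
  · simpa only [hk, hb] using hm.total
  · simpa only [hn, alloc_congr hf] using hrl
  · simpa only [hn, alloc_congr hf, hb] using hm.bl

/-- A frame in which the blue lists and the committed values are the same. -/
theorem Frame.of_key {P : Addr (Bucket Obj m) → Prop}
    (hk : ∀ x, (s'.mem x).key = (s.mem x).key) (hf : s'.fresh = s.fresh)
    (hb : ∀ x, P x → (s'.mem x).bl = (s.mem x).bl)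
    (hv : ∀ x, P x → (s'.mem x).value = (s.mem x).value)
    (hmk : ∀ x, P x → (s'.mem x).marked = (s.mem x).marked) : Frame hash g s g s' P :=
  ⟨fun x hx => ⟨(alloc_congr hf x).2 hx, rfl, hk x⟩, hb, hv, hmk, fun _ _ h => h,
    fun _ _ _ _ h => (isPred_congr hk).2 h, fun _ _ _ _ _ _ _ h => (isSucc_congr hk).2 h,
    fun _ _ _ _ _ => rfl⟩

theorem CoreEq.frame (h : CoreEq s s') (P : Addr (Bucket Obj m) → Prop) :
    Frame hash g s g s' P :=
  Frame.of_key h.key h.fresh (fun x _ => h.bl x) (fun x _ => h.value x) (fun x _ => h.marked x)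

theorem Inv.not_held (h : Inv hash c g) {u : Tx} (hu : u ≠ t) {a : Addr (Bucket Obj m)}
    (ha : a ∈ held c.shared (c.loc t).pc) : a ∉ held c.shared (c.loc u).pc := by
  intro ha'
  refine hu (holds_exclusive (s := c.shared) (a := a) ?_ ?_)
  · rw [h.lock]; exact List.count_pos_iff.2 ha'
  · rw [h.lock]; exact List.count_pos_iff.2 ha

/-- A transaction holds the lock of the owner of the keys it is updating. -/
theorem Inv.pend_owned (h : Inv hash c g) {u : Tx} {e : Entry Obj K V}
    (he : e ∈ pend (c.loc u).log (c.loc u).pc) :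
    ∃ a ∈ held c.shared (c.loc u).pc, IsPred g c.shared (bucket hash e.obj e.key) e.key a := by
  have hpc := h.pc u
  cases hp : (c.loc u).pc <;> rw [hp] at he hpc <;> simp only [pend] at he
  case release lp todo k =>
    cases lp <;> cases k <;> simp only [List.not_mem_nil] at he
    obtain ⟨a, ha, hpa⟩ := (hpc rfl).2 e he
    exact ⟨a, List.mem_append_left _ ha, hpa⟩
  case commit done cur rest ph =>
    obtain ⟨h1, h2, h3⟩ := hpc
    have key : e ∈ (if ph.applied then done ++ [procEntry c.shared cur ph] else done).map
        Located.ent := by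
      split_ifs at he ⊢ with hph <;> simpa [procEntry_ent] using he
    obtain ⟨q, hq, rfl⟩ := List.mem_map.1 key
    refine ⟨q.loc.bp, ?_, h1.owned q hq⟩
    have := mem_orderedLocks hq (x := q.loc.bp) (by simp [Loc.nodes])
    simp only [held, List.append_assoc]
    split_ifs at this with hph
    · rw [orderedLocks_append, orderedLocks_procEntry hph h3] at this
      rw [← List.append_assoc]
      exact List.mem_append_left _ this
    · exact List.mem_append_left _ this
  all_goals simp at he

/-- Nobody else is updating a key owned by `t`. -/
theorem Inv.no_pend (h : Inv hash c g) {o : Obj} {k : K} {a : Addr (Bucket Obj m)}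
    (ha : a ∈ held c.shared (c.loc t).pc) (hpa : IsPred g c.shared (bucket hash o k) k a)
    {u : Tx} (hu : u ≠ t) {e : Entry Obj K V} (he : e ∈ pend (c.loc u).log (c.loc u).pc) :
    ¬ (e.obj = o ∧ e.key = k) := by
  rintro ⟨rfl, rfl⟩
  obtain ⟨a', ha', hpa'⟩ := h.pend_owned he
  exact h.not_held hu ha (hpa.eq h.mem hpa' ▸ ha')

theorem Inv.exec (h : Inv hash c g) (hmem : MemInv g' s')
    (hfr : Frame hash g c.shared g' s' fun x =>
      Alloc c.shared x ∧ x ∉ held c.shared (c.loc t).pc)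
    (hlock : ∀ u a, u ≠ t → holds s' u a = holds c.shared u a)
    (hlock' : ∀ a, holds s' t a = (held s' l'.pc).count a)
    (halloc : ∀ a ∈ held s' l'.pc, Alloc s' a)
    (hpc : PCOK hash g' s' l'.op l'.log l'.pc) (hlog : LogWF l'.log)
    (hval : ValOK hash g' s' fun e =>
      (∃ u, u ≠ t ∧ e ∈ pend (c.loc u).log (c.loc u).pc) ∨ e ∈ pend l'.log l'.pc)
    (hmark : ∀ x, Alloc s' x → (∀ u, u ≠ t → mid (c.loc u).pc ≠ some x) → mid l'.pc ≠ some x →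
      ((s'.mem x).marked = false ↔ x ∈ g'.blue)) :
    Inv hash ⟨s', Function.update c.loc t l'⟩ g' := by
  have hP : ∀ u, u ≠ t → ∀ x ∈ held c.shared (c.loc u).pc,
      Alloc c.shared x ∧ x ∉ held c.shared (c.loc t).pc := fun u hu x hx =>
    ⟨h.alloc u x hx, h.not_held (Ne.symm hu) hx⟩
  constructor
  · exact hmem
  · intro u a
    by_cases hu : u = t
    · subst hu; simpa using hlock' a
    · simp only [Function.update_of_ne hu]
      rw [hlock u a hu, h.lock, held_frame hfr (hP u hu)]
  · intro u a
    by_cases hu : u = t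
    · subst hu; simpa using halloc a
    · simp only [Function.update_of_ne hu]
      rw [held_frame hfr (hP u hu)]
      exact fun ha => (hfr.ext a (h.alloc u a ha)).1
  · intro u
    by_cases hu : u = t
    · subst hu; simpa using hpc
    · simp only [Function.update_of_ne hu]
      exact (h.pc u).frame hfr h.mem (hP u hu)
  · intro u
    by_cases hu : u = t
    · subst hu; simpa using hlog
    · simpa only [Function.update_of_ne hu] using h.log u
  · have key : ∀ e, (∃ u, e ∈ pend ((Function.update c.loc t l') u).log
        ((Function.update c.loc t l') u).pc) ↔
        (∃ u, u ≠ t ∧ e ∈ pend (c.loc u).log (c.loc u).pc) ∨ e ∈ pend l'.log l'.pc := by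
      intro e
      constructor
      · rintro ⟨u, hu⟩
        by_cases hut : u = t
        · subst hut; right; simpa using hu
        · left; exact ⟨u, hut, by simpa only [Function.update_of_ne hut] using hu⟩
      · rintro (⟨u, hut, hu⟩ | hu)
        · exact ⟨u, by simpa only [Function.update_of_ne hut] using hu⟩
        · exact ⟨t, by simpa using hu⟩
    simpa only [key] using hval
  · intro x hx hu
    refine hmark x hx (fun u hut => ?_) ?_
    · simpa only [Function.update_of_ne hut] using hu u
    · simpa using hu t

theorem Inv.val' (h : Inv hash c g) (t : Tx) : ValOK hash g c.shared fun e =>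
    (∃ u, u ≠ t ∧ e ∈ pend (c.loc u).log (c.loc u).pc) ∨ e ∈ pend (c.loc t).log (c.loc t).pc := by
  have key : ∀ e, (∃ u, e ∈ pend (c.loc u).log (c.loc u).pc) ↔
      (∃ u, u ≠ t ∧ e ∈ pend (c.loc u).log (c.loc u).pc) ∨
        e ∈ pend (c.loc t).log (c.loc t).pc := by
    intro e
    constructor
    · rintro ⟨u, hu⟩
      by_cases hut : u = t
      · exact Or.inr (hut ▸ hu)
      · exact Or.inl ⟨u, hut, hu⟩
    · rintro (⟨u, -, hu⟩ | hu)
      exacts [⟨u, hu⟩, ⟨t, hu⟩]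
  simpa only [key] using h.val

theorem Inv.mark' (h : Inv hash c g) (t : Tx) {x : Addr (Bucket Obj m)} (hx : Alloc c.shared x)
    (hu : ∀ u, u ≠ t → mid (c.loc u).pc ≠ some x) (ht : mid (c.loc t).pc ≠ some x) :
    (c.shared.mem x).marked = false ↔ x ∈ g.blue :=
  h.mark x hx fun u => if hut : u = t then hut ▸ ht else hu u hut

theorem ValOK.mono {pd : Entry Obj K V → Prop} (h : ValOK hash g s pd)
    (hh : ∀ o k v, Holds hash g s o k v → Holds hash g' s' o k v) (ha : g'.abs = g.abs) :
    ValOK hash g' s' pd := fun o k =>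
  ⟨fun e he ho hk => hh _ _ _ ((h o k).1 e he ho hk), fun hn => ha ▸ hh _ _ _ ((h o k).2 hn)⟩

/-- A step that changes the memory at most in timestamps and red links. -/
theorem Inv.quiet (h : Inv hash c g) (hcore : CoreEq c.shared s')
    (hrl : ∀ x, Alloc c.shared x → ∀ y, (s'.mem x).rl = some y →
      NodeOf g c.shared (g.bkt x) y)
    (hlock : ∀ u a, u ≠ t → holds s' u a = holds c.shared u a)
    (hlock' : ∀ a, holds s' t a = (held c.shared l'.pc).count a)
    (halloc : ∀ a ∈ held c.shared l'.pc, Alloc c.shared a)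
    (hpc : PCOK hash g c.shared l'.op l'.log l'.pc) (hlog : LogWF l'.log)
    (hpend : ∀ e, e ∈ pend l'.log l'.pc ↔ e ∈ pend (c.loc t).log (c.loc t).pc)
    (hmid : mid l'.pc = mid (c.loc t).pc) :
    Inv hash ⟨s', Function.update c.loc t l'⟩ g := by
  have hh : held s' l'.pc = held c.shared l'.pc :=
    held_frame (hcore.frame (hash := hash) (g := g) fun _ => True) fun _ _ => trivial
  refine h.exec (h.mem.congr hcore.key hcore.bl hcore.fresh hrl) (hcore.frame _) hlock
    (fun a => by rw [hh]; exact hlock' a) ?_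
    (hpc.frame (hcore.frame fun _ => True) h.mem fun _ _ => trivial) hlog ?_ ?_
  · rw [hh]
    simpa only [alloc_congr hcore.fresh] using halloc
  · simp only [hpend]
    refine (h.val' t).mono (fun o k v hv => ?_) rfl
    simpa only [Holds, hcore.key, hcore.value] using hv
  · intro x hx hu ht
    rw [hcore.marked]
    exact h.mark' t ((alloc_congr hcore.fresh x).1 hx) hu (hmid ▸ ht)

/-- A step that does not change the shared memory. -/
theorem Inv.read (h : Inv hash c g)
    (hheld : ∀ a, (held c.shared l'.pc).count a = (held c.shared (c.loc t).pc).count a)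
    (hpc : PCOK hash g c.shared l'.op l'.log l'.pc) (hlog : LogWF l'.log)
    (hpend : ∀ e, e ∈ pend l'.log l'.pc ↔ e ∈ pend (c.loc t).log (c.loc t).pc)
    (hmid : mid l'.pc = mid (c.loc t).pc) :
    Inv hash ⟨c.shared, Function.update c.loc t l'⟩ g :=
  h.quiet (.of_mem ⟨rfl, rfl⟩) h.mem.rl (fun _ _ _ => rfl) (fun a => by rw [hheld, h.lock])
    (fun a ha => h.alloc t a (List.count_pos_iff.1 (hheld a ▸ List.count_pos_iff.2 ha)))
    hpc hlog hpend hmid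

theorem Inv.lockStep (h : Inv hash c g) {a : Addr (Bucket Obj m)}
    (hs : c.shared.lock t a = some s') (ha : Alloc c.shared a)
    (hheld : ∀ x, (held c.shared l'.pc).count x =
      (held c.shared (c.loc t).pc).count x + if x = a then 1 else 0)
    (hpc : PCOK hash g c.shared l'.op l'.log l'.pc) (hlog : LogWF l'.log)
    (hpend : ∀ e, e ∈ pend l'.log l'.pc ↔ e ∈ pend (c.loc t).log (c.loc t).pc)
    (hmid : mid l'.pc = mid (c.loc t).pc) :
    Inv hash ⟨s', Function.update c.loc t l'⟩ g := by
  refine h.quiet (.of_mem (lock_eq hs)) ?_ ?_ ?_ ?_ hpc hlog hpend hmid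
  · rw [(lock_eq hs).1]; exact h.mem.rl
  · intro u x hu
    simp [holds_lock hs, hu]
  · intro x
    simp [holds_lock hs, hheld, h.lock]
  · intro x hx
    by_cases hxa : x = a
    · exact hxa ▸ ha
    · refine h.alloc t x (List.count_pos_iff.1 ?_)
      have := List.count_pos_iff.2 hx
      rw [hheld, if_neg hxa] at this
      exact this

theorem Inv.unlockStep (h : Inv hash c g) {a : Addr (Bucket Obj m)}
    (hheld : ∀ x, (held c.shared l'.pc).count x + (if x = a then 1 else 0) =
      (held c.shared (c.loc t).pc).count x)
    (hpc : PCOK hash g c.shared l'.op l'.log l'.pc) (hlog : LogWF l'.log)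
    (hpend : ∀ e, e ∈ pend l'.log l'.pc ↔ e ∈ pend (c.loc t).log (c.loc t).pc)
    (hmid : mid l'.pc = mid (c.loc t).pc) :
    Inv hash ⟨c.shared.unlock t a, Function.update c.loc t l'⟩ g := by
  refine h.quiet (.of_mem (unlock_eq _ _ _)) ?_ ?_ ?_ ?_ hpc hlog hpend hmid
  · rw [(unlock_eq _ _ _).1]; exact h.mem.rl
  · intro u x hu
    simp [holds_unlock, hu]
  · intro x
    simp only [holds_unlock, true_and, h.lock, ← hheld]
    omega
  · intro x hx
    refine h.alloc t x (List.count_pos_iff.1 ?_)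
    have := List.count_pos_iff.2 hx
    rw [← hheld]
    omega

theorem holds_congr (h : s'.lockOf = s.lockOf) (u : Tx) (x : Addr (Bucket Obj m)) :
    holds s' u x = holds s u x := by
  simp only [holds, h]

end Invariant


section Search

variable {Obj K V : Type*} [DecidableEq Obj] [LinearOrder K] {m : ℕ}

/-! ### Linearization points -/

/-- The response of a method that is past its linearization point. -/
def post : PC Obj K V (Bucket Obj m) → Option (Resp V)
  | .respond r => some r
  | .release false _ (.rv v) | .rvLog v => some (.val v)
  | .release false _ .committed => some .ok
  | .release false _ .aborted => some .abort
  | _ => none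

/-- The log with the update that a lookup or delete owes after its linearization point. -/
def vlog (l : Local Obj K V (Bucket Obj m)) : List (Entry Obj K V) :=
  match l.pc with
  | .release false _ (.rv v) | .rvLog v =>
    match l.op with
    | .lookup o k => setLL l.log ⟨o, k, .lookup, v⟩
    | .delete o k => setLL l.log ⟨o, k, .delete, none⟩
    | _ => l.log
  | _ => l.log

/-- The committed contents after the commit of a transaction with the given log. -/
def absCommit (log : List (Entry Obj K V)) (abs : Obj → K → Option V) (o : Obj) (k : K) :
    Option V :=
  match findInLL log o k with
  | some e => if e.opn = .lookup then abs o k else e.seen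
  | none => abs o k

/-- The effect of the linearization point of a method `op` on the log and on the committed
contents, and the response. -/
inductive LPEffect (log : List (Entry Obj K V)) (abs : Obj → K → Option V) :
    Op Obj K V → List (Entry Obj K V) → (Obj → K → Option V) → Resp V → Prop
  | begin (n : ℕ) : LPEffect log abs .stmBegin log abs (.begun n)
  | insert (o : Obj) (k : K) (v : V) :
      LPEffect log abs (.insert o k v) (setLL log ⟨o, k, .insert, some v⟩) abs .ok
  | lookupLog (o : Obj) (k : K) (e : Entry Obj K V) (h : findInLL log o k = some e) :
      LPEffect log abs (.lookup o k) log abs (.val e.seen)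
  | deleteLog (o : Obj) (k : K) (e : Entry Obj K V) (h : findInLL log o k = some e) :
      LPEffect log abs (.delete o k) (setLL log ⟨o, k, .delete, none⟩) abs (.val e.seen)
  | lookup (o : Obj) (k : K) (h : findInLL log o k = none) :
      LPEffect log abs (.lookup o k) (setLL log ⟨o, k, .lookup, abs o k⟩) abs (.val (abs o k))
  | delete (o : Obj) (k : K) (h : findInLL log o k = none) :
      LPEffect log abs (.delete o k) (setLL log ⟨o, k, .delete, none⟩) abs (.val (abs o k))
  | commit : LPEffect log abs .tryC log (absCommit log abs) .ok
  | abort (op : Op Obj K V) (log' : List (Entry Obj K V)) :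
      LPEffect log abs op log' abs .abort

/-- The invariant is kept by a step of `t`, and the committed contents are changed as the
linearization point demands. -/
def StepOK (hash : Obj → K → Fin m) (c : Config Obj K V m) (g : Ghost Obj K V m) (t : Tx)
    (l' : Local Obj K V (Bucket Obj m)) (s' : Shared K V (Bucket Obj m)) (lp : Bool) : Prop :=
  ∃ g', Inv hash ⟨s', Function.update c.loc t l'⟩ g' ∧
    if lp = true then
      ∃ r, post l'.pc = some r ∧ LPEffect (c.loc t).log g.abs l'.op (vlog l') g'.abs r
    else g'.abs = g.abs

variable {hash : Obj → K → Fin m} {c : Config Obj K V m} {g g' : Ghost Obj K V m}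
  {s s' : Shared K V (Bucket Obj m)} {t : Tx} {l' : Local Obj K V (Bucket Obj m)}
  {pc pc' : PC Obj K V (Bucket Obj m)} {lp : Bool} {act : Act Obj K V (Bucket Obj m)}

theorem Inv.pcOK (h : Inv hash c g) (hp : (c.loc t).pc = pc) :
    PCOK hash g c.shared (c.loc t).op (c.loc t).log pc := hp ▸ h.pc t

theorem Inv.readPC (h : Inv hash c g) (hp : (c.loc t).pc = pc)
    (hpc : PCOK hash g c.shared (c.loc t).op (c.loc t).log pc')
    (hheld : ∀ a, (held c.shared pc').count a = (held c.shared pc).count a)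
    (hpend : ∀ e, e ∈ pend (c.loc t).log pc' ↔ e ∈ pend (c.loc t).log pc)
    (hmid : mid pc' = mid pc) : StepOK hash c g t { c.loc t with pc := pc' } c.shared false := by
  subst hp
  exact ⟨g, h.read hheld hpc (h.log t) hpend hmid, by simp⟩

theorem Inv.quietPC (h : Inv hash c g) (hp : (c.loc t).pc = pc) (hcore : CoreEq c.shared s')
    (hl : s'.lockOf = c.shared.lockOf)
    (hrl : ∀ x, Alloc c.shared x → ∀ y, (s'.mem x).rl = some y →
      NodeOf g c.shared (g.bkt x) y)
    (hpc : PCOK hash g c.shared (c.loc t).op (c.loc t).log pc')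
    (hheld : ∀ a, (held c.shared pc').count a = (held c.shared pc).count a)
    (hpend : ∀ e, e ∈ pend (c.loc t).log pc' ↔ e ∈ pend (c.loc t).log pc)
    (hmid : mid pc' = mid pc) : StepOK hash c g t { c.loc t with pc := pc' } s' false := by
  subst hp
  refine ⟨g, h.quiet hcore hrl (fun u a _ => holds_congr hl u a) (fun a => ?_) (fun a ha => ?_) hpc
    (h.log t) hpend hmid, by simp⟩
  · rw [holds_congr hl, h.lock]; exact (hheld a).symm
  · exact h.alloc t a (List.count_pos_iff.1 (hheld a ▸ List.count_pos_iff.2 ha))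

theorem modify_congr {β : Sort*} {a : Addr (Bucket Obj m)}
    {f : Node K V (Bucket Obj m) → Node K V (Bucket Obj m)} (φ : Node K V (Bucket Obj m) → β)
    (hφ : ∀ x, φ (f x) = φ x) (x : Addr (Bucket Obj m)) :
    φ ((s.modify a f).mem x) = φ (s.mem x) := by
  by_cases hx : x = a
  · subst hx; simp [Shared.modify, hφ]
  · simp [Shared.modify, hx]

theorem Inv.stampPC (h : Inv hash c g) (hp : (c.loc t).pc = pc) {a : Addr (Bucket Obj m)}
    {f : Node K V (Bucket Obj m) → Node K V (Bucket Obj m)}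
    (hf : ∀ x, (f x).key = x.key ∧ (f x).value = x.value ∧ (f x).marked = x.marked ∧
      (f x).rl = x.rl ∧ (f x).bl = x.bl)
    (hpc : PCOK hash g c.shared (c.loc t).op (c.loc t).log pc')
    (hheld : ∀ a, (held c.shared pc').count a = (held c.shared pc).count a)
    (hpend : ∀ e, e ∈ pend (c.loc t).log pc' ↔ e ∈ pend (c.loc t).log pc)
    (hmid : mid pc' = mid pc) :
    StepOK hash c g t { c.loc t with pc := pc' } (c.shared.modify a f) false := by
  refine h.quietPC hp ⟨modify_congr _ fun x => (hf x).1, modify_congr _ fun x => (hf x).2.1,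
    modify_congr _ fun x => (hf x).2.2.1, modify_congr _ fun x => (hf x).2.2.2.2, rfl⟩ rfl ?_ hpc hheld hpend hmid
  intro x hx y hy
  rw [modify_congr Node.rl fun x => (hf x).2.2.2.1] at hy
  exact h.mem.rl x hx y hy

theorem Inv.redPC (h : Inv hash c g) (hp : (c.loc t).pc = pc) {b : Option (Bucket Obj m)}
    {a x : Addr (Bucket Obj m)} (ha : NodeOf g c.shared b a) (hx : NodeOf g c.shared b x)
    (hpc : PCOK hash g c.shared (c.loc t).op (c.loc t).log pc')
    (hheld : ∀ a, (held c.shared pc').count a = (held c.shared pc).count a)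
    (hpend : ∀ e, e ∈ pend (c.loc t).log pc' ↔ e ∈ pend (c.loc t).log pc)
    (hmid : mid pc' = mid pc) :
    StepOK hash c g t { c.loc t with pc := pc' }
      (c.shared.modify a fun y => { y with rl := some x }) false := by
  refine h.quietPC hp ⟨modify_congr _ fun _ => rfl, modify_congr _ fun _ => rfl, modify_congr _ fun _ => rfl,
    modify_congr _ fun _ => rfl, rfl⟩ rfl ?_ hpc hheld hpend hmid
  intro z hz y hy
  by_cases hza : z = a
  · subst hza
    simp only [Shared.modify, Function.update_self, Option.some.injEq] at hy
    subst hy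
    exact ha.2 ▸ hx
  · simp only [Shared.modify, Function.update_of_ne hza] at hy
    exact h.mem.rl z hz y hy

theorem Inv.lockPC (h : Inv hash c g) (hp : (c.loc t).pc = pc) {a : Addr (Bucket Obj m)}
    (hs : c.shared.lock t a = some s') (ha : Alloc c.shared a)
    (hpc : PCOK hash g c.shared (c.loc t).op (c.loc t).log pc')
    (hheld : ∀ x, (held c.shared pc').count x =
      (held c.shared pc).count x + if x = a then 1 else 0)
    (hpend : ∀ e, e ∈ pend (c.loc t).log pc' ↔ e ∈ pend (c.loc t).log pc)
    (hmid : mid pc' = mid pc) : StepOK hash c g t { c.loc t with pc := pc' } s' false := by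
  subst hp
  exact ⟨g, h.lockStep hs ha hheld hpc (h.log t) hpend hmid, by simp⟩

theorem Inv.unlockPC (h : Inv hash c g) (hp : (c.loc t).pc = pc) {a : Addr (Bucket Obj m)}
    (hpc : PCOK hash g c.shared (c.loc t).op (c.loc t).log pc')
    (hheld : ∀ x, (held c.shared pc').count x + (if x = a then 1 else 0) =
      (held c.shared pc).count x)
    (hpend : ∀ e, e ∈ pend (c.loc t).log pc' ↔ e ∈ pend (c.loc t).log pc)
    (hmid : mid pc' = mid pc) :
    StepOK hash c g t { c.loc t with pc := pc' } (c.shared.unlock t a) false := by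
  subst hp
  exact ⟨g, h.unlockStep hheld hpc (h.log t) hpend hmid, by simp⟩

/-! ### Searching -/

theorem stepOK_search (h : Inv hash c g)
    (hp : (c.loc t).pc = pc) {o : Outcome Obj K V m}
    (hs : searchStep hash c.shared pc = some o) :
    StepOK hash c g t { c.loc t with pc := o.1 } o.2.1 o.2.2.2 := by
  have hok := h.pcOK hp
  cases pc <;> simp only [searchStep, reduceCtorEq] at hs
  case search cl =>
    split at hs <;> cases hs
    next a ha =>
    have hn := h.mem.bl (.head _) trivial a ha
    rw [h.mem.head_bkt] at hn
    refine h.readPC hp ⟨hok, ⟨trivial, h.mem.head_bkt _⟩, hn, ?_⟩ (fun _ => rfl) (fun _ => Iff.rfl)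
      rfl
    rw [h.mem.head_key]
    exact XKey.bot_lt_of _
  case blueWalk cl bp bc =>
    obtain ⟨h1, h2, h3, h4⟩ := hok
    split_ifs at hs with hk
    · split at hs <;> cases hs
      next a ha =>
      have hn := h.mem.bl _ h3.1 a ha
      rw [h3.2] at hn
      exact h.readPC hp ⟨h1, h3, hn, hk⟩ (fun _ => rfl) (fun _ => Iff.rfl) rfl
    · cases hs
      exact h.readPC hp ⟨h1, h2, h3, h4, not_lt.1 hk⟩ (fun _ => rfl) (fun _ => Iff.rfl) rfl
  case redStart cl bp bc =>
    obtain ⟨h1, h2, h3, h4, h5⟩ := hok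
    split at hs <;> cases hs
    next a ha =>
    have hn := h.mem.rl _ h2.1 a ha
    rw [h2.2] at hn
    exact h.readPC hp ⟨h1, ⟨h2, h2, hn, h3, h4, h5⟩⟩ (fun _ => rfl) (fun _ => Iff.rfl) rfl
  case redWalk cl loc =>
    obtain ⟨h1, h2⟩ := hok
    split_ifs at hs with hk
    · split at hs <;> cases hs
      next a ha =>
      have hn := h.mem.rl _ h2.rc.1 a ha
      rw [h2.rc.2] at hn
      exact h.readPC hp ⟨h1, ⟨h2.bp, h2.rc, hn, h2.bc, h2.key, h2.key_bc⟩⟩ (fun _ => rfl)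
        (fun _ => Iff.rfl) rfl
    · cases hs
      refine h.readPC hp ⟨h1, h2, List.suffix_rfl⟩ (fun x => ?_) (fun _ => Iff.rfl) rfl
      simp [held, List.count_diff]

theorem stepOK_acquire (h : Inv hash c g) {cl : Caller Obj K V (Bucket Obj m)}
    {loc : Loc (Bucket Obj m)} {a : Addr (Bucket Obj m)} {todo : List (Addr (Bucket Obj m))}
    (hp : (c.loc t).pc = .acquire cl loc (a :: todo)) (hs : c.shared.lock t a = some s') :
    StepOK hash c g t { c.loc t with pc := .acquire cl loc todo } s' false := by
  obtain ⟨h1, h2, h3⟩ := h.pcOK hp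
  have ha : a ∈ loc.nodes := h3.subset (by simp)
  refine h.lockPC hp hs ?_ ⟨h1, h2, (List.suffix_cons a todo).trans h3⟩ (fun x => ?_)
    (fun _ => Iff.rfl) rfl
  · simp only [Loc.nodes, List.mem_cons, List.not_mem_nil, or_false] at ha
    rcases ha with rfl | rfl | rfl | rfl
    exacts [h2.bp.1, h2.rp.1, h2.rc.1, h2.bc.1]
  · have hc := h3.sublist.count_le x
    simp only [held, List.count_append, List.count_diff, List.count_cons, beq_iff_eq] at hc ⊢
    by_cases hx : x = a
    · subst hx; simp at hc ⊢; omega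
    · have : ¬ a = x := fun e => hx e.symm
      simp [hx, this] at hc ⊢

theorem stepOK_acquired (h : Inv hash c g) {cl : Caller Obj K V (Bucket Obj m)}
    {loc : Loc (Bucket Obj m)} (hp : (c.loc t).pc = .acquire cl loc []) :
    StepOK hash c g t { c.loc t with pc := .validate cl loc (checks c.shared cl loc) }
      c.shared false := by
  obtain ⟨h1, h2, h3⟩ := h.pcOK hp
  refine h.readPC hp ⟨h1, h2, Or.inl (by simp [checks]), Or.inl (by simp [checks])⟩ (fun x => ?_)
    (fun _ => Iff.rfl) rfl
  simp [held]

/-- A node that is locked by `t` is blue if and only if it is not marked, unless `t` itself is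
about to change this. -/
theorem Inv.marked_iff (h : Inv hash c g) {a : Addr (Bucket Obj m)} (ha : Alloc c.shared a)
    (hl : a ∈ held c.shared (c.loc t).pc) (hmid : mid (c.loc t).pc ≠ some a) :
    (c.shared.mem a).marked = false ↔ a ∈ g.blue := by
  refine h.mark' t ha (fun u hu hm => ?_) hmid
  refine h.not_held hu hl ?_
  cases hpu : (c.loc u).pc <;> rw [hpu] at hm <;> simp only [mid, reduceCtorEq] at hm
  case commit done cur rest ph =>
    simp only [held, List.mem_append]
    left; right
    cases ph <;> simp only [midPhase, reduceCtorEq, Option.some.injEq] at hm <;> subst hm <;>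
      simp [curHeld]

theorem stepOK_check (h : Inv hash c g) {cl : Caller Obj K V (Bucket Obj m)}
    {loc : Loc (Bucket Obj m)} {ch : Check} {todo : List Check}
    (hp : (c.loc t).pc = .validate cl loc (ch :: todo)) {ts : ℕ} {o : Outcome Obj K V m}
    (ho : checkStep c.shared ts cl loc ch todo = o) :
    StepOK hash c g t { c.loc t with pc := o.1 } o.2.1 o.2.2.2 := by
  obtain ⟨h1, h2, h3, h4⟩ := h.pcOK hp
  have hgo : (ch = .bpMarked → loc.bp ∈ g.blue) →
      (ch = .bpBlue → (c.shared.mem loc.bp).bl = some loc.bc) →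
      StepOK hash c g t { c.loc t with pc := .validate cl loc todo } c.shared false := by
    intro e1 e2
    refine h.readPC hp ⟨h1, h2, ?_, ?_⟩ (fun _ => rfl) (fun _ => Iff.rfl) rfl
    · rcases h3 with h3 | h3
      · rcases List.mem_cons.1 h3 with h3 | h3
        exacts [Or.inr (e1 h3.symm), Or.inl h3]
      · exact Or.inr h3
    · rcases h4 with h4 | h4
      · rcases List.mem_cons.1 h4 with h4 | h4
        exacts [Or.inr (e2 h4.symm), Or.inl h4]
      · exact Or.inr h4
  have hretry : StepOK hash c g t { c.loc t with pc := .release false loc.nodes (.retry cl) }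
      c.shared false :=
    h.readPC hp ⟨rfl, h1⟩ (fun _ => rfl) (fun _ => Iff.rfl) rfl
  have habort : StepOK hash c g t
      { c.loc t with pc := .release true (loc.nodes ++ cl.heldBefore) .aborted } c.shared false :=
    h.readPC hp trivial (fun _ => by simp [held, Cont.held]) (fun _ => Iff.rfl) rfl
  subst ho
  cases ch <;> simp only [checkStep]
  case bpMarked =>
    split_ifs with hc
    · exact hretry
    · refine hgo (fun _ => ?_) (by simp)
      refine (h.marked_iff (t := t) h2.bp.1 ?_ ?_).1 (by simpa using hc)
      · rw [hp]; simp [held, Loc.nodes]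
      · rw [hp]; simp [mid]
  case bpBlue =>
    split_ifs with hc
    · exact hretry
    · exact hgo (by simp) fun _ => not_not.1 hc
  all_goals
    split_ifs
    · assumption
    · exact hgo (by simp) (by simp)

theorem prevInBucket_append (done : List (Located Obj K V (Bucket Obj m)))
    (q p : Located Obj K V (Bucket Obj m)) :
    prevInBucket hash (done ++ [q]) p =
      if bucket hash q.ent.obj q.ent.key = bucket hash p.ent.obj p.ent.key then some q
      else prevInBucket hash done p := by
  unfold prevInBucket
  rw [List.reverse_append, List.reverse_singleton, List.singleton_append, List.find?_cons]
  by_cases hb : bucket hash q.ent.obj q.ent.key = bucket hash p.ent.obj p.ent.key <;> simp [hb]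

theorem stepOK_located (h : Inv hash c g) {cl : Caller Obj K V (Bucket Obj m)}
    {loc : Loc (Bucket Obj m)} (hp : (c.loc t).pc = .validate cl loc []) :
    StepOK hash c g t { c.loc t with pc := located c.shared loc cl } c.shared false := by
  obtain ⟨h1, h2, h3, h4⟩ := h.pcOK hp
  have hf : Found hash g c.shared cl.target.1 cl.target.2 loc :=
    isPred_isSucc_of_bl h.mem (by simpa using h3) h2.bp.2 h2.key (by simpa using h4) h2.key_bc
  cases cl with
  | rv o k =>
    simp only [located]
    split_ifs with hk hk'
    · exact h.readPC hp ⟨o, k, h1, h2, hf, by simpa using hk⟩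
        (fun _ => by simp [held, Caller.heldBefore]) (fun _ => Iff.rfl) rfl
    · exact h.readPC hp ⟨o, k, h1, h2, hf, by simpa using hk⟩
        (fun _ => by simp [held, Caller.heldBefore]) (fun _ => Iff.rfl) rfl
    · exact h.readPC hp ⟨o, k, h1, h2, hf, hk⟩
        (fun _ => by simp [held, Caller.heldBefore]) (fun _ => Iff.rfl) rfl
  | tryC done e rest =>
    obtain ⟨e1, e2, e3⟩ := h1
    have hall : ∀ p ∈ done ++ [⟨e, loc, none⟩], LocOK hash g c.shared p.ent.obj p.ent.key p.loc ∧
        Found hash g c.shared p.ent.obj p.ent.key p.loc ∧ p.node = none := by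
      intro p hp
      rcases List.mem_append.1 hp with hp | hp
      · exact e3 p hp
      · cases List.mem_singleton.1 hp
        exact ⟨h2, hf, rfl⟩
    cases rest with
    | cons e' rest =>
      simp only [located]
      refine h.readPC hp ⟨e1, by simpa using e2, hall⟩ (fun x => ?_) (fun _ => Iff.rfl) rfl
      simp [held, Caller.heldBefore, orderedLocks, Loc.nodes, List.count_cons]
      omega
    | nil =>
      have hlog : orderedLL (c.loc t).log =
          (done ++ [(⟨e, loc, none⟩ : Located Obj K V (Bucket Obj m))]).map Located.ent := by
        simpa using e2
      have hlk : ∀ x, (orderedLocks (done ++ [(⟨e, loc, none⟩ : Located Obj K V (Bucket Obj m))])).count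
          x = (loc.nodes ++ orderedLocks done).count x := by
        intro x
        simp [orderedLocks, Loc.nodes, List.count_cons]
        omega
      simp only [located]
      rcases hd : done ++ [(⟨e, loc, none⟩ : Located Obj K V (Bucket Obj m))] with _ | ⟨p, rest⟩
      · simp at hd
      · rw [hd] at hall hlog hlk
        simp only [advance]
        refine h.readPC hp ⟨⟨e1, hlog, fun q hq => (hall q hq).1, by simp [Phase.applied],
          fun q hq => (hall q hq).2.2, fun q hq => (hall q hq).2.1.2,
          fun q hq => ⟨_, (hall q hq).2.1.1, Or.inl rfl⟩⟩, trivial, (hall p (by simp)).2.2⟩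
          (fun x => ?_) (fun _ => by simp [pend, Phase.applied]) rfl
        have := hlk x
        have hpn := (hall p (by simp)).2.2
        simpa [held, orderedLocks, curHeld, hpn, Caller.heldBefore] using this

end Search


section ReadValue

variable {Obj K V : Type*} [DecidableEq Obj] [LinearOrder K] {m : ℕ}
variable {hash : Obj → K → Fin m} {c : Config Obj K V m} {g g' : Ghost Obj K V m}
  {s s' : Shared K V (Bucket Obj m)} {t : Tx} {l' : Local Obj K V (Bucket Obj m)}
  {pc pc' : PC Obj K V (Bucket Obj m)} {lp : Bool} {act : Act Obj K V (Bucket Obj m)}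

/-! ### Logs -/

theorem logWF_setLL {log : List (Entry Obj K V)} (h : LogWF log) (e : Entry Obj K V) :
    LogWF (setLL log e) := by
  unfold setLL
  split_ifs with hf
  · unfold LogWF
    refine List.pairwise_map.2 (h.imp ?_)
    intro a b hab
    split_ifs with h1 h2 h2
    · exact fun _ => hab ⟨h1.1.trans h2.1.symm, h1.2.trans h2.2.symm⟩
    · exact fun e' => h2 ⟨e'.1.symm, e'.2.symm⟩
    · exact h1
    · exact hab
  · refine List.pairwise_append.2 ⟨h, List.pairwise_singleton _ _, ?_⟩
    intro a ha b hb
    cases List.mem_singleton.1 hb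
    rintro ⟨h1, h2⟩
    rw [findInLL, Option.not_isSome_iff_eq_none, List.find?_eq_none] at hf
    exact hf a ha (by simp [h1, h2])

theorem findInLL_some {log : List (Entry Obj K V)} {o : Obj} {k : K} {e : Entry Obj K V}
    (h : findInLL log o k = some e) : e ∈ log ∧ e.obj = o ∧ e.key = k := by
  refine ⟨List.mem_of_find?_eq_some h, ?_⟩
  simpa using List.find?_some h

theorem findInLL_of_mem {log : List (Entry Obj K V)} (h : LogWF log) {e : Entry Obj K V}
    (he : e ∈ log) : findInLL log e.obj e.key = some e := by
  cases hf : findInLL log e.obj e.key with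
  | none =>
    rw [findInLL, List.find?_eq_none] at hf
    exact absurd (hf e he) (by simp)
  | some e' =>
    obtain ⟨h1, h2, h3⟩ := findInLL_some hf
    by_contra hne
    have hne' : e' ≠ e := fun e => hne (by rw [e])
    have : Std.Symm fun e e' : Entry Obj K V => ¬ (e.obj = e'.obj ∧ e.key = e'.key) :=
      ⟨fun a b hab e => hab ⟨e.1.symm, e.2.symm⟩⟩
    exact h.forall h1 he hne' ⟨h2, h3⟩

theorem absCommit_of_mem {log : List (Entry Obj K V)} (h : LogWF log)
    {abs : Obj → K → Option V} {e : Entry Obj K V} (he : e ∈ orderedLL log) :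
    absCommit log abs e.obj e.key = e.seen := by
  rw [mem_orderedLL] at he
  simp [absCommit, findInLL_of_mem h he.1, he.2]

theorem absCommit_of_not_mem {log : List (Entry Obj K V)}
    {abs : Obj → K → Option V} {o : Obj} {k : K}
    (he : ∀ e ∈ orderedLL log, ¬ (e.obj = o ∧ e.key = k)) : absCommit log abs o k = abs o k := by
  unfold absCommit
  split
  · next e hf =>
    split_ifs with h1
    · rfl
    · exact absurd (findInLL_some hf).2 (he e (mem_orderedLL.2 ⟨(findInLL_some hf).1, h1⟩))
  · rfl

/-! ### Release of locks -/

/-- The linearization point of a successful `tryC`. -/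
theorem stepOK_commit_release (h : Inv hash c g) {a : Addr (Bucket Obj m)}
    {todo : List (Addr (Bucket Obj m))}
    (hp : (c.loc t).pc = .release true (a :: todo) .committed) :
    StepOK hash c g t { c.loc t with pc := .release false todo .committed }
      (c.shared.unlock t a) true := by
  have hok := h.pcOK hp
  obtain ⟨hop, hown⟩ := hok rfl
  have hc : CoreEq c.shared (c.shared.unlock t a) := .of_mem (unlock_eq _ _ _)
  set g' : Ghost Obj K V m := { g with abs := absCommit (c.loc t).log g.abs } with hg'
  have hheld : held c.shared (c.loc t).pc = a :: todo := by rw [hp]; simp [held, Cont.held]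
  have hpend : pend (c.loc t).log (c.loc t).pc = orderedLL (c.loc t).log := by rw [hp]; rfl
  have hmem : MemInv g' (c.shared.unlock t a) := by
    have := h.mem.congr hc.key hc.bl hc.fresh (by rw [(unlock_eq _ _ _).1]; exact h.mem.rl)
    exact ⟨this.1, this.2, this.3, this.4, this.5, this.6, this.7, this.8, this.9⟩
  have hcount : ∀ x, (held c.shared (c.loc t).pc).count x - (if x = a then 1 else 0) =
      todo.count x := by
    intro x
    rw [hheld, List.count_cons]
    by_cases hx : x = a
    · subst hx; simp
    · have : ¬ a = x := fun e => hx e.symm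
      simp [hx, this]
  refine ⟨g', h.exec hmem ?_ ?_ ?_ ?_ ?_ (h.log t) ?_ ?_, ?_⟩
  · refine ⟨fun x hx => ⟨(alloc_congr hc.fresh x).2 hx, rfl, hc.key x⟩, fun x _ => hc.bl x,
      fun x _ => hc.value x, fun x _ => hc.marked x, fun _ _ h => h,
      fun b k a _ hpa => (isPred_congr hc.key).2 hpa,
      fun b k a z _ _ _ hz => (isSucc_congr hc.key).2 hz, ?_⟩
    rintro o k x ⟨-, hx⟩ hpx
    refine absCommit_of_not_mem ?_
    rintro e he ⟨rfl, rfl⟩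
    obtain ⟨y, hy, hpy⟩ := hown e he
    exact hx (hpx.eq h.mem hpy ▸ hheld ▸ hy)
  · intro u x hu
    simp [holds_unlock, hu]
  · intro x
    rw [holds_unlock]
    simp only [true_and, h.lock, hcount]
    simp [held, Cont.held]
  · intro x hx
    refine (alloc_congr hc.fresh x).2 (h.alloc t x ?_)
    rw [hheld]
    simpa [held, Cont.held] using List.mem_cons_of_mem a hx
  · intro hf; cases hf
  · intro o k
    have hv := h.val' t o k
    rw [hpend] at hv
    have hh : ∀ v, Holds hash g' (c.shared.unlock t a) o k v ↔ Holds hash g c.shared o k v := by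
      intro v
      simp only [Holds, hc.key, hc.value, hg']
    simp only [pend, List.not_mem_nil, or_false, hh]
    constructor
    · intro e he
      exact hv.1 e (Or.inl he)
    · intro hn
      by_cases hex : ∃ e ∈ orderedLL (c.loc t).log, e.obj = o ∧ e.key = k
      · obtain ⟨e, he, rfl, rfl⟩ := hex
        simp only [hg', absCommit_of_mem (h.log t) he]
        exact hv.1 e (Or.inr he) rfl rfl
      · push Not at hex
        have hex' : ∀ e ∈ orderedLL (c.loc t).log, ¬ (e.obj = o ∧ e.key = k) := fun e he h' =>
          hex e he h'.1 h'.2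
        simp only [hg', absCommit_of_not_mem hex']
        exact hv.2 fun e he => he.elim (hn e) (hex' e)
  · intro x hx hu ht
    rw [hc.marked]
    refine h.mark' t ((alloc_congr hc.fresh x).1 hx) hu ?_
    rw [hp]; simp [mid]
  · refine ⟨.ok, rfl, ?_⟩
    simp only [hop, vlog, hg']
    exact .commit

theorem stepOK_release (h : Inv hash c g) {a : Addr (Bucket Obj m)}
    {todo : List (Addr (Bucket Obj m))} {k : Cont Obj K V (Bucket Obj m)}
    (hp : (c.loc t).pc = .release lp (a :: todo) k) :
    StepOK hash c g t { c.loc t with pc := .release false todo k } (c.shared.unlock t a) lp := by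
  have hok := h.pcOK hp
  have hheld : ∀ x, (held c.shared (.release false todo k)).count x + (if x = a then 1 else 0) =
      (held c.shared (.release lp (a :: todo) k)).count x := by
    intro x
    simp only [held, List.cons_append, List.count_cons]
    by_cases hx : x = a
    · subst hx; simp
    · have : ¬ a = x := fun e => hx e.symm
      simp [hx, this]
  have hok' : PCOK hash g c.shared (c.loc t).op (c.loc t).log (.release false todo k) := by
    cases k with
    | retry cl => exact ⟨rfl, hok.2⟩
    | rv v => intro e; cases e
    | committed => intro e; cases e
    | aborted => trivial
  cases lp with
  | false => exact h.unlockPC hp hok' hheld (fun _ => Iff.rfl) rfl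
  | true =>
    cases k with
    | retry cl => cases hok.1
    | committed => exact stepOK_commit_release h hp
    | rv v =>
      obtain ⟨g', hg', -⟩ := h.unlockPC hp hok' hheld (fun _ => Iff.rfl) rfl
      have hg := h.unlockStep (t := t) (l' := { c.loc t with pc := .release false todo (.rv v) })
        (by rw [hp]; exact hheld) hok' (h.log t) (by rw [hp]; exact fun _ => Iff.rfl)
        (by rw [hp]; rfl)
      refine ⟨g, hg, .val v, rfl, ?_⟩
      obtain ⟨o, k, ⟨hop, hf⟩, rfl, -⟩ := hok rfl
      rcases hop with hop | hop
      · simp only [vlog, hop]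
        exact .lookup o k hf
      · simp only [vlog, hop]
        exact .delete o k hf
    | aborted =>
      have hg := h.unlockStep (t := t) (l' := { c.loc t with pc := .release false todo .aborted })
        (by rw [hp]; exact hheld) hok' (h.log t) (by rw [hp]; exact fun _ => Iff.rfl)
        (by rw [hp]; rfl)
      exact ⟨g, hg, .abort, rfl, .abort _ _⟩

theorem stepOK_released (h : Inv hash c g) {k : Cont Obj K V (Bucket Obj m)}
    (hp : (c.loc t).pc = .release lp [] k) :
    StepOK hash c g t { c.loc t with pc := k.pc } c.shared false := by
  have hok := h.pcOK hp
  cases k with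
  | retry cl => exact h.readPC hp hok.2 (fun _ => rfl) (fun _ => by cases lp <;> rfl) rfl
  | rv v => exact h.readPC hp trivial (fun _ => rfl) (fun _ => by cases lp <;> rfl) rfl
  | aborted => exact h.readPC hp trivial (fun _ => rfl) (fun _ => by cases lp <;> rfl) rfl
  | committed =>
    refine h.readPC hp trivial (fun _ => rfl) (fun e => ?_) rfl
    cases lp with
    | false => rfl
    | true =>
      simp only [Cont.pc, pend, List.not_mem_nil, false_iff]
      intro he
      obtain ⟨a, ha, -⟩ := (hok rfl).2 e he
      cases ha

/-! ### Lookups and deletes -/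

/-- The blue list holds the committed value of a key owned by a transaction that does not
update anything. -/
theorem Inv.holds_abs (h : Inv hash c g) {o : Obj} {k : K} {a : Addr (Bucket Obj m)}
    (ha : a ∈ held c.shared (c.loc t).pc) (hpa : IsPred g c.shared (bucket hash o k) k a)
    (hn : ∀ e ∈ pend (c.loc t).log (c.loc t).pc, ¬ (e.obj = o ∧ e.key = k)) :
    Holds hash g c.shared o k (g.abs o k) :=
  (h.val' t o k).2 fun e he => he.elim (fun ⟨_, hu, he⟩ => h.no_pend ha hpa hu he) (hn e)

theorem stepOK_rvStamp (h : Inv hash c g) {loc : Loc (Bucket Obj m)} {a : Addr (Bucket Obj m)}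
    {blue : Bool} {ts : ℕ} (hp : (c.loc t).pc = .rvStamp loc a blue) :
    StepOK hash c g t { c.loc t with
        pc := if blue then .rvValue loc else .release true loc.nodes (.rv none) }
      (c.shared.modify a fun x => { x with tsLookup := ts }) false := by
  obtain ⟨o, k, h1, h2, h3, h4⟩ := h.pcOK hp
  refine h.stampPC hp (fun x => ⟨rfl, rfl, rfl, rfl, rfl⟩) ?_ ?_ ?_ ?_ <;> cases blue
  · intro _
    have hk : (c.shared.mem loc.bc).key ≠ XKey.of k := by simpa using h4
    have := h.holds_abs (t := t) (by rw [hp]; simp [held, Loc.nodes]) h3.1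
      (by rw [hp]; simp [pend])
    refine ⟨o, k, h1, ?_, loc.bp, by simp [Loc.nodes], h3.1⟩
    rcases this with ⟨z, hz, hzb, hzk, -⟩ | ⟨-, hv⟩
    · exact absurd hzk (h3.2.key_ne hk z hz hzb)
    · exact hv.symm
  · exact ⟨o, k, h1, h2, h3, h4.1 rfl⟩
  · exact fun _ => by simp [held, Cont.held]
  · exact fun _ => rfl
  · exact fun _ => Iff.rfl
  · exact fun _ => Iff.rfl
  · rfl
  · rfl

theorem stepOK_rvValue (h : Inv hash c g) {loc : Loc (Bucket Obj m)}
    (hp : (c.loc t).pc = .rvValue loc) :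
    StepOK hash c g t { c.loc t with
        pc := .release true loc.nodes (.rv (c.shared.mem loc.bc).value) } c.shared false := by
  obtain ⟨o, k, h1, h2, h3, h4⟩ := h.pcOK hp
  refine h.readPC hp (fun _ => ⟨o, k, h1, ?_, loc.bp, by simp [Loc.nodes], h3.1⟩)
    (fun _ => by simp [held, Cont.held]) (fun _ => Iff.rfl) rfl
  have := h.holds_abs (t := t) (by rw [hp]; simp [held, Loc.nodes]) h3.1 (by rw [hp]; simp [pend])
  rcases this with ⟨z, hz, hzb, hzk, hv⟩ | ⟨hz, -⟩
  · rw [h.mem.inj _ h3.2.1 _ hz (h3.2.2.1.trans hzb.symm) (h4.trans hzk.symm)]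
    exact hv
  · exact absurd h4 (hz _ h3.2.1 h3.2.2.1)

theorem stepOK_rvLink (h : Inv hash c g) {loc : Loc (Bucket Obj m)} {a : Addr (Bucket Obj m)}
    (hp : (c.loc t).pc = .rvLink loc a) :
    StepOK hash c g t { c.loc t with pc := .rvStamp loc a false }
      (c.shared.modify loc.rp fun x => { x with rl := some a }) false := by
  obtain ⟨o, k, h1, h2, h3, h4, h5⟩ := h.pcOK hp
  exact h.redPC hp h2.rp h5 ⟨o, k, h1, h2, h3, by simpa using h4⟩ (fun _ => rfl)
    (fun _ => Iff.rfl) rfl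

/-! ### Creation of nodes -/

section Creation

variable {b : Option (Bucket Obj m)} {x : Node K V (Bucket Obj m)}

theorem alloc_ne_fresh {y : Addr (Bucket Obj m)} (hy : Alloc s y) : y ≠ .node s.fresh := by
  rintro rfl
  exact lt_irrefl _ hy

theorem alloc_mem_of_alloc {y : Addr (Bucket Obj m)} (hy : Alloc s y) :
    (s.alloc x).mem y = s.mem y := by
  simp [Shared.alloc, alloc_ne_fresh hy]

theorem alloc_alloc {y : Addr (Bucket Obj m)} :
    Alloc (s.alloc x) y ↔ Alloc s y ∨ y = .node s.fresh := by
  cases y <;> simp [Alloc, Shared.alloc]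
  omega

/-- The ghost state after the creation of a node in the bucket `b`. -/
def Ghost.alloc (g : Ghost Obj K V m) (s : Shared K V (Bucket Obj m)) (b : Option (Bucket Obj m)) :
    Ghost Obj K V m :=
  { g with bkt := Function.update g.bkt (.node s.fresh) b }

theorem Ghost.alloc_bkt {y : Addr (Bucket Obj m)} (hy : Alloc s y) :
    (g.alloc s b).bkt y = g.bkt y := by
  simp [Ghost.alloc, alloc_ne_fresh hy]

theorem frame_alloc (hm : MemInv g s) :
    Frame hash g s (g.alloc s b) (s.alloc x) (Alloc s) := by
  have hk : ∀ z ∈ g.blue, ((s.alloc x).mem z).key = (s.mem z).key := fun z hz => by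
    rw [alloc_mem_of_alloc (hm.alloc z hz)]
  have hb : ∀ z ∈ g.blue, (g.alloc s b).bkt z = g.bkt z := fun z hz =>
    Ghost.alloc_bkt (hm.alloc z hz)
  refine ⟨fun y hy => ⟨alloc_alloc.2 (Or.inl hy), Ghost.alloc_bkt hy, ?_⟩, fun y hy => ?_,
    fun y hy => ?_, fun y hy => ?_, fun _ _ h => h, fun b k a _ ha => ?_,
    fun b k a z _ _ _ hz => ?_, fun _ _ _ _ _ => rfl⟩
  · rw [alloc_mem_of_alloc hy]
  · rw [alloc_mem_of_alloc hy]
  · rw [alloc_mem_of_alloc hy]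
  · rw [alloc_mem_of_alloc hy]
  · obtain ⟨h1, h2, h3, h4⟩ := ha
    refine ⟨h1, (hb a h1).trans h2, by rwa [hk a h1], fun z hz hzb hzk => ?_⟩
    rw [hk z hz] at hzk ⊢
    rw [hk a h1]
    exact h4 z hz ((hb z hz).symm.trans hzb) hzk
  · obtain ⟨h1, h2, h3, h4⟩ := hz
    refine ⟨h1, (hb z h1).trans h2, by rwa [hk z h1], fun y hy hyb hyk => ?_⟩
    rw [hk y hy] at hyk ⊢
    rw [hk z h1]
    exact h4 y hy ((hb y hy).symm.trans hyb) hyk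

theorem MemInv.create (hm : MemInv g s)
    (hrl : ∀ y, x.rl = some y → NodeOf g s b y) (hbl : ∀ y, x.bl = some y → NodeOf g s b y) :
    MemInv (g.alloc s b) (s.alloc x) := by
  have hmem : ∀ z ∈ g.blue, (s.alloc x).mem z = s.mem z := fun z hz =>
    alloc_mem_of_alloc (hm.alloc z hz)
  have hb : ∀ z ∈ g.blue, (g.alloc s b).bkt z = g.bkt z := fun z hz =>
    Ghost.alloc_bkt (hm.alloc z hz)
  have hn : ∀ b' y, NodeOf g s b' y → NodeOf (g.alloc s b) (s.alloc x) b' y := fun b' y hy =>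
    ⟨alloc_alloc.2 (Or.inl hy.1), (Ghost.alloc_bkt hy.1).trans hy.2⟩
  have hfr : (g.alloc s b).bkt (.node s.fresh) = b := by simp [Ghost.alloc]
  have hfm : (s.alloc x).mem (.node s.fresh) = x := by simp [Shared.alloc]
  refine ⟨hm.head_mem, fun b' => ?_, fun b' => ?_, fun y hy => alloc_alloc.2
    (Or.inl (hm.alloc y hy)), fun y hy z hz hyz hk => ?_, fun y hy z hz => ?_,
    fun y hy hk => ?_, fun y hy z hz => ?_, fun y hy z hz => ?_⟩
  · rw [hmem _ (hm.head_mem b')]; exact hm.head_key b'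
  · rw [hb _ (hm.head_mem b')]; exact hm.head_bkt b'
  · rw [hmem y hy, hmem z hz] at hk
    rw [hb y hy, hb z hz] at hyz
    exact hm.inj y hy z hz hyz hk
  · rw [hmem y hy] at hz
    obtain ⟨h1, h2, h3, h4⟩ := hm.next y hy z hz
    refine ⟨h1, by rw [hb z h1, hb y hy, h2], by rwa [hmem y hy, hmem z h1], fun w hw hwb hwk => ?_⟩
    rw [hmem w hw] at hwk ⊢
    rw [hmem y hy] at hwk
    rw [hmem z h1]
    exact h4 w hw (by rwa [hb w hw, hb y hy] at hwb) hwk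
  · rw [hmem y hy] at hk ⊢
    exact hm.total y hy hk
  · rcases alloc_alloc.1 hy with hy | rfl
    · rw [alloc_mem_of_alloc hy] at hz
      rw [Ghost.alloc_bkt hy]
      exact hn _ _ (hm.rl y hy z hz)
    · rw [hfm] at hz
      rw [hfr]
      exact hn _ _ (hrl z hz)
  · rcases alloc_alloc.1 hy with hy | rfl
    · rw [alloc_mem_of_alloc hy] at hz
      rw [Ghost.alloc_bkt hy]
      exact hn _ _ (hm.bl y hy z hz)
    · rw [hfm] at hz
      rw [hfr]
      exact hn _ _ (hbl z hz)

theorem Holds.alloc (hm : MemInv g s) {o : Obj} {k : K} {v : Option V}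
    (h : Holds hash g s o k v) : Holds hash (g.alloc s b) (s.alloc x) o k v := by
  have hmem : ∀ z ∈ g.blue, (s.alloc x).mem z = s.mem z := fun z hz =>
    alloc_mem_of_alloc (hm.alloc z hz)
  have hb : ∀ z ∈ g.blue, (g.alloc s b).bkt z = g.bkt z := fun z hz =>
    Ghost.alloc_bkt (hm.alloc z hz)
  rcases h with ⟨z, hz, h1, h2, h3⟩ | ⟨h1, h2⟩
  · exact Or.inl ⟨z, hz, (hb z hz).trans h1, by rw [hmem z hz]; exact h2,
      by rw [hmem z hz]; exact h3⟩
  · refine Or.inr ⟨fun z hz hzb => ?_, h2⟩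
    rw [hmem z hz]
    exact h1 z hz ((hb z hz).symm.trans hzb)

end Creation

theorem stepOK_rvNew (h : Inv hash c g) {loc : Loc (Bucket Obj m)} {o : Obj} {k : K}
    (hp : (c.loc t).pc = .rvNew loc)
    (hop : (c.loc t).op = .lookup o k ∨ (c.loc t).op = .delete o k) :
    StepOK hash c g t { c.loc t with pc := .rvLink loc (.node c.shared.fresh) }
      (c.shared.alloc ⟨XKey.of k, none, true, 0, 0, 0, some loc.rc, none⟩) false := by
  obtain ⟨o', k', ⟨h1, h1'⟩, h2, h3, h4⟩ := h.pcOK hp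
  have hok : o' = o ∧ k' = k := by
    rcases hop with hop | hop <;> rw [hop] at h1 <;> simpa [eq_comm] using h1
  obtain ⟨rfl, rfl⟩ := hok
  set x : Node K V (Bucket Obj m) := ⟨XKey.of k', none, true, 0, 0, 0, some loc.rc, none⟩
  have hfr := frame_alloc (hash := hash) (b := bucket hash o' k') (x := x) h.mem
  have hheld : held c.shared (c.loc t).pc = loc.nodes := by rw [hp]; rfl
  refine ⟨g.alloc c.shared (bucket hash o' k'), h.exec (h.mem.create ?_ ?_) ?_ ?_ ?_ ?_ ?_
    (h.log t) ?_ ?_, by simp [Ghost.alloc]⟩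
  · rintro y hy; cases hy; exact h2.rc
  · rintro y hy; cases hy
  · exact ⟨hfr.1, fun x hx => hfr.2 x hx.1, fun x hx => hfr.3 x hx.1, fun x hx => hfr.4 x hx.1,
      fun x hx => hfr.5 x hx.1, fun b k a hx => hfr.6 b k a hx.1,
      fun b k a c hx hx' => hfr.7 b k a c hx.1 hx'.1, fun o k a hx => hfr.8 o k a hx.1⟩
  · exact fun u a _ => rfl
  · intro a
    change holds c.shared t a = _
    rw [h.lock, hheld]; rfl
  · intro a ha
    exact alloc_alloc.2 (Or.inl (h.alloc t a (by rw [hheld]; exact ha)))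
  · have hal : ∀ z ∈ loc.nodes, Alloc c.shared z := fun z hz => h.alloc t z (by rwa [hheld])
    refine ⟨o', k', ⟨h1, h1'⟩, h2.frame hfr, h3.frame hfr (hal _ (by simp [Loc.nodes]))
      (hal _ (by simp [Loc.nodes])), ?_, ?_⟩
    · rw [hfr.key h2.bc]; exact h4
    · exact ⟨alloc_alloc.2 (Or.inr rfl), by simp [Ghost.alloc]⟩
  · have hv := h.val' t
    rw [hp] at hv
    exact hv.mono (fun o k v hv => hv.alloc h.mem) rfl
  · intro y hy hu ht
    rcases alloc_alloc.1 hy with hy | rfl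
    · rw [alloc_mem_of_alloc hy]
      exact h.mark' t hy hu (by rw [hp]; simp [mid])
    · simp only [Shared.alloc, Function.update_self]
      refine ⟨fun e => (Bool.noConfusion e), fun e => ?_⟩
      exact absurd rfl (alloc_ne_fresh (h.mem.alloc _ e))

/-! ### Local steps -/

theorem stepOK_rvLog (h : Inv hash c g) {v : Option V} (hp : (c.loc t).pc = .rvLog v)
    (e : Entry Obj K V) :
    StepOK hash c g t { c.loc t with log := setLL (c.loc t).log e, pc := .respond (.val v) }
      c.shared false :=
  ⟨g, h.read (by rw [hp]; exact fun _ => rfl) trivial (logWF_setLL (h.log t) e)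
    (by rw [hp]; exact fun _ => Iff.rfl) (by rw [hp]; rfl), by simp⟩

theorem stepOK_invoked (h : Inv hash c g) (hp : (c.loc t).pc = .invoked)
    (hs : step hash t (c.loc t) c.shared = some (l', s', act, lp)) :
    StepOK hash c g t l' s' lp := by
  have read : ∀ (pc' : PC Obj K V (Bucket Obj m)) (log' : List (Entry Obj K V)),
      (PCOK hash g c.shared (c.loc t).op log' pc') → LogWF log' →
      held c.shared pc' = [] → pend log' pc' = [] → mid pc' = none →
      Inv hash ⟨c.shared, Function.update c.loc t { c.loc t with pc := pc', log := log' }⟩ g := by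
    intro pc' log' h1 h2 h3 h4 h5
    refine h.read ?_ h1 h2 ?_ ?_
    · dsimp only; rw [hp, h3]; exact fun _ => rfl
    · dsimp only; rw [hp, h4]; exact fun _ => Iff.rfl
    · dsimp only; rw [hp, h5]; rfl
  rw [step, hp] at hs
  simp only at hs
  split at hs
  · next hop =>
    cases hs
    refine ⟨g, h.quiet ⟨fun _ => rfl, fun _ => rfl, fun _ => rfl, fun _ => rfl, rfl⟩ h.mem.rl
      (fun _ _ _ => rfl) (fun a => ?_) (by simp [held]) trivial (h.log t)
      (by rw [hp]; exact fun _ => Iff.rfl) (by rw [hp]; rfl), ?_⟩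
    · change holds c.shared t a = _
      rw [h.lock, hp]; rfl
    · simp only [if_true]
      refine ⟨_, rfl, ?_⟩
      simp only [vlog, hop]
      exact .begin _
  · next o k v hop =>
    cases hs
    refine ⟨g, read _ _ trivial (logWF_setLL (h.log t) _) rfl rfl rfl, ?_⟩
    simp only [if_true]
    refine ⟨_, rfl, ?_⟩
    simp only [vlog, hop]
    exact .insert _ _ _
  · next o k hop =>
    split at hs <;> cases hs
    · next e he =>
      refine ⟨g, read _ _ trivial (h.log t) rfl rfl rfl, ?_⟩
      simp only [if_true]
      refine ⟨_, rfl, ?_⟩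
      simp only [vlog, hop]
      exact .lookupLog _ _ _ he
    · next he =>
      exact ⟨g, read _ _ ⟨Or.inl hop, he⟩ (h.log t) rfl rfl rfl, by simp⟩
  · next o k hop =>
    split at hs <;> cases hs
    · next e he =>
      refine ⟨g, read _ _ trivial (logWF_setLL (h.log t) _) rfl rfl rfl, ?_⟩
      simp only [if_true]
      refine ⟨_, rfl, ?_⟩
      simp only [vlog, hop]
      exact .deleteLog _ _ _ he
    · next he =>
      exact ⟨g, read _ _ ⟨Or.inr hop, he⟩ (h.log t) rfl rfl rfl, by simp⟩
  · next hop =>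
    split at hs <;> cases hs
    · next he =>
      refine ⟨g, read _ _ trivial (h.log t) rfl rfl rfl, ?_⟩
      simp only [if_true]
      refine ⟨_, rfl, ?_⟩
      simp only [vlog, hop]
      have : g.abs = absCommit (c.loc t).log g.abs := by
        funext o k
        rw [absCommit_of_not_mem]
        simp [he]
      conv => arg 5; rw [this]
      exact .commit
    · next e rest he =>
      exact ⟨g, read _ _ ⟨hop, he, by simp⟩ (h.log t) rfl rfl rfl, by simp⟩

theorem stepOK_respond (h : Inv hash c g) {r : Resp V} (hp : (c.loc t).pc = .respond r)
    (hs : step hash t (c.loc t) c.shared = some (l', s', act, lp)) :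
    StepOK hash c g t l' s' lp := by
  rw [step, hp] at hs
  simp only [Option.some.injEq, Prod.mk.injEq] at hs
  obtain ⟨rfl, rfl, -, rfl⟩ := hs
  refine ⟨g, h.read ?_ ?_ (h.log t) ?_ ?_, by simp⟩
  · rw [hp]; dsimp only; split <;> exact fun _ => rfl
  · dsimp only; split <;> trivial
  · rw [hp]; dsimp only; split <;> exact fun _ => Iff.rfl
  · rw [hp]; dsimp only; split <;> rfl

theorem Inv.invoke (h : Inv hash c g) {op : Op Obj K V} (hc : CanInvoke (c.loc t).pc op) :
    Inv hash ⟨c.shared, Function.update c.loc t { c.loc t with pc := .invoked, op := op }⟩ g := by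
  have hp : (c.loc t).pc = .unborn ∨ (c.loc t).pc = .ready := by
    revert hc
    cases (c.loc t).pc <;> simp [CanInvoke]
  refine h.read ?_ trivial (h.log t) ?_ ?_ <;> rcases hp with hp | hp <;> rw [hp]
  exacts [fun _ => rfl, fun _ => rfl, fun _ => Iff.rfl, fun _ => Iff.rfl, rfl, rfl]

end ReadValue


section Commit

variable {Obj K V : Type*} [DecidableEq Obj] [LinearOrder K] {m : ℕ}
variable {hash : Obj → K → Fin m} {c : Config Obj K V m} {g g' : Ghost Obj K V m}
  {s s' : Shared K V (Bucket Obj m)} {t : Tx} {l' : Local Obj K V (Bucket Obj m)}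
  {pc pc' : PC Obj K V (Bucket Obj m)} {op : Op Obj K V} {log : List (Entry Obj K V)}
  {done rest : List (Located Obj K V (Bucket Obj m))} {cur : Located Obj K V (Bucket Obj m)}
  {ph : Phase (Bucket Obj m)}

/-! ### The next entry -/

theorem CommitOK.advance (h : CommitOK hash g s op log done rest) :
    PCOK hash g s op log (HTOSTM.advance done rest) := by
  cases rest with
  | nil =>
    refine fun _ => ⟨h.op, fun e he => ?_⟩
    rw [h.log, List.append_nil] at he
    obtain ⟨q, hq, rfl⟩ := List.mem_map.1 he
    exact ⟨q.loc.bp, mem_orderedLocks hq (by simp [Loc.nodes]), h.owned q hq⟩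
  | cons p rest =>
    exact ⟨h, trivial, h.node p (by simp)⟩

theorem CommitOK.held_advance (h : CommitOK hash g s op log done rest)
    (s' : Shared K V (Bucket Obj m)) :
    held s' (HTOSTM.advance done rest) = orderedLocks done ++ orderedLocks rest := by
  cases rest with
  | nil => simp [HTOSTM.advance, held, Cont.held, orderedLocks]
  | cons p rest =>
    have hn := h.node p (by simp)
    simp [HTOSTM.advance, held, orderedLocks, curHeld, hn]

theorem CommitOK.pend_advance (h : CommitOK hash g s op log done rest) :
    pend log (HTOSTM.advance done rest) = done.map Located.ent := by
  cases rest with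
  | nil => simp [HTOSTM.advance, pend, h.log]
  | cons p rest => simp [HTOSTM.advance, pend, Phase.applied]

theorem mid_advance : mid (HTOSTM.advance done rest) = none := by
  cases rest <;> rfl

/-! ### Changes of the current location -/

theorem CommitOK.replace (h : CommitOK hash g s op log done (cur :: rest))
    {loc : Loc (Bucket Obj m)} (hl : LocOK hash g s cur.ent.obj cur.ent.key loc)
    (hbc : loc.bc = cur.loc.bc)
    (hp : IsPred g s (bucket hash cur.ent.obj cur.ent.key) cur.ent.key loc.bp) :
    CommitOK hash g s op log done ({ cur with loc := loc } :: rest) := by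
  refine ⟨h.op, by simpa using h.log, fun p hp => ?_, h.owned, fun p hp => ?_, fun p hp => ?_,
    fun p hp => ?_⟩
  · rcases List.mem_append.1 hp with hp | hp
    · exact h.loc p (List.mem_append_left _ hp)
    · rcases List.mem_cons.1 hp with rfl | hp
      · exact hl
      · exact h.loc p (by simp [hp])
  · rcases List.mem_cons.1 hp with rfl | hp
    · exact h.node cur (by simp)
    · exact h.node p (by simp [hp])
  · rcases List.mem_cons.1 hp with rfl | hp
    · exact hbc ▸ h.succ cur (by simp)
    · exact h.succ p (by simp [hp])
  · rcases List.mem_cons.1 hp with rfl | hp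
    · exact ⟨_, ‹IsPred _ _ _ _ loc.bp›, Or.inl rfl⟩
    · exact h.pred p (by simp [hp])

theorem CommitOK.congr (h : CommitOK hash g s op log done rest)
    (hk : ∀ x, (s'.mem x).key = (s.mem x).key) (hf : s'.fresh = s.fresh)
    (hbl : ∀ x ∈ g.blue, (s'.mem x).bl = (s.mem x).bl) :
    CommitOK hash g s' op log done rest := by
  have hfr : Frame hash g s g s' fun _ => False :=
    .of_key hk hf (fun _ h => h.elim) (fun _ h => h.elim) (fun _ h => h.elim)
  refine ⟨h.op, h.log, fun p hp => (h.loc p hp).frame hfr, fun p hp =>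
    (isPred_congr hk).2 (h.owned p hp), h.node, fun p hp => (isSucc_congr hk).2 (h.succ p hp),
    fun p hp => ?_⟩
  obtain ⟨a, ha, hor⟩ := h.pred p hp
  refine ⟨a, (isPred_congr hk).2 ha, hor.imp id ?_⟩
  rintro ⟨q, h1, h2, h3, h4, h5⟩
  refine ⟨q, h1, by rwa [hk], h3, h4, ?_⟩
  rwa [hbl _ h3]

/-! ### The entries are in increasing order -/

theorem CommitOK.lt (h : CommitOK hash g s op log done (cur :: rest)) (hlog : LogWF log) :
    (∀ q ∈ done, q.ent.obj = cur.ent.obj → q.ent.key < cur.ent.key) ∧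
      ∀ p ∈ rest, cur.ent.obj = p.ent.obj → cur.ent.key < p.ent.key := by
  have hpw := orderedLL_pairwise hlog
  rw [h.log, List.pairwise_map, List.pairwise_append, List.pairwise_cons] at hpw
  exact ⟨fun q hq => hpw.2.2 q hq cur (by simp), hpw.2.1.1⟩

theorem bucket_fst {o o' : Obj} {k k' : K} (h : bucket hash o k = bucket hash o' k') : o = o' :=
  congrArg Prod.fst h

theorem CommitOK.apply
    (hsb : SameBut g s g' s' (bucket hash cur.ent.obj cur.ent.key) cur.ent.key)
    (h : CommitOK hash g s op log done (cur :: rest)) (hlog : LogWF log)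
    (hp : IsPred g s (bucket hash cur.ent.obj cur.ent.key) cur.ent.key cur.loc.bp)
    (hbl : ∀ x, g.bkt x ≠ bucket hash cur.ent.obj cur.ent.key → (s'.mem x).bl = (s.mem x).bl)
    {cur' : Located Obj K V (Bucket Obj m)} (he : cur'.ent = cur.ent) (hl : cur'.loc = cur.loc)
    {f : Addr (Bucket Obj m)} (hf : f ∈ g'.blue)
    (hfb : g.bkt f = bucket hash cur.ent.obj cur.ent.key)
    (hfk : (s.mem f).key ≤ XKey.of cur.ent.key)
    (hfm : ∀ z ∈ g'.blue, g.bkt z = bucket hash cur.ent.obj cur.ent.key →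
      (s.mem z).key ≤ XKey.of cur.ent.key → (s.mem z).key ≤ (s.mem f).key)
    (hfl : f ∈ orderedLocks [cur'])
    (hff : if cur.ent.opn = .insert then (s'.mem cur.loc.bp).bl = some f else f = cur.loc.bp) :
    CommitOK hash g' s' op log (done ++ [cur']) rest := by
  obtain ⟨hlt1, hlt2⟩ := h.lt hlog
  have hp' := hsb.isPred_of_le (fun _ => le_rfl) hp
  have hloc : ∀ p : Located Obj K V (Bucket Obj m), LocOK hash g s p.ent.obj p.ent.key p.loc →
      LocOK hash g' s' p.ent.obj p.ent.key p.loc := fun p hp =>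
    ⟨(hsb.nodeOf _).2 hp.bp, (hsb.nodeOf _).2 hp.rp, (hsb.nodeOf _).2 hp.rc, (hsb.nodeOf _).2 hp.bc,
      by rw [hsb.key]; exact hp.key, by rw [hsb.key]; exact hp.key_bc⟩
  refine ⟨h.op, ?_, ?_, ?_, fun p hp => h.node p (by simp [hp]), ?_, ?_⟩
  · rw [h.log]; simp [he]
  · intro p hp
    rw [List.append_assoc, List.mem_append, List.mem_append, List.mem_singleton] at hp
    rcases hp with hp | rfl | hp
    · exact hloc p (h.loc p (by simp [hp]))
    · have := hloc cur (h.loc cur (by simp))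
      rwa [← he, ← hl] at this
    · exact hloc p (h.loc p (by simp [hp]))
  · intro p hpd
    rw [List.mem_append, List.mem_singleton] at hpd
    rcases hpd with hpd | rfl
    · exact hsb.isPred_of_le (fun e => (hlt1 p hpd (bucket_fst (Option.some_injective _ e))).le) (h.owned p hpd)
    · rw [he, hl]; exact hp'
  · intro p hpr
    exact hsb.isSucc_of_lt (fun e => hlt2 p hpr (bucket_fst (Option.some_injective _ e)).symm) (h.succ p (by simp [hpr]))
  · intro p hpr
    obtain ⟨a, ha, hor⟩ := h.pred p (by simp [hpr])
    unfold Frontier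
    simp only [prevInBucket_append, he]
    by_cases hb : bucket hash cur.ent.obj cur.ent.key = bucket hash p.ent.obj p.ent.key
    · have hkk := hlt2 p hpr (bucket_fst hb)
      rw [← hb] at ha ⊢
      simp only [if_true]
      rcases le_or_gt (s.mem a).key (XKey.of cur.ent.key) with hle | hgt
      · refine ⟨f, hsb.isPred_of_frontier hkk hf hfb hfk hfm ha hle, Or.inr ⟨cur', rfl, ?_, ?_, ?_,
          ?_⟩⟩
        · rw [hsb.key, he]; exact hfk
        · rw [hl]; exact hp'.1
        · rw [orderedLocks_append]; exact List.mem_append_right _ hfl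
        · rw [he, hl]; exact hff
      · refine ⟨a, hsb.isPred_of_key_gt ha hgt, Or.inl ?_⟩
        rcases hor with rfl | ⟨q, h1, h2, -⟩
        · rfl
        · obtain ⟨hq, hqb⟩ := mem_of_prevInBucket h1
          have := hlt1 q hq (bucket_fst (hqb.trans hb.symm))
          exact absurd (h2.trans (XKey.of_lt_of.2 this).le) (not_le.2 hgt)
    · simp only [hb, if_false]
      refine ⟨a, hsb.isPred_of_le (fun e => absurd (Option.some_injective _ e.symm) hb) ha, hor.imp id ?_⟩
      rintro ⟨q, h1, h2, h3, h4, h5⟩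
      obtain ⟨hq, hqb⟩ := mem_of_prevInBucket h1
      have hqb' : g.bkt q.loc.bp ≠ bucket hash cur.ent.obj cur.ent.key := by
        rw [(h.loc q (by simp [hq])).bp.2, hqb]
        exact fun e => hb (Option.some_injective _ e.symm)
      refine ⟨q, h1, by rwa [hsb.key], (hsb.blue _ fun e => hqb' e.1).2 h3, ?_, ?_⟩
      · rw [orderedLocks_append]; exact List.mem_append_left _ h4
      · rwa [hbl _ hqb']

/-! ### The current entry takes effect -/

theorem Inv.apply (h : Inv hash c g)
    (hp : (c.loc t).pc = .commit done cur rest ph) (hph : ph.applied = false)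
    (hbp : cur.loc.bp ∈ held c.shared (c.loc t).pc)
    (hpr : IsPred g c.shared (bucket hash cur.ent.obj cur.ent.key) cur.ent.key cur.loc.bp)
    (hsb : SameBut g c.shared g' s' (bucket hash cur.ent.obj cur.ent.key) cur.ent.key)
    (hmem : MemInv g' s') (habs : g'.abs = g.abs)
    (hbl : ∀ x, x ∉ held c.shared (c.loc t).pc → (s'.mem x).bl = (c.shared.mem x).bl)
    (hvl : ∀ x, x ∉ held c.shared (c.loc t).pc ∨
      ¬ (g.bkt x = bucket hash cur.ent.obj cur.ent.key ∧
        (c.shared.mem x).key = XKey.of cur.ent.key) →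
      (s'.mem x).value = (c.shared.mem x).value)
    (hmk : ∀ x, (s'.mem x).marked = (c.shared.mem x).marked)
    (hav : ∀ x, x ∉ held c.shared (c.loc t).pc → x ∈ g.blue → x ∈ g'.blue)
    (hnew : Holds hash g' s' cur.ent.obj cur.ent.key cur.ent.seen)
    (hlo : s'.lockOf = c.shared.lockOf)
    (hheld : ∀ a, (held s' pc').count a = (held c.shared (c.loc t).pc).count a)
    (hpc : PCOK hash g' s' (c.loc t).op (c.loc t).log pc')
    (hpd : ∀ e, e ∈ pend (c.loc t).log pc' ↔ e ∈ done.map Located.ent ∨ e = cur.ent)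
    (hmark : ∀ x, Alloc c.shared x → (∀ u, u ≠ t → mid (c.loc u).pc ≠ some x) →
      ((c.shared.mem x).marked = false ↔ x ∈ g'.blue)) :
    StepOK hash c g t { c.loc t with pc := pc' } s' false := by
  have hok := h.pcOK hp
  have hco := hok.1
  simp only [hph, if_false, Bool.false_eq_true] at hco
  obtain ⟨hlt1, -⟩ := hco.lt (h.log t)
  have hne : ∀ x, x ∉ held c.shared (c.loc t).pc → x ≠ cur.loc.bp := fun x hx e => hx (e ▸ hbp)
  refine ⟨g', h.exec hmem ?_ (fun u a _ => holds_congr hlo u a) ?_ ?_ hpc (h.log t) ?_ ?_,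
    by simpa using habs⟩
  · exact ⟨fun x hx => ⟨(hsb.alloc x).2 hx, by rw [hsb.bkt], hsb.key x⟩, fun x hx => hbl x hx.2,
      fun x hx => hvl x (Or.inl hx.2), fun x _ => hmk x, fun x hx => hav x hx.2,
      fun b k a ha hpa => hsb.isPred_of_ne h.mem hpr (hne a ha.2) (hav a ha.2) hpa,
      fun b k a z ha hz hpa => hsb.isSucc_of_ne h.mem hpr (hne a ha.2) (hav z hz.2) hpa,
      fun o k a _ _ => by rw [habs]⟩
  · intro a
    rw [holds_congr hlo, h.lock]
    exact (hheld a).symm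
  · intro a ha
    exact (hsb.alloc a).2 (h.alloc t a (List.count_pos_iff.1 (hheld a ▸ List.count_pos_iff.2 ha)))
  · intro o k
    by_cases hok : cur.ent.obj = o ∧ cur.ent.key = k
    · obtain ⟨rfl, rfl⟩ := hok
      constructor
      · rintro e (⟨u, hu, he⟩ | he) h1 h2
        · exact absurd ⟨h1, h2⟩ (h.no_pend hbp hpr hu he)
        · rcases (hpd e).1 he with he | rfl
          · obtain ⟨q, hq, rfl⟩ := List.mem_map.1 he
            exact absurd h2 (hlt1 q hq h1).ne
          · exact hnew
      · intro hn
        exact absurd ⟨rfl, rfl⟩ (hn cur.ent (Or.inr ((hpd _).2 (Or.inr rfl))))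
    · have hnn : ∀ z, g.bkt z = bucket hash o k → (c.shared.mem z).key = XKey.of k →
          ¬ (g.bkt z = bucket hash cur.ent.obj cur.ent.key ∧
            (c.shared.mem z).key = XKey.of cur.ent.key) := fun z h1 h2 e =>
        hok ⟨bucket_fst (Option.some_injective _ (e.1.symm.trans h1)), XKey.of_inj.1 (e.2.symm.trans h2)⟩
      have hh : ∀ v, Holds hash g c.shared o k v → Holds hash g' s' o k v := by
        rintro v (⟨z, hz, h1, h2, h3⟩ | ⟨h1, h2⟩)
        · refine Or.inl ⟨z, (hsb.blue z (hnn z h1 h2)).2 hz, by rwa [hsb.bkt], by rwa [hsb.key], ?_⟩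
          rw [hvl z (Or.inr (hnn z h1 h2))]; exact h3
        · refine Or.inr ⟨fun z hz hzb hzk => ?_, h2⟩
          rw [hsb.bkt] at hzb
          rw [hsb.key] at hzk
          exact h1 z ((hsb.blue z (hnn z hzb hzk)).1 hz) hzb hzk
      have hv := h.val' t o k
      have hpt : pend (c.loc t).log (c.loc t).pc = done.map Located.ent := by
        rw [hp]; simp [pend, hph]
      rw [hpt] at hv
      constructor
      · rintro e (he | he) h1 h2
        · exact hh _ (hv.1 e (Or.inl he) h1 h2)
        · rcases (hpd e).1 he with he | rfl
          · exact hh _ (hv.1 e (Or.inr he) h1 h2)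
          · exact absurd ⟨h1, h2⟩ hok
      · intro hn
        rw [habs]
        refine hh _ (hv.2 fun e he => hn e (he.imp id fun he => (hpd e).2 (Or.inl he)))
  · intro x hx hu _
    rw [hmk]
    exact hmark x ((hsb.alloc x).1 hx) hu

/-- A change of a node that is locked by `t` and is not visible in the blue lists. -/
theorem Inv.touch (h : Inv hash c g) (hmem : MemInv g s')
    (hk : ∀ x, (s'.mem x).key = (c.shared.mem x).key) (hf : s'.fresh = c.shared.fresh)
    (hlo : s'.lockOf = c.shared.lockOf)
    (hsame : ∀ x, x ∉ held c.shared (c.loc t).pc → s'.mem x = c.shared.mem x)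
    (hvl : ∀ x ∈ g.blue, (s'.mem x).value = (c.shared.mem x).value)
    (hheld : ∀ a, (held s' pc').count a = (held c.shared (c.loc t).pc).count a)
    (hpc : PCOK hash g s' (c.loc t).op (c.loc t).log pc')
    (hpd : ∀ e, e ∈ pend (c.loc t).log pc' ↔ e ∈ pend (c.loc t).log (c.loc t).pc)
    (hmark : ∀ x, Alloc c.shared x → (∀ u, u ≠ t → mid (c.loc u).pc ≠ some x) →
      mid pc' ≠ some x → ((s'.mem x).marked = false ↔ x ∈ g.blue)) :
    StepOK hash c g t { c.loc t with pc := pc' } s' false := by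
  refine ⟨g, h.exec hmem (.of_key hk hf (fun x hx => by rw [hsame x hx.2])
    (fun x hx => by rw [hsame x hx.2]) (fun x hx => by rw [hsame x hx.2]))
    (fun u a _ => holds_congr hlo u a) ?_ ?_ hpc (h.log t) ?_ ?_, by simp⟩
  · intro a
    rw [holds_congr hlo, h.lock]
    exact (hheld a).symm
  · intro a ha
    exact (alloc_congr hf a).2
      (h.alloc t a (List.count_pos_iff.1 (hheld a ▸ List.count_pos_iff.2 ha)))
  · simp only [hpd]
    refine (h.val' t).mono (fun o k v hv => ?_) rfl
    rcases hv with ⟨z, hz, h1, h2, h3⟩ | ⟨h1, h2⟩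
    · exact Or.inl ⟨z, hz, h1, by rwa [hk], by rwa [hvl z hz]⟩
    · exact Or.inr ⟨fun z hz hzb => by rw [hk]; exact h1 z hz hzb, h2⟩
  · exact fun x hx => hmark x ((alloc_congr hf x).1 hx)

end Commit


section CommitStep

variable {Obj K V : Type*} [DecidableEq Obj] [LinearOrder K] {m : ℕ}
variable {hash : Obj → K → Fin m} {c : Config Obj K V m} {g g' : Ghost Obj K V m}
  {s s' : Shared K V (Bucket Obj m)} {t : Tx} {l' : Local Obj K V (Bucket Obj m)}
  {pc pc' : PC Obj K V (Bucket Obj m)} {op : Op Obj K V} {log : List (Entry Obj K V)}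
  {done rest : List (Located Obj K V (Bucket Obj m))} {cur : Located Obj K V (Bucket Obj m)}
  {ph : Phase (Bucket Obj m)}

/-! ### Validation inside the transaction -/

theorem Inv.commitOK (h : Inv hash c g) (hp : (c.loc t).pc = .commit done cur rest ph)
    (hph : ph.applied = false) :
    CommitOK hash g c.shared (c.loc t).op (c.loc t).log done (cur :: rest) ∧
      PhaseOK hash g c.shared done cur ph ∧ cur.node = none := by
  have hok := h.pcOK hp
  simpa only [PCOK, hph, if_false, Bool.false_eq_true] using hok

theorem Inv.commitOK' (h : Inv hash c g) (hp : (c.loc t).pc = .commit done cur rest ph)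
    (hph : ph.applied = true) :
    CommitOK hash g c.shared (c.loc t).op (c.loc t).log (done ++ [procEntry c.shared cur ph])
      rest ∧ PhaseOK hash g c.shared done cur ph ∧ cur.node = none := by
  have hok := h.pcOK hp
  simpa only [PCOK, hph, if_true] using hok

theorem pcOK_commit {ph' : Phase (Bucket Obj m)} (hph : ph'.applied = false)
    (h : CommitOK hash g s op log done (cur :: rest)) (hn : cur.node = none)
    (hpo : PhaseOK hash g s done cur ph') :
    PCOK hash g s op log (.commit done cur rest ph') := by
  simpa only [PCOK, hph, if_false, Bool.false_eq_true] using ⟨h, hpo, hn⟩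

theorem pcOK_commit' {ph' : Phase (Bucket Obj m)} (hph : ph'.applied = true)
    (h : CommitOK hash g s op log (done ++ [procEntry s cur ph']) rest) (hn : cur.node = none)
    (hpo : PhaseOK hash g s done cur ph') :
    PCOK hash g s op log (.commit done cur rest ph') := by
  simpa only [PCOK, hph, if_true] using ⟨h, hpo, hn⟩

/-- A read inside the second loop of `tryC`. -/
theorem Inv.readPhase (h : Inv hash c g) (hp : (c.loc t).pc = .commit done cur rest ph)
    {cur' : Located Obj K V (Bucket Obj m)} {ph' : Phase (Bucket Obj m)}
    (hph : ph.applied = false) (hph' : ph'.applied = false)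
    (hco : CommitOK hash g c.shared (c.loc t).op (c.loc t).log done (cur' :: rest))
    (hn : cur'.node = none) (hpo : PhaseOK hash g c.shared done cur' ph')
    (hheld : curHeld c.shared cur' ph' = curHeld c.shared cur ph)
    (hmid : midPhase cur' ph' = midPhase cur ph) :
    StepOK hash c g t { c.loc t with pc := .commit done cur' rest ph' } c.shared false :=
  h.readPC hp (pcOK_commit hph' hco hn hpo) (fun a => by simp only [held, hheld])
    (fun e => by simp [pend, hph, hph']) hmid

theorem Inv.bp_marked_iff (h : Inv hash c g) (hp : (c.loc t).pc = .commit done cur rest ph)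
    {a : Addr (Bucket Obj m)} (ha : a ∈ curHeld c.shared cur ph) (hm : midPhase cur ph ≠ some a) :
    (c.shared.mem a).marked = false ↔ a ∈ g.blue := by
  have hl : a ∈ held c.shared (c.loc t).pc := by
    rw [hp]; simp [held, ha]
  exact h.marked_iff (h.alloc t a hl) hl (by rw [hp]; exact hm)

theorem stepOK_chkMarked (h : Inv hash c g)
    (hp : (c.loc t).pc = .commit done cur rest .chkMarked) :
    StepOK hash c g t { c.loc t with
      pc := .commit done cur rest
        (if (c.shared.mem cur.loc.bp).marked then .bpUnlock else .chkBlue) } c.shared false := by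
  obtain ⟨hco, hpo, hn⟩ := h.commitOK hp rfl
  have hmk := h.bp_marked_iff hp (a := cur.loc.bp) (by simp [curHeld]) (by simp [midPhase])
  split_ifs with hc
  · refine h.readPhase hp rfl rfl hco hn ?_ rfl rfl
    obtain ⟨a, ha, rfl | hf⟩ := hco.pred cur (by simp)
    · rw [hmk.2 ha.1] at hc; cases hc
    · exact ⟨a, ha, hf⟩
  · exact h.readPhase hp rfl rfl hco hn (hmk.1 (by simpa using hc)) rfl rfl

theorem stepOK_chkBlue (h : Inv hash c g)
    (hp : (c.loc t).pc = .commit done cur rest .chkBlue) :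
    StepOK hash c g t { c.loc t with
      pc := .commit done cur rest
        (if (c.shared.mem cur.loc.bp).bl ≠ some cur.loc.bc then .bpUnlock else .chkRed) }
      c.shared false := by
  obtain ⟨hco, hpo, hn⟩ := h.commitOK hp rfl
  split_ifs with hc
  · refine h.readPhase hp rfl rfl hco hn ?_ rfl rfl
    obtain ⟨a, ha, rfl | hf⟩ := hco.pred cur (by simp)
    · exact absurd (ha.bl h.mem (hco.succ cur (by simp))) hc
    · exact ⟨a, ha, hf⟩
  · have hl := hco.loc cur (by simp)
    exact h.readPhase hp rfl rfl hco hn (isPred_isSucc_of_bl h.mem hpo hl.bp.2 hl.key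
      (not_not.1 hc) hl.key_bc).1 rfl rfl

theorem stepOK_bpUnlock (h : Inv hash c g)
    (hp : (c.loc t).pc = .commit done cur rest .bpUnlock) :
    StepOK hash c g t { c.loc t with pc := .commit done cur rest .bpLoad }
      (c.shared.unlock t cur.loc.bp) false := by
  obtain ⟨hco, hpo, hn⟩ := h.commitOK hp rfl
  refine h.unlockPC hp (pcOK_commit rfl hco hn hpo) (fun x => ?_) (fun _ => Iff.rfl) rfl
  simp only [held, curHeld, List.count_append, List.count_cons, beq_iff_eq, eq_comm (a := x)]
  omega

theorem stepOK_bpLoad (h : Inv hash c g)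
    (hp : (c.loc t).pc = .commit done cur rest .bpLoad) {p : Located Obj K V (Bucket Obj m)}
    (hprev : prevInBucket hash done cur = some p) {a : Addr (Bucket Obj m)}
    (ha : if p.ent.opn = .insert then (c.shared.mem p.loc.bp).bl = some a else a = p.loc.bp) :
    StepOK hash c g t { c.loc t with
      pc := .commit done { cur with loc := { cur.loc with bp := a } } rest .bpLock }
      c.shared false := by
  obtain ⟨hco, ⟨a', hpa, q, h1, h2, h3, h4, h5⟩, hn⟩ := h.commitOK hp rfl
  rw [hprev] at h1
  cases h1
  have haa : a' = a := by
    split_ifs at ha h5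
    · exact Option.some_injective _ (h5.symm.trans ha)
    · exact h5.trans ha.symm
  subst haa
  have hl := hco.loc cur (by simp)
  exact h.readPhase hp rfl rfl (hco.replace ⟨hpa.nodeOf h.mem, hl.rp, hl.rc, hl.bc, hpa.2.2.1,
    hl.key_bc⟩ rfl hpa) hn ⟨hpa, h4⟩ rfl rfl

theorem stepOK_bpLock (h : Inv hash c g)
    (hp : (c.loc t).pc = .commit done cur rest .bpLock)
    (hs : c.shared.lock t cur.loc.bp = some s') :
    StepOK hash c g t { c.loc t with pc := .commit done cur rest .chkRed } s' false := by
  obtain ⟨hco, hpo, hn⟩ := h.commitOK hp rfl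
  refine h.lockPC hp hs (hco.loc cur (by simp)).bp.1 (pcOK_commit rfl hco hn hpo.1) (fun x => ?_)
    (fun _ => Iff.rfl) rfl
  simp only [held, curHeld, List.count_append, List.count_cons, beq_iff_eq, eq_comm (a := x)]
  omega

theorem stepOK_chkRed (h : Inv hash c g)
    (hp : (c.loc t).pc = .commit done cur rest .chkRed) :
    StepOK hash c g t { c.loc t with
      pc := .commit done cur rest
        (if (c.shared.mem cur.loc.rp).rl ≠ some cur.loc.rc then .rpUnlock else .apply) }
      c.shared false := by
  obtain ⟨hco, hpo, hn⟩ := h.commitOK hp rfl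
  split_ifs
  · exact h.readPhase hp rfl rfl hco hn hpo rfl rfl
  · exact h.readPhase hp rfl rfl hco hn hpo rfl rfl

theorem stepOK_rpUnlock (h : Inv hash c g)
    (hp : (c.loc t).pc = .commit done cur rest .rpUnlock) :
    StepOK hash c g t { c.loc t with pc := .commit done cur rest .rpLoad }
      (c.shared.unlock t cur.loc.rp) false := by
  obtain ⟨hco, hpo, hn⟩ := h.commitOK hp rfl
  refine h.unlockPC hp (pcOK_commit rfl hco hn hpo) (fun x => ?_) (fun _ => Iff.rfl) rfl
  simp only [held, curHeld, List.count_append, List.count_cons, beq_iff_eq, eq_comm (a := x)]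
  omega

theorem stepOK_rpLoad (h : Inv hash c g)
    (hp : (c.loc t).pc = .commit done cur rest .rpLoad) {p : Located Obj K V (Bucket Obj m)}
    (hprev : prevInBucket hash done cur = some p) {a : Addr (Bucket Obj m)}
    (ha : (c.shared.mem p.loc.rp).rl = some a) :
    StepOK hash c g t { c.loc t with
      pc := .commit done { cur with loc := { cur.loc with rp := a } } rest .rpLock }
      c.shared false := by
  obtain ⟨hco, hpo, hn⟩ := h.commitOK hp rfl
  obtain ⟨hq, hqb⟩ := mem_of_prevInBucket hprev
  have hl := hco.loc cur (by simp)
  have hlq := (hco.loc p (by simp [hq])).rp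
  have hna := h.mem.rl _ hlq.1 a ha
  rw [hlq.2, hqb] at hna
  exact h.readPhase hp rfl rfl (hco.replace ⟨hl.bp, hna, hl.rc, hl.bc, hl.key, hl.key_bc⟩ rfl hpo)
    hn hpo rfl rfl

theorem stepOK_rpLock (h : Inv hash c g)
    (hp : (c.loc t).pc = .commit done cur rest .rpLock)
    (hs : c.shared.lock t cur.loc.rp = some s') :
    StepOK hash c g t { c.loc t with pc := .commit done cur rest .apply } s' false := by
  obtain ⟨hco, hpo, hn⟩ := h.commitOK hp rfl
  refine h.lockPC hp hs (hco.loc cur (by simp)).rp.1 (pcOK_commit rfl hco hn hpo) (fun x => ?_)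
    (fun _ => Iff.rfl) rfl
  simp only [held, curHeld, List.count_append, List.count_cons, beq_iff_eq, eq_comm (a := x)]
  omega

/-! ### The case distinction -/

theorem CommitOK.opn (hco : CommitOK hash g s op log done (cur :: rest)) :
    cur.ent.opn ≠ .lookup := by
  have : cur.ent ∈ orderedLL log := by rw [hco.log]; simp
  exact (mem_orderedLL.1 this).2

theorem Entry.seen_of_insert {e : Entry Obj K V} (h : e.opn = .insert) : e.seen = e.value := by
  simp [Entry.seen, h]

theorem Entry.seen_of_delete {e : Entry Obj K V} (h : e.opn ≠ .insert) (h' : e.opn ≠ .lookup) :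
    e.seen = none := by
  cases ho : e.opn <;> simp_all [Entry.seen]

theorem count_orderedLocks_cur (hn : cur.node = none) (a : Addr (Bucket Obj m)) :
    (orderedLocks (done ++ [cur]) ++ orderedLocks rest).count a =
      (orderedLocks done ++ [cur.loc.bp, cur.loc.rp, cur.loc.rc, cur.loc.bc] ++
        orderedLocks rest).count a := by
  simp [orderedLocks, hn]

theorem SameBut.refl (b : Option (Bucket Obj m)) (k : K) : SameBut g s g s b k :=
  ⟨rfl, fun _ => rfl, rfl, fun _ _ => Iff.rfl⟩

/-- A delete of a key that is not in the blue list. -/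
theorem stepOK_apply_skip (h : Inv hash c g)
    (hp : (c.loc t).pc = .commit done cur rest .apply) (ho : cur.ent.opn ≠ .insert)
    (hk : (c.shared.mem cur.loc.bc).key ≠ XKey.of cur.ent.key) :
    StepOK hash c g t { c.loc t with pc := advance (done ++ [cur]) rest } c.shared false := by
  obtain ⟨hco, hpo, hn⟩ := h.commitOK hp rfl
  have hsb : SameBut g c.shared g c.shared (bucket hash cur.ent.obj cur.ent.key) cur.ent.key :=
    .refl _ _
  have hno := (hco.succ cur (by simp)).key_ne hk
  have hco' := hco.apply hsb (h.log t) hpo (fun _ _ => rfl) (cur' := cur) rfl rfl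
    (f := cur.loc.bp) hpo.1 hpo.2.1 hpo.2.2.1.le
    (fun z hz hzb hzk => hpo.2.2.2 z hz hzb (lt_of_le_of_ne hzk (hno z hz hzb)))
    (by simp [orderedLocks]) (by simp [ho])
  refine h.apply hp rfl (by rw [hp]; simp [held, curHeld]) hpo hsb h.mem rfl (fun _ _ => rfl)
    (fun _ _ => rfl) (fun _ => rfl) (fun _ _ h => h) ?_ rfl ?_ hco'.advance ?_ ?_
  · exact Or.inr ⟨hno, Entry.seen_of_delete ho hco.opn⟩
  · intro a
    rw [hco'.held_advance, count_orderedLocks_cur hn, hp]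
    rfl
  · intro e
    rw [hco'.pend_advance]
    simp
  · intro x hx hu
    exact h.mark' t hx hu (by rw [hp]; simp [mid, midPhase])

theorem stepOK_apply (h : Inv hash c g)
    (hp : (c.loc t).pc = .commit done cur rest .apply) :
    StepOK hash c g t { c.loc t with
      pc :=
        if cur.ent.opn = .insert then
          if (c.shared.mem cur.loc.bc).key = XKey.of cur.ent.key then
            .commit done cur rest .insValue
          else if (c.shared.mem cur.loc.rc).key = XKey.of cur.ent.key then
            .commit done cur rest .redValue
          else .commit done cur rest .newNode
        else if (c.shared.mem cur.loc.bc).key = XKey.of cur.ent.key then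
          .commit done cur rest .delMark
        else advance (done ++ [cur]) rest } c.shared false := by
  obtain ⟨hco, hpo, hn⟩ := h.commitOK hp rfl
  split_ifs with h1 h2 h3 h4
  · exact h.readPhase hp rfl rfl hco hn ⟨hpo, h1, h2⟩ rfl rfl
  · exact h.readPhase hp rfl rfl hco hn ⟨hpo, h1, h2, h3⟩ rfl rfl
  · exact h.readPhase hp rfl rfl hco hn ⟨hpo, h1, h2⟩ rfl rfl
  · exact h.readPhase hp rfl rfl hco hn ⟨hpo, h1, h4⟩ rfl rfl
  · exact stepOK_apply_skip h hp h1 h4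

/-! ### After an update -/

/-- The last write of an update, which concerns only a timestamp. -/
theorem stepOK_stamp (h : Inv hash c g) (hp : (c.loc t).pc = .commit done cur rest ph)
    (hph : ph.applied = true) (hcur : procEntry c.shared cur ph = cur) (hmid : midPhase cur ph = none)
    {a : Addr (Bucket Obj m)} {f : Node K V (Bucket Obj m) → Node K V (Bucket Obj m)}
    (hf : ∀ x, (f x).key = x.key ∧ (f x).value = x.value ∧ (f x).marked = x.marked ∧
      (f x).rl = x.rl ∧ (f x).bl = x.bl) :
    StepOK hash c g t { c.loc t with pc := advance (done ++ [cur]) rest }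
      (c.shared.modify a f) false := by
  obtain ⟨hco, hpo, hn⟩ := h.commitOK' hp hph
  have hlk := orderedLocks_procEntry (s := c.shared) hph hn
  rw [hcur] at hco hlk
  refine h.stampPC hp hf hco.advance (fun x => ?_) (fun e => ?_) ?_
  · rw [hco.held_advance, orderedLocks_append, hlk]; rfl
  · rw [hco.pend_advance]; simp [pend, hph]
  · rw [mid_advance]; exact hmid.symm

theorem stepOK_newStamp (h : Inv hash c g) {a : Addr (Bucket Obj m)}
    (hp : (c.loc t).pc = .commit done cur rest (.newStamp a)) {ts : ℕ} :
    StepOK hash c g t { c.loc t with pc := .commit done cur rest .newField }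
      (c.shared.modify a fun x => { x with tsInsert := ts }) false := by
  obtain ⟨hco, hpo, hn⟩ := h.commitOK' hp rfl
  have hpe : procEntry c.shared cur .newField = procEntry c.shared cur (.newStamp a) := by
    simp only [procEntry]
    rw [show (c.shared.mem cur.loc.bp).bl = some a from hpo]
  refine h.stampPC hp (fun x => ⟨rfl, rfl, rfl, rfl, rfl⟩)
    (pcOK_commit' rfl (hpe ▸ hco) hn trivial) (fun x => ?_) (fun e => Iff.rfl) rfl
  simp only [held, curHeld]
  rw [show (c.shared.mem cur.loc.bp).bl = some a from hpo]
  rfl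

theorem stepOK_newField (h : Inv hash c g)
    (hp : (c.loc t).pc = .commit done cur rest .newField) :
    StepOK hash c g t { c.loc t with
      pc := advance (done ++ [{ cur with node := (c.shared.mem cur.loc.bp).bl }]) rest }
      c.shared false := by
  obtain ⟨hco, hpo, hn⟩ := h.commitOK' hp rfl
  have hlk := orderedLocks_procEntry (s := c.shared) (ph := .newField) rfl hn
  refine h.readPC hp hco.advance (fun x => ?_) (fun e => ?_) ?_
  · erw [hco.held_advance]; rw [orderedLocks_append, hlk]; rfl
  · erw [hco.pend_advance]; simp [pend, Phase.applied, procEntry]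
  · rw [mid_advance]; rfl

end CommitStep


section CommitWrite

variable {Obj K V : Type*} [DecidableEq Obj] [LinearOrder K] {m : ℕ}
variable {hash : Obj → K → Fin m} {c : Config Obj K V m} {g g' : Ghost Obj K V m}
  {s s' : Shared K V (Bucket Obj m)} {t : Tx} {l' : Local Obj K V (Bucket Obj m)}
  {pc pc' : PC Obj K V (Bucket Obj m)} {op : Op Obj K V} {log : List (Entry Obj K V)}
  {done rest : List (Located Obj K V (Bucket Obj m))} {cur : Located Obj K V (Bucket Obj m)}
  {ph : Phase (Bucket Obj m)}

theorem modify_of_ne {a x : Addr (Bucket Obj m)}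
    {f : Node K V (Bucket Obj m) → Node K V (Bucket Obj m)} (hx : x ≠ a) :
    (s.modify a f).mem x = s.mem x := by
  simp [Shared.modify, hx]

theorem modify_self {a : Addr (Bucket Obj m)}
    {f : Node K V (Bucket Obj m) → Node K V (Bucket Obj m)} :
    (s.modify a f).mem a = f (s.mem a) := by
  simp [Shared.modify]

theorem FreshOK.congr {a : Addr (Bucket Obj m)} (h : FreshOK hash g s cur a)
    (hf : s'.fresh = s.fresh) (hk : (s'.mem a).key = (s.mem a).key)
    (hv : (s'.mem a).value = (s.mem a).value) : FreshOK hash g s' cur a :=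
  ⟨⟨(alloc_congr hf a).2 h.1.1, h.1.2⟩, hk.trans h.2.1, hv.trans h.2.2⟩

/-- The red current node is not in the blue list if the blue one does not carry the key. -/
theorem CommitOK.not_blue (hco : CommitOK hash g s op log done (cur :: rest))
    (hk : (s.mem cur.loc.bc).key ≠ XKey.of cur.ent.key) {a : Addr (Bucket Obj m)}
    (ha : NodeOf g s (bucket hash cur.ent.obj cur.ent.key) a)
    (hak : (s.mem a).key = XKey.of cur.ent.key) : a ∉ g.blue := fun hb =>
  (hco.succ cur (by simp)).key_ne hk a hb ha.2 hak

/-! ### Insertions -/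

theorem stepOK_insValue (h : Inv hash c g)
    (hp : (c.loc t).pc = .commit done cur rest .insValue) :
    StepOK hash c g t { c.loc t with pc := .commit done cur rest .insStamp }
      (c.shared.modify cur.loc.bc fun x => { x with value := cur.ent.value }) false := by
  obtain ⟨hco, ⟨hpr, ho, hk⟩, hn⟩ := h.commitOK hp rfl
  have hsc := hco.succ cur (by simp)
  set s' := c.shared.modify cur.loc.bc fun x => { x with value := cur.ent.value } with hs'
  have hkey : ∀ x, (s'.mem x).key = (c.shared.mem x).key := modify_congr _ fun _ => rfl
  have hbl : ∀ x, (s'.mem x).bl = (c.shared.mem x).bl := modify_congr _ fun _ => rfl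
  have hrl : ∀ x, (s'.mem x).rl = (c.shared.mem x).rl := modify_congr _ fun _ => rfl
  have hmk : ∀ x, (s'.mem x).marked = (c.shared.mem x).marked := modify_congr _ fun _ => rfl
  have hsb : SameBut g c.shared g s' (bucket hash cur.ent.obj cur.ent.key) cur.ent.key :=
    ⟨rfl, hkey, rfl, fun _ _ => Iff.rfl⟩
  have hbc : cur.loc.bc ∈ held c.shared (c.loc t).pc := by rw [hp]; simp [held, curHeld]
  have hco' := hco.apply hsb (h.log t) hpr (fun x _ => hbl x) (cur' := cur) rfl rfl
    (f := cur.loc.bc) hsc.1 hsc.2.1 hk.le (fun z _ _ hz => hk ▸ hz) (by simp [orderedLocks])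
    (by simp only [ho, if_true, hbl]; exact hpr.bl h.mem hsc)
  refine h.apply hp rfl (by rw [hp]; simp [held, curHeld]) hpr hsb
    (h.mem.congr hkey hbl rfl (by simpa only [hrl] using h.mem.rl)) rfl
    (fun x _ => hbl x) (fun x hx => ?_) hmk (fun _ _ h => h) ?_ rfl ?_
    (pcOK_commit' rfl hco' hn trivial) ?_ ?_
  · rw [hs', modify_of_ne]
    rintro rfl
    exact hx.elim (fun hx => hx hbc) fun hx => hx ⟨hsc.2.1, hk⟩
  · refine Or.inl ⟨_, hsc.1, hsc.2.1, (hkey _).trans hk, ?_⟩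
    rw [hs', modify_self, Entry.seen_of_insert ho]
  · intro a; rw [hp]; rfl
  · intro e; simp [pend, Phase.applied]
  · intro x hx hu
    exact h.mark' t hx hu (by rw [hp]; simp [mid, midPhase])

theorem stepOK_redValue (h : Inv hash c g)
    (hp : (c.loc t).pc = .commit done cur rest .redValue) :
    StepOK hash c g t { c.loc t with pc := .commit done cur rest .redUnmark }
      (c.shared.modify cur.loc.rc fun x => { x with value := cur.ent.value }) false := by
  obtain ⟨hco, ⟨hpr, ho, hk, hrk⟩, hn⟩ := h.commitOK hp rfl
  have hnb := hco.not_blue hk (hco.loc cur (by simp)).rc hrk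
  set s' := c.shared.modify cur.loc.rc fun x => { x with value := cur.ent.value } with hs'
  have hkey : ∀ x, (s'.mem x).key = (c.shared.mem x).key := modify_congr _ fun _ => rfl
  have hbl : ∀ x, (s'.mem x).bl = (c.shared.mem x).bl := modify_congr _ fun _ => rfl
  have hrl : ∀ x, (s'.mem x).rl = (c.shared.mem x).rl := modify_congr _ fun _ => rfl
  have hmk : ∀ x, (s'.mem x).marked = (c.shared.mem x).marked := modify_congr _ fun _ => rfl
  have hrc : cur.loc.rc ∈ held c.shared (c.loc t).pc := by rw [hp]; simp [held, curHeld]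
  refine h.touch (h.mem.congr hkey hbl rfl (by simpa only [hrl] using h.mem.rl)) hkey rfl rfl
    (fun x hx => modify_of_ne fun e => hx (e ▸ hrc)) (fun x hx => ?_) ?_
    (pcOK_commit rfl (hco.congr hkey rfl fun x _ => hbl x) hn ⟨(isPred_congr hkey).2 hpr, ho,
      (hkey _).symm ▸ hk, ⟨?_, (hkey _).trans hrk, ?_⟩⟩) ?_ ?_
  · rw [hs', modify_of_ne (show x ≠ cur.loc.rc from fun e => hnb (e ▸ hx))]
  · intro a; rw [hp]; rfl
  · exact (hco.loc cur (by simp)).rc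
  · rw [hs', modify_self]
  · intro e; rw [hp]; rfl
  · intro x hx hu _
    rw [hmk]
    exact h.mark' t hx hu (by rw [hp]; simp [mid, midPhase])

theorem stepOK_redUnmark (h : Inv hash c g)
    (hp : (c.loc t).pc = .commit done cur rest .redUnmark) :
    StepOK hash c g t { c.loc t with pc := .commit done cur rest .redBlue }
      (c.shared.modify cur.loc.rc fun x => { x with marked := false }) false := by
  obtain ⟨hco, ⟨hpr, ho, hk, hfo⟩, hn⟩ := h.commitOK hp rfl
  set s' := c.shared.modify cur.loc.rc fun x => { x with marked := false } with hs'
  have hkey : ∀ x, (s'.mem x).key = (c.shared.mem x).key := modify_congr _ fun _ => rfl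
  have hbl : ∀ x, (s'.mem x).bl = (c.shared.mem x).bl := modify_congr _ fun _ => rfl
  have hrl : ∀ x, (s'.mem x).rl = (c.shared.mem x).rl := modify_congr _ fun _ => rfl
  have hvl : ∀ x, (s'.mem x).value = (c.shared.mem x).value := modify_congr _ fun _ => rfl
  have hrc : cur.loc.rc ∈ held c.shared (c.loc t).pc := by rw [hp]; simp [held, curHeld]
  refine h.touch (h.mem.congr hkey hbl rfl (by simpa only [hrl] using h.mem.rl)) hkey rfl rfl
    (fun x hx => modify_of_ne fun e => hx (e ▸ hrc)) (fun x _ => hvl x) ?_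
    (pcOK_commit rfl (hco.congr hkey rfl fun x _ => hbl x) hn ⟨(isPred_congr hkey).2 hpr, ho,
      (hkey _).symm ▸ hk, hfo.congr rfl (hkey _) (hvl _), ?_⟩) ?_ ?_
  · intro a; rw [hp]; rfl
  · rw [hs', modify_self]
  · intro e; rw [hp]; rfl
  · intro x hx hu hm
    rw [hs', modify_of_ne fun e => hm (by rw [e]; rfl)]
    exact h.mark' t hx hu (by rw [hp]; simp [mid, midPhase])

theorem MemInv.setBl (hm : MemInv g s) {a y : Addr (Bucket Obj m)} (ha : a ∉ g.blue)
    (hy : NodeOf g s (g.bkt a) y) : MemInv g (s.modify a fun x => { x with bl := some y }) := by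
  set s' := s.modify a fun x => { x with bl := some y } with hs'
  have hkey : ∀ x, (s'.mem x).key = (s.mem x).key := modify_congr _ fun _ => rfl
  have hrl : ∀ x, (s'.mem x).rl = (s.mem x).rl := modify_congr _ fun _ => rfl
  have hbl : ∀ x ∈ g.blue, (s'.mem x).bl = (s.mem x).bl := fun x hx => by
    rw [hs', modify_of_ne (show x ≠ a from fun e => ha (e ▸ hx))]
  refine ⟨hm.head_mem, by simpa only [hkey] using hm.head_key, hm.head_bkt, hm.alloc,
    by simpa only [hkey] using hm.inj, ?_, ?_, fun x hx z hz => hm.rl x hx z (hrl x ▸ hz), ?_⟩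
  · intro x hx
    simpa only [hkey, hbl x hx] using hm.next x hx
  · intro x hx
    simpa only [hkey, hbl x hx] using hm.total x hx
  · intro x hx z hz
    by_cases hxa : x = a
    · subst hxa
      rw [hs', modify_self] at hz
      cases hz
      exact hy
    · rw [hs', modify_of_ne hxa] at hz
      exact hm.bl x hx z hz

theorem stepOK_redBlue (h : Inv hash c g)
    (hp : (c.loc t).pc = .commit done cur rest .redBlue) :
    StepOK hash c g t { c.loc t with pc := .commit done cur rest .redLink }
      (c.shared.modify cur.loc.rc fun x => { x with bl := some cur.loc.bc }) false := by
  obtain ⟨hco, ⟨hpr, ho, hk, hfo, hmf⟩, hn⟩ := h.commitOK hp rfl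
  have hnb := hco.not_blue hk hfo.1 hfo.2.1
  set s' := c.shared.modify cur.loc.rc fun x => { x with bl := some cur.loc.bc } with hs'
  have hkey : ∀ x, (s'.mem x).key = (c.shared.mem x).key := modify_congr _ fun _ => rfl
  have hmk : ∀ x, (s'.mem x).marked = (c.shared.mem x).marked := modify_congr _ fun _ => rfl
  have hvl : ∀ x, (s'.mem x).value = (c.shared.mem x).value := modify_congr _ fun _ => rfl
  have hrc : cur.loc.rc ∈ held c.shared (c.loc t).pc := by rw [hp]; simp [held, curHeld]
  have hne : ∀ x ∈ g.blue, x ≠ cur.loc.rc := fun x hx e => hnb (e ▸ hx)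
  refine h.touch (h.mem.setBl hnb ?_) hkey rfl rfl
    (fun x hx => modify_of_ne fun e => hx (e ▸ hrc)) (fun x _ => hvl x) ?_
    (pcOK_commit rfl (hco.congr hkey rfl fun x hx => by rw [hs', modify_of_ne (hne x hx)]) hn
      ⟨(isPred_congr hkey).2 hpr, ho, (hkey _).symm ▸ hk, hfo.congr rfl (hkey _) (hvl _),
        (hmk _).trans hmf, ?_⟩) ?_ ?_
  · rw [hfo.1.2]; exact (hco.loc cur (by simp)).bc
  · intro a; rw [hp]; rfl
  · rw [hs', modify_self]
  · intro e; rw [hp]; rfl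
  · intro x hx hu hm
    rw [hmk]
    exact h.mark' t hx hu (by rw [hp]; exact hm)

/-- A node is linked into the blue list. -/
theorem stepOK_link (h : Inv hash c g) (hp : (c.loc t).pc = .commit done cur rest ph)
    {ph' : Phase (Bucket Obj m)} {a : Addr (Bucket Obj m)} (hph : ph.applied = false)
    (hph' : ph'.applied = true) (hmid : midPhase cur ph = some a)
    (hbp : cur.loc.bp ∈ curHeld c.shared cur ph)
    (hpr : IsPred g c.shared (bucket hash cur.ent.obj cur.ent.key) cur.ent.key cur.loc.bp)
    (ho : cur.ent.opn = .insert) (hk : (c.shared.mem cur.loc.bc).key ≠ XKey.of cur.ent.key)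
    (hfo : FreshOK hash g c.shared cur a) (hmf : (c.shared.mem a).marked = false)
    (hbl : (c.shared.mem a).bl = some cur.loc.bc)
    (hheld : ∀ s : Shared K V (Bucket Obj m), (s.mem cur.loc.bp).bl = some a →
      curHeld s cur ph' = curHeld c.shared cur ph)
    (hfl : ∀ s : Shared K V (Bucket Obj m), a ∈ orderedLocks [procEntry s cur ph'])
    (hpo : ∀ g (s : Shared K V (Bucket Obj m)), (s.mem cur.loc.bp).bl = some a →
      PhaseOK hash g s done cur ph') :
    StepOK hash c g t { c.loc t with pc := .commit done cur rest ph' }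
      (c.shared.modify cur.loc.bp fun x => { x with bl := some a }) false := by
  obtain ⟨hco, -, hn⟩ := h.commitOK hp hph
  have hsc := hco.succ cur (by simp)
  set s' := c.shared.modify cur.loc.bp fun x => { x with bl := some a } with hs'
  have hkey : ∀ x, (s'.mem x).key = (c.shared.mem x).key := modify_congr _ fun _ => rfl
  have hmk : ∀ x, (s'.mem x).marked = (c.shared.mem x).marked := modify_congr _ fun _ => rfl
  have hvl : ∀ x, (s'.mem x).value = (c.shared.mem x).value := modify_congr _ fun _ => rfl
  have hblp : (s'.mem cur.loc.bp).bl = some a := by rw [hs', modify_self]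
  have hbph : cur.loc.bp ∈ held c.shared (c.loc t).pc := by rw [hp]; simp [held, hbp]
  have hno := hsc.key_ne hk
  have hsb : SameBut g c.shared { g with blue := insert a g.blue } s'
      (bucket hash cur.ent.obj cur.ent.key) cur.ent.key := by
    refine ⟨rfl, hkey, rfl, fun x hx => ?_⟩
    simp only [Set.mem_insert_iff, or_iff_right_iff_imp]
    rintro rfl
    exact absurd ⟨hfo.1.2, hfo.2.1⟩ hx
  have hco' := hco.apply hsb (h.log t) hpr (cur' := procEntry s' cur ph') (fun x hx => by
      rw [hs', modify_of_ne]; rintro rfl; exact hx hpr.2.1)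
    (procEntry_ent _ _ _) (procEntry_loc _ _ _) (f := a) (Or.inl rfl) hfo.1.2 hfo.2.1.le
    (fun z _ _ hz => hfo.2.1 ▸ hz) (hfl s') (by simp only [ho, if_true]; exact hblp)
  refine h.apply hp hph hbph hpr hsb (h.mem.link hpr hsc hk hfo.1 hfo.2.1 hbl) rfl
    (fun x hx => ?_) (fun x _ => hvl x) hmk (fun _ _ h => Or.inr h) ?_ rfl ?_
    (pcOK_commit' hph' hco' hn (hpo _ _ hblp)) ?_ ?_
  · rw [hs', modify_of_ne]
    rintro rfl
    exact hx hbph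
  · refine Or.inl ⟨a, Or.inl rfl, hfo.1.2, (hkey _).trans hfo.2.1, ?_⟩
    rw [hvl, Entry.seen_of_insert ho, hfo.2.2]
  · intro x
    rw [hp]
    simp only [held, hheld s' hblp]
  · intro e; simp [pend, hph']
  · intro x hx hu
    by_cases hxa : x = a
    · subst hxa
      simp [hmf]
    · simp only [Set.mem_insert_iff, hxa, false_or]
      refine h.mark' t hx hu ?_
      rw [hp]
      simp only [mid, hmid, ne_eq, Option.some.injEq]
      exact fun e => hxa e.symm

theorem stepOK_redLink (h : Inv hash c g)
    (hp : (c.loc t).pc = .commit done cur rest .redLink) :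
    StepOK hash c g t { c.loc t with pc := .commit done cur rest .redStamp }
      (c.shared.modify cur.loc.bp fun x => { x with bl := some cur.loc.rc }) false := by
  obtain ⟨hco, ⟨hpr, ho, hk, hfo, hmf, hbl⟩, hn⟩ := h.commitOK hp rfl
  exact stepOK_link h hp rfl rfl rfl (by simp [curHeld]) hpr ho hk hfo hmf hbl (fun _ _ => rfl)
    (fun _ => by simp [orderedLocks, procEntry]) fun _ _ _ => trivial

theorem stepOK_newBlue (h : Inv hash c g) {a : Addr (Bucket Obj m)}
    (hp : (c.loc t).pc = .commit done cur rest (.newBlue a)) :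
    StepOK hash c g t { c.loc t with pc := .commit done cur rest (.newStamp a) }
      (c.shared.modify cur.loc.bp fun x => { x with bl := some a }) false := by
  obtain ⟨hco, ⟨hpr, ho, hk, hfo, hmf, hbl⟩, hn⟩ := h.commitOK hp rfl
  exact stepOK_link h hp rfl rfl rfl (by simp [curHeld]) hpr ho hk hfo hmf hbl (fun _ _ => rfl)
    (fun _ => by simp [orderedLocks, procEntry]) fun _ _ h => h

theorem stepOK_newRed (h : Inv hash c g) {a : Addr (Bucket Obj m)}
    (hp : (c.loc t).pc = .commit done cur rest (.newRed a)) :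
    StepOK hash c g t { c.loc t with pc := .commit done cur rest (.newBlue a) }
      (c.shared.modify cur.loc.rp fun x => { x with rl := some a }) false := by
  obtain ⟨hco, hpo, hn⟩ := h.commitOK hp rfl
  exact h.redPC hp (hco.loc cur (by simp)).rp hpo.2.2.2.1.1 (pcOK_commit rfl hco hn hpo)
    (fun _ => rfl) (fun _ => Iff.rfl) rfl

theorem Frame.congr_right {P : Addr (Bucket Obj m) → Prop} {s₁ : Shared K V (Bucket Obj m)}
    (h : Frame hash g s g' s₁ P) (hc : CoreEq s₁ s') : Frame hash g s g' s' P := by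
  refine ⟨fun x hx => ?_, fun x hx => (hc.bl x).trans (h.bl x hx),
    fun x hx => (hc.value x).trans (h.value x hx), fun x hx => (hc.marked x).trans (h.marked x hx),
    h.blue, fun b k a ha hp => (isPred_congr hc.key).2 (h.pred b k a ha hp),
    fun b k a z ha hz hp hs => (isSucc_congr hc.key).2 (h.succ b k a z ha hz hp hs), h.abs⟩
  obtain ⟨h1, h2, h3⟩ := h.ext x hx
  exact ⟨(alloc_congr hc.fresh x).2 h1, h2, (hc.key x).trans h3⟩

theorem stepOK_newNode (h : Inv hash c g)
    (hp : (c.loc t).pc = .commit done cur rest .newNode)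
    (hs : (c.shared.alloc ⟨XKey.of cur.ent.key, cur.ent.value, false, 0, 0, 0, some cur.loc.rc,
      some cur.loc.bc⟩).lock t (.node c.shared.fresh) = some s') :
    StepOK hash c g t
      { c.loc t with pc := .commit done cur rest (.newRed (.node c.shared.fresh)) } s' false := by
  have hok := h.pcOK hp
  obtain ⟨hco, ⟨hpr, ho, hk⟩, hn⟩ := h.commitOK hp rfl
  have hl := hco.loc cur (by simp)
  set a : Addr (Bucket Obj m) := .node c.shared.fresh with ha
  set x : Node K V (Bucket Obj m) :=
    ⟨XKey.of cur.ent.key, cur.ent.value, false, 0, 0, 0, some cur.loc.rc, some cur.loc.bc⟩ with hx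
  set b := bucket hash cur.ent.obj cur.ent.key with hb
  have hc : CoreEq (c.shared.alloc x) s' := .of_mem (lock_eq hs)
  have hfr : Frame hash g c.shared (g.alloc c.shared b) s' (Alloc c.shared) :=
    (frame_alloc h.mem).congr_right hc
  have hmem : MemInv (g.alloc c.shared b) (c.shared.alloc x) := by
    refine h.mem.create ?_ ?_
    · rintro y hy; cases hy; exact hl.rc
    · rintro y hy; cases hy; exact hl.bc
  have hal : ∀ y, Alloc s' y ↔ Alloc c.shared y ∨ y = a := fun y =>
    (alloc_congr hc.fresh y).trans alloc_alloc
  have hma : s'.mem a = x := by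
    rw [(lock_eq hs).1]; simp [Shared.alloc, ha]
  have hmy : ∀ y, Alloc c.shared y → s'.mem y = c.shared.mem y := fun y hy => by
    rw [(lock_eq hs).1, alloc_mem_of_alloc hy]
  have hcount : ∀ y, (held s' (.commit done cur rest (.newRed a))).count y =
      (held c.shared (c.loc t).pc).count y + if y = a then 1 else 0 := by
    intro y
    rw [hp]
    simp only [held, curHeld, List.count_append, List.count_cons, List.count_nil, beq_iff_eq,
      eq_comm (a := y)]
    omega
  have hok' := hok.frame hfr h.mem fun y hy => h.alloc t y (by rw [hp]; exact hy)
  simp only [PCOK, Phase.applied, if_false, Bool.false_eq_true] at hok'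
  obtain ⟨hco', ⟨hpr', -, hk'⟩, -⟩ := hok'
  refine ⟨g.alloc c.shared b, h.exec ?_ ?_ ?_ ?_ ?_ ?_ (h.log t) ?_ ?_, by simp [Ghost.alloc]⟩
  · exact hmem.congr hc.key hc.bl hc.fresh (by rw [(lock_eq hs).1]; exact hmem.rl)
  · exact ⟨hfr.1, fun x hx => hfr.2 x hx.1, fun x hx => hfr.3 x hx.1, fun x hx => hfr.4 x hx.1,
      fun x hx => hfr.5 x hx.1, fun b k a hx => hfr.6 b k a hx.1,
      fun b k a c hx hx' => hfr.7 b k a c hx.1 hx'.1, fun o k a hx => hfr.8 o k a hx.1⟩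
  · intro u y hu
    rw [holds_lock hs]
    simp only [hu, false_and, if_false, Nat.add_zero]
    rfl
  · intro y
    rw [holds_lock hs]
    simp only [true_and]
    rw [hcount, ← h.lock]
    rfl
  · intro y hy
    refine (hal y).2 ?_
    by_cases hya : y = a
    · exact Or.inr hya
    · have := List.count_pos_iff.2 hy
      rw [hcount, if_neg hya] at this
      exact Or.inl (h.alloc t y (List.count_pos_iff.1 this))
  · refine pcOK_commit rfl hco' hn ⟨hpr', ho, hk', ⟨⟨(hal a).2 (Or.inr rfl), ?_⟩, ?_, ?_⟩, ?_, ?_⟩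
    · simp [Ghost.alloc, ha, hb]
    all_goals rw [hma]
  · have hv := h.val' t
    rw [hp] at hv
    refine hv.mono (fun o k v hv => ?_) rfl
    have := hv.alloc (b := some b) (x := x) h.mem
    simpa only [Holds, hc.key, hc.value] using this
  · intro y hy hu ht
    rcases (hal y).1 hy with hy | rfl
    · rw [hmy y hy]
      exact h.mark' t hy hu (by rw [hp]; simp [mid, midPhase])
    · exact absurd rfl ht

/-! ### Deletions -/

theorem stepOK_delMark (h : Inv hash c g)
    (hp : (c.loc t).pc = .commit done cur rest .delMark) :
    StepOK hash c g t { c.loc t with pc := .commit done cur rest .delLoad }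
      (c.shared.modify cur.loc.bc fun x => { x with marked := true }) false := by
  obtain ⟨hco, ⟨hpr, ho, hk⟩, hn⟩ := h.commitOK hp rfl
  set s' := c.shared.modify cur.loc.bc fun x => { x with marked := true } with hs'
  have hkey : ∀ x, (s'.mem x).key = (c.shared.mem x).key := modify_congr _ fun _ => rfl
  have hbl : ∀ x, (s'.mem x).bl = (c.shared.mem x).bl := modify_congr _ fun _ => rfl
  have hrl : ∀ x, (s'.mem x).rl = (c.shared.mem x).rl := modify_congr _ fun _ => rfl
  have hvl : ∀ x, (s'.mem x).value = (c.shared.mem x).value := modify_congr _ fun _ => rfl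
  have hbc : cur.loc.bc ∈ held c.shared (c.loc t).pc := by rw [hp]; simp [held, curHeld]
  refine h.touch (h.mem.congr hkey hbl rfl (by simpa only [hrl] using h.mem.rl)) hkey rfl rfl
    (fun x hx => modify_of_ne fun e => hx (e ▸ hbc)) (fun x _ => hvl x) ?_
    (pcOK_commit rfl (hco.congr hkey rfl fun x _ => hbl x) hn ⟨(isPred_congr hkey).2 hpr, ho,
      (hkey _).trans hk, ?_⟩) ?_ ?_
  · intro a; rw [hp]; rfl
  · rw [hs', modify_self]
  · intro e; rw [hp]; rfl
  · intro x hx hu hm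
    rw [hs', modify_of_ne fun e => hm (by rw [e]; rfl)]
    exact h.mark' t hx hu (by rw [hp]; simp [mid, midPhase])

theorem stepOK_delLoad (h : Inv hash c g)
    (hp : (c.loc t).pc = .commit done cur rest .delLoad) :
    StepOK hash c g t
      { c.loc t with pc := .commit done cur rest (.delLink (c.shared.mem cur.loc.bc).bl) }
      c.shared false := by
  obtain ⟨hco, ⟨hpr, ho, hk, hmk⟩, hn⟩ := h.commitOK hp rfl
  exact h.readPhase hp rfl rfl hco hn ⟨hpr, ho, hk, hmk, rfl⟩ rfl rfl

theorem stepOK_delLink (h : Inv hash c g) {x : Option (Addr (Bucket Obj m))}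
    (hp : (c.loc t).pc = .commit done cur rest (.delLink x)) :
    StepOK hash c g t { c.loc t with pc := .commit done cur rest .delStamp }
      (c.shared.modify cur.loc.bp fun y => { y with bl := x }) false := by
  obtain ⟨hco, ⟨hpr, ho, hk, hmt, rfl⟩, hn⟩ := h.commitOK hp rfl
  have hsc := hco.succ cur (by simp)
  set s' := c.shared.modify cur.loc.bp fun y => { y with bl := (c.shared.mem cur.loc.bc).bl }
    with hs'
  have hkey : ∀ x, (s'.mem x).key = (c.shared.mem x).key := modify_congr _ fun _ => rfl
  have hmk : ∀ x, (s'.mem x).marked = (c.shared.mem x).marked := modify_congr _ fun _ => rfl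
  have hvl : ∀ x, (s'.mem x).value = (c.shared.mem x).value := modify_congr _ fun _ => rfl
  have hbph : cur.loc.bp ∈ held c.shared (c.loc t).pc := by rw [hp]; simp [held, curHeld]
  have hbch : cur.loc.bc ∈ held c.shared (c.loc t).pc := by rw [hp]; simp [held, curHeld]
  have huniq : ∀ z ∈ g.blue, g.bkt z = bucket hash cur.ent.obj cur.ent.key →
      (c.shared.mem z).key = XKey.of cur.ent.key → z = cur.loc.bc := fun z hz h1 h2 =>
    h.mem.inj z hz _ hsc.1 (h1.trans hsc.2.1.symm) (h2.trans hk.symm)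
  have hsb : SameBut g c.shared { g with blue := g.blue \ {cur.loc.bc} } s'
      (bucket hash cur.ent.obj cur.ent.key) cur.ent.key := by
    refine ⟨rfl, hkey, rfl, fun x hx => ?_⟩
    simp only [Set.mem_sdiff, Set.mem_singleton_iff, and_iff_left_iff_imp]
    rintro - rfl
    exact hx ⟨hsc.2.1, hk⟩
  have hpb : cur.loc.bp ≠ cur.loc.bc := fun e => hpr.2.2.1.ne (e ▸ hk)
  have hco' := hco.apply hsb (h.log t) hpr (cur' := cur) (fun x hx => by
      rw [hs', modify_of_ne]; rintro rfl; exact hx hpr.2.1)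
    rfl rfl (f := cur.loc.bp) ⟨hpr.1, hpb⟩ hpr.2.1 hpr.2.2.1.le
    (fun z hz hzb hzk => hpr.2.2.2 z hz.1 hzb (lt_of_le_of_ne hzk fun e =>
      hz.2 (huniq z hz.1 hzb e))) (by simp [orderedLocks]) (by simp [ho])
  refine h.apply hp rfl hbph hpr hsb (h.mem.unlink hpr hsc hk) rfl
    (fun x hx => ?_) (fun x _ => hvl x) hmk (fun x hx hb => ⟨hb, fun e => hx (e ▸ hbch)⟩) ?_ rfl ?_
    (pcOK_commit' rfl hco' hn trivial) ?_ ?_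
  · rw [hs', modify_of_ne]
    rintro rfl
    exact hx hbph
  · refine Or.inr ⟨fun z hz hzb hzk => ?_, Entry.seen_of_delete ho hco.opn⟩
    rw [hkey] at hzk
    exact hz.2 (huniq z hz.1 hzb hzk)
  · intro x
    rw [hp]
    rfl
  · intro e; simp [pend, Phase.applied]
  · intro x hx hu
    by_cases hxa : x = cur.loc.bc
    · subst hxa
      simp [hmt]
    · simp only [Set.mem_sdiff, Set.mem_singleton_iff, hxa, not_false_eq_true, and_true]
      refine h.mark' t hx hu ?_
      rw [hp]
      simp only [mid, midPhase, ne_eq, Option.some.injEq]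
      exact fun e => hxa e.symm

end CommitWrite


section Step

variable {Obj K V : Type*} [DecidableEq Obj] [LinearOrder K] {m : ℕ}
variable {hash : Obj → K → Fin m} {c : Config Obj K V m} {g g' : Ghost Obj K V m}
  {s s' : Shared K V (Bucket Obj m)} {t : Tx} {l' : Local Obj K V (Bucket Obj m)}
  {act : Act Obj K V (Bucket Obj m)} {lp : Bool}
  {done rest : List (Located Obj K V (Bucket Obj m))} {cur : Located Obj K V (Bucket Obj m)}
  {ph : Phase (Bucket Obj m)}

theorem stepOK_commitStep (h : Inv hash c g) (hp : (c.loc t).pc = .commit done cur rest ph)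
    {o : Outcome Obj K V m} {ts : ℕ}
    (hs : commitStep hash t ts c.shared done cur rest ph = some o) :
    StepOK hash c g t { c.loc t with pc := o.1 } o.2.1 o.2.2.2 := by
  cases ph <;> simp only [commitStep, Option.some.injEq] at hs
  case chkMarked => subst hs; exact stepOK_chkMarked h hp
  case chkBlue => subst hs; exact stepOK_chkBlue h hp
  case bpUnlock => subst hs; exact stepOK_bpUnlock h hp
  case bpLoad =>
    split at hs
    · cases hs
    · next p hprev =>
      split_ifs at hs with ho
      · split at hs <;> cases hs
        next a ha => exact stepOK_bpLoad h hp hprev (by simp only [ho, if_true]; exact ha)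
      · cases hs
        exact stepOK_bpLoad h hp hprev (by simp only [ho, if_false])
  case bpLock =>
    obtain ⟨s', hs', rfl⟩ := Option.map_eq_some_iff.1 hs
    exact stepOK_bpLock h hp hs'
  case chkRed => subst hs; exact stepOK_chkRed h hp
  case rpUnlock => subst hs; exact stepOK_rpUnlock h hp
  case rpLoad =>
    split at hs
    · cases hs
    · next p hprev =>
      split at hs <;> cases hs
      next a ha => exact stepOK_rpLoad h hp hprev ha
  case rpLock =>
    obtain ⟨s', hs', rfl⟩ := Option.map_eq_some_iff.1 hs
    exact stepOK_rpLock h hp hs'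
  case apply => subst hs; exact stepOK_apply h hp
  case insValue => subst hs; exact stepOK_insValue h hp
  case redValue => subst hs; exact stepOK_redValue h hp
  case redUnmark => subst hs; exact stepOK_redUnmark h hp
  case redBlue => subst hs; exact stepOK_redBlue h hp
  case redLink => subst hs; exact stepOK_redLink h hp
  case newNode =>
    obtain ⟨s', hs', rfl⟩ := Option.map_eq_some_iff.1 hs
    exact stepOK_newNode h hp hs'
  case newRed => subst hs; exact stepOK_newRed h hp
  case newBlue => subst hs; exact stepOK_newBlue h hp
  case newStamp => subst hs; exact stepOK_newStamp h hp
  case newField => subst hs; exact stepOK_newField h hp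
  case delMark => subst hs; exact stepOK_delMark h hp
  case delLoad => subst hs; exact stepOK_delLoad h hp
  case delLink => subst hs; exact stepOK_delLink h hp
  case insStamp | redStamp =>
    subst hs
    refine stepOK_stamp (f := fun x => { x with tsInsert := ts }) h hp rfl rfl rfl ?_
    exact fun _ => ⟨rfl, rfl, rfl, rfl, rfl⟩
  case delStamp =>
    subst hs
    refine stepOK_stamp (f := fun x => { x with tsDelete := ts }) h hp rfl rfl rfl ?_
    exact fun _ => ⟨rfl, rfl, rfl, rfl, rfl⟩

theorem step_ok (h : Inv hash c g)
    (hs : step hash t (c.loc t) c.shared = some (l', s', act, lp)) :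
    StepOK hash c g t l' s' lp := by
  have hs0 := hs
  have lift : ∀ {o : Outcome Obj K V m},
      (({ c.loc t with pc := o.1 }, o.2) : Local Obj K V (Bucket Obj m) × _) =
        (l', s', act, lp) →
      StepOK hash c g t { c.loc t with pc := o.1 } o.2.1 o.2.2.2 → StepOK hash c g t l' s' lp := by
    rintro ⟨pc, s, act, lp⟩ e h
    cases e
    exact h
  have lift' : ∀ {pc : PC Obj K V (Bucket Obj m)} {s : Shared K V (Bucket Obj m)}
      {act' : Act Obj K V (Bucket Obj m)} {lp' : Bool},
      some (({ c.loc t with pc := pc }, s, act', lp') : Local Obj K V (Bucket Obj m) × _) =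
        some (l', s', act, lp) →
      StepOK hash c g t { c.loc t with pc := pc } s lp' → StepOK hash c g t l' s' lp := by
    intro pc s act' lp' e h
    cases e
    exact h
  cases hp : (c.loc t).pc <;> rw [step, hp] at hs <;> simp only [reduceCtorEq] at hs
  case invoked => exact stepOK_invoked h hp hs0
  case respond r => exact stepOK_respond h hp hs0
  case search | blueWalk | redStart | redWalk =>
    obtain ⟨o, ho, hl⟩ := Option.map_eq_some_iff.1 hs
    exact lift hl (stepOK_search h hp ho)
  case acquire cl loc todo =>
    cases todo with
    | nil => exact lift' hs (stepOK_acquired h hp)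
    | cons a todo =>
      obtain ⟨s1, hs1, hl⟩ := Option.map_eq_some_iff.1 hs
      cases hl; exact stepOK_acquire h hp hs1
  case validate cl loc todo =>
    cases todo with
    | nil => exact lift' hs (stepOK_located h hp)
    | cons ch todo => exact lift' hs (stepOK_check h hp rfl)
  case release lp' todo k =>
    cases todo with
    | nil => exact lift' hs (stepOK_released h hp)
    | cons a todo => exact lift' hs (stepOK_release h hp)
  case rvStamp loc a blue => exact lift' hs (stepOK_rvStamp h hp)
  case rvValue loc => exact lift' hs (stepOK_rvValue h hp)
  case rvNew loc =>
    split at hs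
    · next o k ho => exact lift' hs (stepOK_rvNew h hp (Or.inl ho))
    · next o k ho => exact lift' hs (stepOK_rvNew h hp (Or.inr ho))
    · cases hs
  case rvLink loc a => exact lift' hs (stepOK_rvLink h hp)
  case rvLog v =>
    split at hs
    · cases hs; exact stepOK_rvLog h hp _
    · cases hs; exact stepOK_rvLog h hp _
    · cases hs
  case commit done cur rest ph =>
    obtain ⟨o, ho, hl⟩ := Option.map_eq_some_iff.1 hs
    exact lift hl (stepOK_commitStep h hp ho)

/-- The initial auxiliary state. -/
def Ghost.init (Obj K V : Type*) (m : ℕ) : Ghost Obj K V m where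
  bkt
    | .head b => some b
    | .tail b => some b
    | .node _ => none
  blue := {x | ∀ n, x ≠ .node n}
  abs _ _ := none

theorem Inv.init (hash : Obj → K → Fin m) :
    Inv hash (Config.init Obj K V m) (Ghost.init Obj K V m) := by
  constructor
  · constructor
    · intro b n
      simp
    · intro b; rfl
    · intro b; rfl
    · intro x hx
      cases x with
      | node n => exact absurd rfl (hx n)
      | _ => trivial
    · intro x hx y hy hxy hk
      cases x <;> cases y <;>
        simp_all [Ghost.init, Config.init, Shared.init]
    · intro x hx y hy
      cases x with
      | head b =>
        cases hy
        refine ⟨by simp [Ghost.init], rfl, WithBot.bot_lt_coe _, fun z hz hzb hzk => ?_⟩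
        cases z with
        | head b => exact absurd hzk (lt_irrefl _)
        | tail b => exact le_rfl
        | node n => exact absurd rfl (hz n)
      | tail b => cases hy
      | node n => exact absurd rfl (hx n)
    · intro x hx hk
      cases x with
      | head b => exact ⟨_, rfl⟩
      | tail b => exact absurd rfl hk
      | node n => exact absurd rfl (hx n)
    · intro x hx y hy
      cases x <;> cases hy
      exact ⟨trivial, rfl⟩
    · intro x hx y hy
      cases x <;> cases hy
      exact ⟨trivial, rfl⟩
  · intro t a; rfl
  · intro t a ha; cases ha
  · intro t; trivial
  · intro t; exact List.Pairwise.nil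
  · intro o k
    refine ⟨?_, fun _ => Or.inr ⟨fun z hz hzb => ?_, rfl⟩⟩
    · rintro e ⟨t, ht⟩
      cases ht
    · cases z with
      | head b => exact (XKey.bot_lt_of k).ne
      | tail b => exact (XKey.of_ne_top k).symm
      | node n => exact absurd rfl (hz n)
  · intro x hx _
    cases x with
    | node n => exact absurd hx (Nat.not_lt_zero _)
    | head b => simp [Ghost.init, Config.init, Shared.init]
    | tail b => simp [Ghost.init, Config.init, Shared.init]

end Step


section Classify

variable {Obj K V : Type*} [DecidableEq Obj] [LinearOrder K] {m : ℕ}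
variable {hash : Obj → K → Fin m} {s s' : Shared K V (Bucket Obj m)} {t : Tx}
  {l l' : Local Obj K V (Bucket Obj m)} {act : Act Obj K V (Bucket Obj m)} {lp : Bool}

/-! ### The steps inside a method -/

/-- The transaction is inside a method. -/
def Active : PC Obj K V (Bucket Obj m) → Prop
  | .unborn | .ready | .finished => False
  | _ => True

/-- The event is neither an invocation nor a response. -/
def Act.Internal : Act Obj K V (Bucket Obj m) → Prop
  | .inv _ | .rsp _ _ => False
  | _ => True

/-- A release that still has to contain the linearization point is not finished. -/
def Unreleased : PC Obj K V (Bucket Obj m) → Prop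
  | .release true todo _ => todo ≠ []
  | _ => True

/-- The program point lies inside a method, before its linearization point. -/
def Before (pc : PC Obj K V (Bucket Obj m)) : Prop :=
  post pc = none ∧ Active pc ∧ Unreleased pc

/-- A step inside a method that is not its linearization point, the linearization point, or
the response. -/
inductive StepKind (l : Local Obj K V (Bucket Obj m)) : Local Obj K V (Bucket Obj m) →
    Act Obj K V (Bucket Obj m) → Bool → Prop
  | internal (l' : Local Obj K V (Bucket Obj m)) (act : Act Obj K V (Bucket Obj m))
      (ha : act.Internal) (hi : l'.idx = l.idx) (ho : l'.op = l.op) (hpost : post l'.pc = post l.pc)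
      (hact : Active l'.pc) (hv : vlog l' = vlog l) : StepKind l l' act false
  | lin (l' : Local Obj K V (Bucket Obj m)) (act : Act Obj K V (Bucket Obj m))
      (ha : act.Internal) (hi : l'.idx = l.idx) (ho : l'.op = l.op) (hpost : post l.pc = none) :
      StepKind l l' act true
  | respond (r : Resp V) (pc' : PC Obj K V (Bucket Obj m)) (hr : l.pc = .respond r)
      (hpc : pc' = .finished ∨ pc' = .ready ∧ r ≠ .abort ∧ l.op ≠ .tryC) :
      StepKind l { l with pc := pc', idx := l.idx + 1 } (.rsp l.op r) false

theorem vlog_of_post_none (h : post l.pc = none) : vlog l = l.log := by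
  obtain ⟨pc, idx, op, ts, log⟩ := l
  cases pc <;> try rfl
  case release lp todo k => cases lp <;> cases k <;> first | rfl | simp [post] at h
  case rvLog => simp [post] at h

theorem before_advance (done rest : List (Located Obj K V (Bucket Obj m)))
    (p : Located Obj K V (Bucket Obj m)) : Before (advance (done ++ [p]) rest) := by
  cases rest with
  | nil => exact ⟨rfl, trivial, by simp [advance, Unreleased, orderedLocks]⟩
  | cons q rest => exact ⟨rfl, trivial, trivial⟩

theorem before_located (loc : Loc (Bucket Obj m)) (cl : Caller Obj K V (Bucket Obj m)) :
    Before (located s loc cl) := by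
  cases cl with
  | rv o k =>
    simp only [located]
    split_ifs <;> exact ⟨rfl, trivial, trivial⟩
  | tryC done e rest =>
    cases rest with
    | cons e' rest => exact ⟨rfl, trivial, trivial⟩
    | nil =>
      simp only [located]
      cases done <;> exact ⟨rfl, trivial, trivial⟩

theorem before_searchStep {pc : PC Obj K V (Bucket Obj m)} {o : Outcome Obj K V m}
    (h : searchStep hash s pc = some o) :
    Before o.1 ∧ o.2.2.1.Internal ∧ o.2.2.2 = false := by
  cases pc <;> simp only [searchStep, reduceCtorEq] at h <;> split at h <;>
    (try split at h) <;> cases h <;> exact ⟨⟨rfl, trivial, trivial⟩, trivial, rfl⟩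

theorem before_checkStep (ts : ℕ) (cl : Caller Obj K V (Bucket Obj m))
    (loc : Loc (Bucket Obj m)) (ch : Check) (todo : List Check) :
    Before (checkStep s ts cl loc ch todo).1 ∧ (checkStep s ts cl loc ch todo).2.2.1.Internal ∧
      (checkStep s ts cl loc ch todo).2.2.2 = false := by
  cases ch <;> refine ⟨?_, trivial, rfl⟩ <;> simp only [checkStep] <;> split_ifs <;>
    exact ⟨rfl, trivial, by simp [Unreleased, Loc.nodes]⟩

theorem before_commitStep {ts : ℕ} {done rest : List (Located Obj K V (Bucket Obj m))}
    {cur : Located Obj K V (Bucket Obj m)} {ph : Phase (Bucket Obj m)} {o : Outcome Obj K V m}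
    (h : commitStep hash t ts s done cur rest ph = some o) :
    Before o.1 ∧ o.2.2.1.Internal ∧ o.2.2.2 = false := by
  have hb : ∀ (cur' : Located Obj K V (Bucket Obj m)) (ph' : Phase (Bucket Obj m)),
    Before (PC.commit done cur' rest ph') := fun _ _ => ⟨rfl, trivial, trivial⟩
  have ha := before_advance done rest
  cases ph <;> simp only [commitStep, Option.some.injEq, Option.map_eq_some_iff] at h
  case bpLoad =>
    split at h
    · cases h
    · split_ifs at h
      · split at h <;> cases h
        exact ⟨hb _ _, trivial, rfl⟩
      · cases h
        exact ⟨hb _ _, trivial, rfl⟩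
  case rpLoad =>
    split at h
    · cases h
    · split at h <;> cases h
      exact ⟨hb _ _, trivial, rfl⟩
  case bpLock | rpLock | newNode =>
    obtain ⟨s', -, rfl⟩ := h
    exact ⟨hb _ _, trivial, rfl⟩
  case apply =>
    subst h
    refine ⟨?_, trivial, rfl⟩
    dsimp only
    split_ifs
    all_goals first | exact hb _ _ | exact ha _
  all_goals
    subst h
    exact ⟨by first | exact hb _ _ | exact ha _, trivial, rfl⟩

theorem active_of_post {pc : PC Obj K V (Bucket Obj m)} {r : Resp V} (h : post pc = some r) :
    Active pc := by
  cases pc <;> trivial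

theorem active_of_step (h : step hash t l s = some (l', s', act, lp)) : Active l.pc := by
  cases hp : l.pc <;> first | trivial | (rw [step, hp] at h; cases h)

theorem step_kind (hu : Unreleased l.pc) (h : step hash t l s = some (l', s', act, lp)) :
    StepKind l l' act lp ∧ Unreleased l'.pc := by
  have key : ∀ {o : Outcome Obj K V m}, post l.pc = none →
      (Before o.1 ∧ o.2.2.1.Internal ∧ o.2.2.2 = false) →
      (({ l with pc := o.1 }, o.2) : Local Obj K V (Bucket Obj m) × _) = (l', s', act, lp) →
      StepKind l l' act lp ∧ Unreleased l'.pc := by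
    rintro ⟨pc, s, act, lp⟩ hpost ⟨h1, h2, h3⟩ e
    cases e
    cases h3
    refine ⟨.internal _ _ h2 rfl rfl (h1.1.trans hpost.symm) h1.2.1 ?_, h1.2.2⟩
    rw [vlog_of_post_none hpost, vlog_of_post_none h1.1]
  obtain ⟨pc, idx, op, ts, log⟩ := l
  cases pc <;> simp only [step, reduceCtorEq, Option.map_eq_some_iff] at h
  case invoked =>
    cases op <;> simp only at h
    case stmBegin => cases h; exact ⟨.lin _ _ trivial rfl rfl rfl, trivial⟩
    case insert => cases h; exact ⟨.lin _ _ trivial rfl rfl rfl, trivial⟩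
    all_goals
      split at h
      all_goals
        cases h
        first
        | exact ⟨.lin _ _ trivial rfl rfl rfl, trivial⟩
        | exact ⟨.internal _ _ trivial rfl rfl rfl trivial rfl, trivial⟩
  case respond r =>
    cases h
    refine ⟨.respond r _ rfl ?_, ?_⟩
    · cases r <;> cases op <;> simp
    · cases r <;> cases op <;> trivial
  case search | blueWalk | redStart | redWalk =>
    obtain ⟨o, ho, hl⟩ := h
    exact key rfl (before_searchStep ho) hl
  case acquire cl loc todo =>
    cases todo with
    | nil => cases h; exact ⟨.internal _ _ trivial rfl rfl rfl trivial rfl, trivial⟩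
    | cons a todo =>
      obtain ⟨s1, -, hl⟩ := Option.map_eq_some_iff.1 h
      cases hl
      exact ⟨.internal _ _ trivial rfl rfl rfl trivial rfl, trivial⟩
  case validate cl loc todo =>
    cases todo with
    | nil =>
      exact key (o := (located s loc cl, s, .read loc.bc, false)) rfl
        ⟨before_located loc cl, trivial, rfl⟩ (Option.some_injective _ h)
    | cons ch todo =>
      exact key (o := checkStep s ts cl loc ch todo) rfl (before_checkStep ts cl loc ch todo)
        (Option.some_injective _ h)
  case release lp' todo k =>
    cases todo with
    | nil =>
      cases lp' with
      | true => exact absurd rfl hu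
      | false =>
        cases h
        cases k <;> exact ⟨.internal _ _ trivial rfl rfl rfl trivial rfl, trivial⟩
    | cons a todo =>
      cases lp' with
      | true => cases h; exact ⟨.lin _ _ trivial rfl rfl rfl, trivial⟩
      | false => cases h; cases k <;> exact ⟨.internal _ _ trivial rfl rfl rfl trivial rfl, trivial⟩
  case rvStamp loc a blue =>
    cases h
    cases blue <;> exact ⟨.internal _ _ trivial rfl rfl rfl trivial rfl, by simp [Unreleased, Loc.nodes]⟩
  case rvValue loc =>
    cases h
    exact ⟨.internal _ _ trivial rfl rfl rfl trivial rfl, by simp [Unreleased, Loc.nodes]⟩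
  case rvNew loc =>
    cases op <;> simp only [reduceCtorEq] at h <;> cases h <;>
      exact ⟨.internal _ _ trivial rfl rfl rfl trivial rfl, trivial⟩
  case rvLink loc a =>
    cases h
    exact ⟨.internal _ _ trivial rfl rfl rfl trivial rfl, trivial⟩
  case rvLog v =>
    cases op <;> simp only [reduceCtorEq] at h <;> cases h <;>
      exact ⟨.internal _ _ trivial rfl rfl rfl trivial rfl, trivial⟩
  case commit done cur rest ph =>
    obtain ⟨o, ho, hl⟩ := h
    exact key rfl (before_commitStep ho) hl

end Classify


section Legality

variable {Obj K V : Type*}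
variable {S : List (Method Obj K V)} {M : Method Obj K V} {x : Tx} {o : Obj} {k : K} {i j : ℕ}

/-! ### Appending a method to a sequential history -/

theorem getElem?_snoc_of_lt {α : Type*} {S : List α} {a b : α} (h : i < S.length) :
    (S ++ [a])[i]? = some b ↔ S[i]? = some b := by
  rw [List.getElem?_append_left h]

theorem lt_of_getElem? {α : Type*} {S : List α} {b : α} (h : S[i]? = some b) : i < S.length :=
  (List.getElem?_eq_some_iff.1 h).1

theorem getElem?_snoc {α : Type*} {S : List α} {a b : α} :
    (S ++ [a])[i]? = some b ↔ S[i]? = some b ∨ i = S.length ∧ a = b := by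
  rcases lt_trichotomy i S.length with h | rfl | h
  · rw [getElem?_snoc_of_lt h]
    exact ⟨Or.inl, fun h' => h'.resolve_right fun e => h.ne e.1⟩
  · simp
  · constructor
    · intro h'
      have := lt_of_getElem? h'
      simp at this
      omega
    · rintro (h' | h')
      · exact absurd (lt_of_getElem? h') (by omega)
      · omega

theorem Method.IsUpdate.on (h : M.IsUpdate o k) : M.On o k :=
  h.elim Or.inl fun h => Or.inr (Or.inl h)

theorem updates_snoc : Updates (S ++ [M]) x o k ↔ Updates S x o k ∨ M.tx = x ∧ M.IsUpdate o k := by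
  simp only [Updates, List.mem_append, List.mem_singleton]
  constructor
  · rintro ⟨U, hU | rfl, h⟩
    exacts [Or.inl ⟨U, hU, h⟩, Or.inr h]
  · rintro (⟨U, hU, h⟩ | h)
    exacts [⟨U, Or.inl hU, h⟩, ⟨M, Or.inr rfl, h⟩]

theorem commitsAt_snoc : CommitsAt (S ++ [M]) x i ↔
    CommitsAt S x i ∨ i = S.length ∧ M.tx = x ∧ M.op = .tryC ∧ M.resp = .ok := by
  simp only [CommitsAt, getElem?_snoc]
  constructor
  · rintro ⟨C, hC | ⟨h, rfl⟩, h'⟩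
    exacts [Or.inl ⟨C, hC, h'⟩, Or.inr ⟨h, h'⟩]
  · rintro (⟨C, hC, h⟩ | ⟨h, h'⟩)
    exacts [⟨C, Or.inl hC, h⟩, ⟨M, Or.inr ⟨h, rfl⟩, h'⟩]

theorem CommitsAt.lt (h : CommitsAt S x i) : i < S.length :=
  lt_of_getElem? h.choose_spec.1

theorem LastUpdate.snoc {U : Method Obj K V} (h : LastUpdate S x o k U)
    (hM : ¬ (M.tx = x ∧ M.IsUpdate o k)) : LastUpdate (S ++ [M]) x o k U := by
  obtain ⟨j, h1, h2, h3, h4⟩ := h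
  refine ⟨j, getElem?_snoc.2 (Or.inl h1), h2, h3, fun j' Q hj hQ => ?_⟩
  rcases getElem?_snoc.1 hQ with hQ | ⟨-, rfl⟩
  exacts [h4 j' Q hj hQ, hM]

theorem lastUpdate_snoc_self (h1 : M.tx = x) (h2 : M.IsUpdate o k) :
    LastUpdate (S ++ [M]) x o k M := by
  refine ⟨S.length, by simp, h1, h2, fun j' Q hj hQ => ?_⟩
  have := lt_of_getElem? hQ
  simp at this
  omega

theorem prevOnKey_snoc {P : Method Obj K V} (hi : i ≤ S.length) :
    PrevOnKey (S ++ [M]) x o k i j P ↔ PrevOnKey S x o k i j P := by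
  unfold PrevOnKey
  refine and_congr_right fun hj => and_congr (getElem?_snoc_of_lt (by omega)) <|
    and_congr_right fun _ => and_congr_right fun _ => forall_congr' fun j' => forall_congr' fun Q =>
      forall_congr' fun _ => forall_congr' fun hj' => ?_
  rw [getElem?_snoc_of_lt (by omega)]

theorem PrevOnKey.snoc {P : Method Obj K V} (h : PrevOnKey S x o k S.length j P)
    (hM : ¬ (M.tx = x ∧ M.On o k)) : PrevOnKey (S ++ [M]) x o k (S ++ [M]).length j P := by
  obtain ⟨h0, h1, h2, h3, h4⟩ := h
  refine ⟨by simp; omega, getElem?_snoc.2 (Or.inl h1), h2, h3, fun j' Q hj hj' hQ => ?_⟩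
  rcases getElem?_snoc.1 hQ with hQ | ⟨-, rfl⟩
  exacts [h4 j' Q hj (lt_of_getElem? hQ) hQ, hM]

theorem prevOnKey_snoc_self (h1 : M.tx = x) (h2 : M.On o k) :
    PrevOnKey (S ++ [M]) x o k (S ++ [M]).length S.length M :=
  ⟨by simp, by simp, h1, h2, fun j' Q hj hj' => by simp at hj'; omega⟩

theorem PrevOnKey.unique {P P' : Method Obj K V} {j' : ℕ} (h : PrevOnKey S x o k i j P)
    (h' : PrevOnKey S x o k i j' P') : P = P' := by
  obtain ⟨a0, a1, a2, a3, a4⟩ := h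
  obtain ⟨b0, b1, b2, b3, b4⟩ := h'
  rcases lt_trichotomy j j' with e | rfl | e
  · exact absurd ⟨b2, b3⟩ (a4 j' P' e b0 b1)
  · exact Option.some_injective _ (a1.symm.trans b1)
  · exact absurd ⟨a2, a3⟩ (b4 j P e a0 a1)

/-! ### The committed contents -/

/-- The last transaction that updates `⟨o, k⟩` and commits before position `i` has a last update
method with the property `p`. -/
def LastCommit (S : List (Method Obj K V)) (o : Obj) (k : K) (p : Op Obj K V → Prop) (i : ℕ) :
    Prop :=
  ∃ x c U, LastUpdate S x o k U ∧ p U.op ∧ CommitsAt S x c ∧ c < i ∧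
    ¬ ∃ y d, Updates S y o k ∧ CommitsAt S y d ∧ c < d ∧ d < i

/-- The transaction `x` has not committed in `S`. -/
def Uncommitted (S : List (Method Obj K V)) (x : Tx) : Prop :=
  ∀ c, ¬ CommitsAt S x c

theorem Method.not_isUpdate_of_tryC (h : M.op = .tryC) : ¬ M.IsUpdate o k := by
  rintro (⟨v, h'⟩ | h') <;> simp [h] at h'

theorem noCommit_snoc {p p' : ℕ → Prop} (hun : Uncommitted S M.tx)
    (h : ¬ ∃ y d, Updates S y o k ∧ CommitsAt S y d ∧ p d) (hp : ∀ d < S.length, p' d → p d)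
    (hM : p' S.length → M.op = .tryC → M.resp = .ok → ¬ Updates S M.tx o k) :
    ¬ ∃ y d, Updates (S ++ [M]) y o k ∧ CommitsAt (S ++ [M]) y d ∧ p' d := by
  rintro ⟨y, d, h1, h2, h3⟩
  rw [updates_snoc] at h1
  rw [commitsAt_snoc] at h2
  rcases h2 with h2 | ⟨rfl, rfl, h2, h2'⟩
  · rcases h1 with h1 | ⟨rfl, -⟩
    · exact h ⟨y, d, h1, h2, hp d h2.lt h3⟩
    · exact hun d h2
  · rcases h1 with h1 | ⟨-, h1⟩
    · exact hM h3 h2 h2' h1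
    · exact Method.not_isUpdate_of_tryC h2 h1

theorem LastCommit.snoc {p : Op Obj K V → Prop} {i' : ℕ} (hun : Uncommitted S M.tx)
    (h : LastCommit S o k p i) (hi : i ≤ i') (hp : ∀ d < S.length, d < i' → d < i)
    (hM : S.length < i' → M.op = .tryC → M.resp = .ok → ¬ Updates S M.tx o k) :
    LastCommit (S ++ [M]) o k p i' := by
  obtain ⟨x, c, U, h1, h2, h3, h4, h5⟩ := h
  refine ⟨x, c, U, h1.snoc fun e => hun c (e.1 ▸ h3), h2, commitsAt_snoc.2 (Or.inl h3),
    h4.trans_le hi, ?_⟩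
  exact noCommit_snoc (p := fun d => c < d ∧ d < i) (p' := fun d => c < d ∧ d < i') hun h5
    (fun d hd h => ⟨h.1, hp d hd h.2⟩) fun h => hM h.2

theorem lastCommit_snoc_self {p : Op Obj K V → Prop} {U : Method Obj K V}
    (hU : LastUpdate S M.tx o k U) (hp : p U.op) (h1 : M.op = .tryC) (h2 : M.resp = .ok) :
    LastCommit (S ++ [M]) o k p (S ++ [M]).length := by
  refine ⟨M.tx, S.length, U, hU.snoc fun e => Method.not_isUpdate_of_tryC h1 e.2, hp,
    commitsAt_snoc.2 (Or.inr ⟨rfl, rfl, h1, h2⟩), by simp, ?_⟩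
  rintro ⟨y, d, -, -, h3, h4⟩
  simp at h4
  omega

/-- `v` is the value of `⟨o, k⟩` according to the commits before position `i`. -/
def Committed (S : List (Method Obj K V)) (o : Obj) (k : K) (v : Option V) (i : ℕ) : Prop :=
  match v with
  | some w => LR2 S o k w i
  | none => LR3 S o k i

theorem Committed.snoc {v : Option V} {i' : ℕ} (hun : Uncommitted S M.tx)
    (h : Committed S o k v i) (hi : i ≤ i') (hp : ∀ d < S.length, d < i' → d < i)
    (hM : S.length < i' → M.op = .tryC → M.resp = .ok → ¬ Updates S M.tx o k) :
    Committed (S ++ [M]) o k v i' := by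
  cases v with
  | some w => exact LastCommit.snoc (p := (· = .insert o k w)) hun h hi hp hM
  | none =>
    rcases h with h | h
    · exact Or.inl (LastCommit.snoc (p := (· = .delete o k)) hun h hi hp hM)
    · exact Or.inr (noCommit_snoc hun h hp hM)

/-! ### Logs and sequential histories -/

/-- The log entry for `⟨o, k⟩` of the transaction `x` agrees with its methods in `S`. -/
def EntryMatch (S : List (Method Obj K V)) (x : Tx) (o : Obj) (k : K) :
    Option (Entry Obj K V) → Prop
  | none => ∀ M ∈ S, M.tx = x → ¬ M.On o k
  | some e => (∃ j P, PrevOnKey S x o k S.length j P ∧ LR1 P e.seen) ∧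
    match e.opn with
    | .insert => ∃ U w, LastUpdate S x o k U ∧ U.op = .insert o k w ∧ e.value = some w
    | .delete => ∃ U, LastUpdate S x o k U ∧ U.op = .delete o k
    | .lookup => ¬ Updates S x o k

theorem EntryMatch.not_updates (h : EntryMatch S x o k none) : ¬ Updates S x o k :=
  fun ⟨U, hU, hx, hu⟩ => h U hU hx hu.on

theorem EntryMatch.snoc {e : Option (Entry Obj K V)} (h : EntryMatch S x o k e)
    (hM : ¬ (M.tx = x ∧ M.On o k)) : EntryMatch (S ++ [M]) x o k e := by
  have hM' : ¬ (M.tx = x ∧ M.IsUpdate o k) := fun h => hM ⟨h.1, h.2.on⟩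
  cases e with
  | none =>
    intro P hP hx hon
    rcases List.mem_append.1 hP with hP | hP
    · exact h P hP hx hon
    · cases List.mem_singleton.1 hP
      exact hM ⟨hx, hon⟩
  | some e =>
    obtain ⟨⟨j, P, h1, h2⟩, h3⟩ := h
    refine ⟨⟨j, P, h1.snoc hM, h2⟩, ?_⟩
    cases ho : e.opn <;> simp only [ho] at h3 ⊢
    · obtain ⟨U, w, h4, h5⟩ := h3
      exact ⟨U, w, h4.snoc hM', h5⟩
    · obtain ⟨U, h4, h5⟩ := h3
      exact ⟨U, h4.snoc hM', h5⟩
    · rw [updates_snoc]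
      exact fun h => h.elim h3 hM'

theorem EntryMatch.insert {v : V} (hx : M.tx = x) (ho : M.op = .insert o k v) :
    EntryMatch (S ++ [M]) x o k (some ⟨o, k, .insert, some v⟩) := by
  have hu : M.IsUpdate o k := Or.inl ⟨v, ho⟩
  refine ⟨⟨_, M, prevOnKey_snoc_self hx hu.on, ?_⟩, M, v, lastUpdate_snoc_self hx hu, ho, rfl⟩
  refine ⟨fun o' k' v' h => ?_, fun o' k' v' h => ?_, fun o' k' h => ?_⟩ <;> rw [ho] at h <;>
    cases h
  rfl

theorem EntryMatch.delete (hx : M.tx = x) (ho : M.op = .delete o k) :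
    EntryMatch (S ++ [M]) x o k (some ⟨o, k, .delete, none⟩) := by
  have hu : M.IsUpdate o k := Or.inr ho
  refine ⟨⟨_, M, prevOnKey_snoc_self hx hu.on, ?_⟩, M, lastUpdate_snoc_self hx hu, ho⟩
  refine ⟨fun o' k' v' h => ?_, fun o' k' v' h => ?_, fun o' k' h => ?_⟩ <;> rw [ho] at h <;>
    cases h
  rfl

theorem LR1.of_lookup {v : Option V} (ho : M.op = .lookup o k) (hr : M.resp = .val v) :
    LR1 M v := by
  refine ⟨fun o' k' v' h => ?_, fun o' k' v' h h' => ?_, fun o' k' h => ?_⟩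
  · rw [ho] at h; cases h
  · rw [hr] at h'; cases h'; rfl
  · rw [ho] at h; cases h

theorem EntryMatch.lookup {v : Option V} (hx : M.tx = x) (ho : M.op = .lookup o k)
    (hr : M.resp = .val v) (h : EntryMatch S x o k none) :
    EntryMatch (S ++ [M]) x o k (some ⟨o, k, .lookup, v⟩) := by
  refine ⟨⟨_, M, prevOnKey_snoc_self hx (Or.inr (Or.inr ho)), .of_lookup ho hr⟩, ?_⟩
  simp only [updates_snoc]
  rintro (h' | ⟨-, ⟨v, h'⟩ | h'⟩)
  · exact h.not_updates h'
  · rw [ho] at h'; cases h'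
  · rw [ho] at h'; cases h'

theorem EntryMatch.lookup_again {e : Entry Obj K V} (hx : M.tx = x) (ho : M.op = .lookup o k)
    (hr : M.resp = .val e.seen) (h : EntryMatch S x o k (some e)) :
    EntryMatch (S ++ [M]) x o k (some e) := by
  have hM' : ¬ (M.tx = x ∧ M.IsUpdate o k) := by
    rintro ⟨-, ⟨v, h'⟩ | h'⟩ <;> rw [ho] at h' <;> cases h'
  refine ⟨⟨_, M, prevOnKey_snoc_self hx (Or.inr (Or.inr ho)), .of_lookup ho hr⟩, ?_⟩
  have h3 := h.2
  cases ho : e.opn <;> simp only [ho] at h3 ⊢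
  · obtain ⟨U, w, h4, h5⟩ := h3
    exact ⟨U, w, h4.snoc hM', h5⟩
  · obtain ⟨U, h4, h5⟩ := h3
    exact ⟨U, h4.snoc hM', h5⟩
  · rw [updates_snoc]
    exact fun h => h.elim h3 hM'

section Log

variable [DecidableEq Obj] [LinearOrder K]

theorem findInLL_cons (a : Entry Obj K V) (log : List (Entry Obj K V)) (o : Obj) (k : K) :
    findInLL (a :: log) o k = if a.obj = o ∧ a.key = k then some a else findInLL log o k := by
  unfold findInLL
  rw [List.find?_cons]
  by_cases h : a.obj = o ∧ a.key = k <;> simp [h]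

theorem findInLL_setLL (log : List (Entry Obj K V)) (e : Entry Obj K V) (o : Obj) (k : K) :
    findInLL (setLL log e) o k = if e.obj = o ∧ e.key = k then some e else findInLL log o k := by
  have hmap : ∀ log : List (Entry Obj K V), findInLL
      (log.map fun e' => if e'.obj = e.obj ∧ e'.key = e.key then e else e') o k =
      if e.obj = o ∧ e.key = k ∧ (findInLL log o k).isSome then some e else findInLL log o k := by
    intro log
    induction log with
    | nil => simp [findInLL]
    | cons a log ih =>
      rw [List.map_cons, findInLL_cons, findInLL_cons, ih]
      by_cases h2 : e.obj = o ∧ e.key = k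
      · obtain ⟨rfl, rfl⟩ := h2
        by_cases h1 : a.obj = e.obj ∧ a.key = e.key <;> simp [h1]
      · by_cases h1 : a.obj = e.obj ∧ a.key = e.key
        · have h3 : ¬ (a.obj = o ∧ a.key = k) := by rwa [h1.1, h1.2]
          rw [if_pos h1, if_neg h2, if_neg h3]
        · have h2' : ∀ p : Prop, ¬ (e.obj = o ∧ e.key = k ∧ p) := fun p h => h2 ⟨h.1, h.2.1⟩
          simp only [if_neg h1, h2', if_false]
  unfold setLL
  split_ifs with h1 h2 h2
  · rw [hmap, if_pos ⟨h2.1, h2.2, by rwa [← h2.1, ← h2.2]⟩]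
  · rw [hmap, if_neg fun h => h2 ⟨h.1, h.2.1⟩]
  · rw [Option.not_isSome_iff_eq_none, h2.1, h2.2] at h1
    unfold findInLL at h1 ⊢
    rw [List.find?_append, h1]
    simp [h2.1, h2.2]
  · unfold findInLL
    rw [List.find?_append, List.find?_singleton, if_neg (by simpa using h2), Option.or_none]

/-- The log of the transaction `x` agrees with its methods in `S`. -/
def LogMatch (S : List (Method Obj K V)) (x : Tx) (log : List (Entry Obj K V)) : Prop :=
  ∀ o k, EntryMatch S x o k (findInLL log o k)

theorem LogMatch.snoc {log : List (Entry Obj K V)} (h : LogMatch S x log)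
    (hM : ∀ o k, ¬ (M.tx = x ∧ M.On o k)) : LogMatch (S ++ [M]) x log :=
  fun o k => (h o k).snoc (hM o k)

theorem Method.On.unique {o' : Obj} {k' : K} (h : M.On o k) (h' : M.On o' k') :
    o = o' ∧ k = k' := by
  rcases h with ⟨v, h⟩ | h | h <;> rcases h' with ⟨v', h'⟩ | h' | h' <;> rw [h] at h' <;>
    cases h' <;> exact ⟨rfl, rfl⟩

theorem LogMatch.set {log : List (Entry Obj K V)} {e : Entry Obj K V} (h : LogMatch S x log)
    (hM : M.On e.obj e.key) (he : EntryMatch (S ++ [M]) x e.obj e.key (some e)) :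
    LogMatch (S ++ [M]) x (setLL log e) := by
  intro o k
  rw [findInLL_setLL]
  split_ifs with h1
  · rw [← h1.1, ← h1.2]; exact he
  · exact (h o k).snoc fun h' => h1 (hM.unique h'.2)

/-- The committed contents agree with the commits in `S`. -/
def AbsMatch (S : List (Method Obj K V)) (abs : Obj → K → Option V) : Prop :=
  ∀ o k, Committed S o k (abs o k) S.length

theorem AbsMatch.snoc {abs : Obj → K → Option V} (h : AbsMatch S abs) (hun : Uncommitted S M.tx)
    (hM : M.op = .tryC → M.resp ≠ .ok) : AbsMatch (S ++ [M]) abs := fun o k =>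
  (h o k).snoc hun (by simp) (fun d hd _ => hd) fun _ h1 h2 => absurd h2 (hM h1)

theorem AbsMatch.commit {abs : Obj → K → Option V} {log : List (Entry Obj K V)}
    (h : AbsMatch S abs) (hun : Uncommitted S M.tx) (hl : LogMatch S M.tx log)
    (h1 : M.op = .tryC) (h2 : M.resp = .ok) : AbsMatch (S ++ [M]) (absCommit log abs) := by
  intro o k
  have hk := hl o k
  have hsame : ¬ Updates S M.tx o k → Committed (S ++ [M]) o k (abs o k) (S ++ [M]).length :=
    fun hn => (h o k).snoc hun (by simp) (fun d hd _ => hd) fun _ _ _ => hn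
  unfold absCommit
  cases hf : findInLL log o k with
  | none =>
    rw [hf] at hk
    exact hsame hk.not_updates
  | some e =>
    rw [hf] at hk
    have h3 := hk.2
    cases ho : e.opn <;> simp only [ho] at h3 <;> simp only [Entry.seen, ho, reduceCtorEq, if_true,
      if_false]
    · obtain ⟨U, w, h4, h5, h6⟩ := h3
      rw [h6]
      exact lastCommit_snoc_self (p := (· = .insert o k w)) h4 h5 h1 h2
    · obtain ⟨U, h4, h5⟩ := h3
      exact Or.inl (lastCommit_snoc_self (p := (· = .delete o k)) h4 h5 h1 h2)
    · exact hsame h3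

theorem Legal.snoc (h : Legal S) (hun : Uncommitted S M.tx)
    (hM : ∀ o k v, (M.op = .lookup o k ∨ M.op = .delete o k) → M.resp = .val v →
      (∀ j P, PrevOnKey S M.tx o k S.length j P → LR1 P v) ∧
      ((¬ ∃ j P, PrevOnKey S M.tx o k S.length j P) → Committed S o k v S.length)) :
    Legal (S ++ [M]) := by
  have key : ∀ i x o k v, i ≤ S.length →
      (∀ j P, PrevOnKey S x o k i j P → LR1 P v) ∧
        ((¬ ∃ j P, PrevOnKey S x o k i j P) → Committed S o k v i) →
      (∀ j P, PrevOnKey (S ++ [M]) x o k i j P → LR1 P v) ∧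
        ((¬ ∃ j P, PrevOnKey (S ++ [M]) x o k i j P) → Committed (S ++ [M]) o k v i) := by
    intro i x o k v hi
    simp only [prevOnKey_snoc hi]
    exact And.imp id fun h hn =>
      (h hn).snoc hun le_rfl (fun _ _ h => h) fun h => absurd h (not_lt.2 hi)
  intro i N o k v hN ho hr
  rcases getElem?_snoc.1 hN with hN | ⟨rfl, rfl⟩
  · exact key i N.tx o k v (lt_of_getElem? hN).le (h i N o k v hN ho hr)
  · exact key _ _ o k v le_rfl (hM o k v ho hr)

theorem LogMatch.legal {log : List (Entry Obj K V)} {e : Entry Obj K V} (h : LogMatch S x log)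
    (he : findInLL log o k = some e) :
    (∀ j P, PrevOnKey S x o k S.length j P → LR1 P e.seen) ∧
      ((¬ ∃ j P, PrevOnKey S x o k S.length j P) → Committed S o k e.seen S.length) := by
  have hk := h o k
  rw [he] at hk
  obtain ⟨⟨j, P, h1, h2⟩, -⟩ := hk
  exact ⟨fun j' P' h' => h1.unique h' ▸ h2, fun hn => absurd ⟨j, P, h1⟩ hn⟩

theorem LogMatch.legal_of_none {log : List (Entry Obj K V)} {abs : Obj → K → Option V}
    (h : LogMatch S x log) (ha : AbsMatch S abs) (he : findInLL log o k = none) :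
    (∀ j P, PrevOnKey S x o k S.length j P → LR1 P (abs o k)) ∧
      ((¬ ∃ j P, PrevOnKey S x o k S.length j P) → Committed S o k (abs o k) S.length) := by
  have hk := h o k
  rw [he] at hk
  refine ⟨fun j P h' => ?_, fun _ => ha o k⟩
  exact absurd h'.2.2.2.1 (hk P (List.mem_of_getElem? h'.2.1) h'.2.2.1)

/-- The linearization point of a method keeps the sequential history legal. -/
theorem LPEffect.legal {log log' : List (Entry Obj K V)} {abs abs' : Obj → K → Option V}
    (h : LPEffect log abs M.op log' abs' M.resp) (hun : Uncommitted S M.tx)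
    (hl : LogMatch S M.tx log) (ha : AbsMatch S abs) (hS : Legal S) :
    (M.resp = .abort ∨ LogMatch (S ++ [M]) M.tx log') ∧ AbsMatch (S ++ [M]) abs' ∧
      Legal (S ++ [M]) := by
  obtain ⟨mid, op, r⟩ := M
  simp only at h
  set M : Method Obj K V := ⟨mid, op, r⟩ with hM
  have hr : M.resp = r := rfl
  have ho : M.op = op := rfl
  cases h with
  | begin n =>
    refine ⟨Or.inr (hl.snoc ?_), ha.snoc hun (by simp [hM]), hS.snoc hun ?_⟩
    · rintro o k ⟨-, ⟨v, h⟩ | h | h⟩ <;> cases h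
    · rintro o k v - h; cases h
  | insert o k v =>
    refine ⟨Or.inr (hl.set (Or.inl ⟨v, rfl⟩) (.insert rfl rfl)), ha.snoc hun (by simp [hM]),
      hS.snoc hun ?_⟩
    rintro o k v - h; cases h
  | lookupLog o k e he =>
    refine ⟨Or.inr fun o' k' => ?_, ha.snoc hun (by simp [hM]), hS.snoc hun ?_⟩
    · by_cases hk : o = o' ∧ k = k'
      · obtain ⟨rfl, rfl⟩ := hk
        have := hl o k
        rw [he] at this ⊢
        exact this.lookup_again rfl rfl rfl
      · exact (hl o' k').snoc fun h => hk (Method.On.unique (Or.inr (Or.inr rfl)) h.2)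
    · rintro o' k' v (h | h) hv <;> cases h
      cases hv
      exact hl.legal he
  | deleteLog o k e he =>
    refine ⟨Or.inr (hl.set (Or.inr (Or.inl rfl)) (.delete rfl rfl)), ha.snoc hun (by simp [hM]),
      hS.snoc hun ?_⟩
    rintro o' k' v (h | h) hv <;> cases h
    cases hv
    exact hl.legal he
  | lookup o k he =>
    have hk := hl o k
    rw [he] at hk
    refine ⟨Or.inr (hl.set (Or.inr (Or.inr rfl)) (.lookup rfl rfl rfl hk)),
      ha.snoc hun (by simp [hM]), hS.snoc hun ?_⟩
    rintro o' k' v (h | h) hv <;> cases h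
    cases hv
    exact hl.legal_of_none ha he
  | delete o k he =>
    refine ⟨Or.inr (hl.set (Or.inr (Or.inl rfl)) (.delete rfl rfl)), ha.snoc hun (by simp [hM]),
      hS.snoc hun ?_⟩
    rintro o' k' v (h | h) hv <;> cases h
    cases hv
    exact hl.legal_of_none ha he
  | commit =>
    refine ⟨Or.inr (hl.snoc ?_), ha.commit hun hl rfl rfl, hS.snoc hun ?_⟩
    · rintro o k ⟨-, ⟨v, h⟩ | h | h⟩ <;> cases h
    · rintro o k v - h; cases h
  | abort =>
    refine ⟨Or.inl rfl, ha.snoc hun (by simp [hM]), hS.snoc hun ?_⟩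
    rintro o k v - h; cases h

end Log

end Legality


section Histories

variable {Obj K V B : Type*} {E : List (Event Obj K V B)} {e : Event Obj K V B}
  {H : List (HEvent Obj K V)} {S : List (Method Obj K V)} {i j : MId}

/-! ### Histories -/

/-- The part of a method-level history that is due to one event. -/
def Event.hist (e : Event Obj K V B) : Option (HEvent Obj K V) :=
  match e.act with
  | .inv op => some (.inv e.mid op)
  | .rsp op r => some (.rsp e.mid op r)
  | _ => none

theorem history_snoc : history (E ++ [e]) = history E ++ e.hist.toList := by
  have : history [e] = e.hist.toList := by
    obtain ⟨mid, act, lp⟩ := e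
    cases act <;> rfl
  rw [← this]
  exact List.filterMap_append

theorem mem_history_inv {op : Op Obj K V} : HEvent.inv i op ∈ history E ↔
    ∃ (q : ℕ) (e : Event Obj K V B), E[q]? = some e ∧ e.mid = i ∧ e.act = .inv op := by
  unfold history
  rw [List.mem_filterMap]
  constructor
  · rintro ⟨e, he, h⟩
    obtain ⟨q, hq⟩ := List.mem_iff_getElem?.1 he
    refine ⟨q, e, hq, ?_⟩
    split at h <;> cases h
    next h => exact ⟨rfl, h⟩
  · rintro ⟨q, e, hq, rfl, h⟩
    exact ⟨e, List.mem_of_getElem? hq, by rw [h]⟩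

theorem mem_history_rsp {q : ℕ} {op : Op Obj K V} {r : Resp V} (hq : E[q]? = some e)
    (h : e.act = .rsp op r) : HEvent.rsp e.mid op r ∈ history E := by
  unfold history
  rw [List.mem_filterMap]
  exact ⟨e, List.mem_of_getElem? hq, by rw [h]⟩

/-- Every linearization point lies between the invocation and the response. -/
def Within (E : List (Event Obj K V B)) : Prop :=
  ∀ (p : ℕ) (e : Event Obj K V B), E[p]? = some e → e.lp = true →
    (∃ (q : ℕ) (e' : Event Obj K V B) (op : Op Obj K V),
      q < p ∧ E[q]? = some e' ∧ e'.mid = e.mid ∧ e'.act = .inv op) ∧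
    ∀ (q : ℕ) (e' : Event Obj K V B) (op : Op Obj K V) (r : Resp V),
      E[q]? = some e' → e'.mid = e.mid → e'.act = .rsp op r → p < q

theorem Within.snoc (h : Within E)
    (he : e.lp = true → (∀ op r, e.act ≠ .rsp op r) ∧ (∃ op, HEvent.inv e.mid op ∈ history E) ∧
      ∀ op r, HEvent.rsp e.mid op r ∉ history E) : Within (E ++ [e]) := by
  intro p e₁ hp hlp
  rcases getElem?_snoc.1 hp with hp | ⟨rfl, rfl⟩
  · obtain ⟨⟨q, e', op, h1, h2, h3⟩, h4⟩ := h p e₁ hp hlp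
    refine ⟨⟨q, e', op, h1, getElem?_snoc.2 (Or.inl h2), h3⟩, fun q e' op r hq h5 h6 => ?_⟩
    rcases getElem?_snoc.1 hq with hq | ⟨rfl, rfl⟩
    · exact h4 q e' op r hq h5 h6
    · exact lt_of_getElem? hp
  · obtain ⟨h1, ⟨op, h2⟩, h3⟩ := he hlp
    obtain ⟨q, e', hq, h4, h5⟩ := mem_history_inv.1 h2
    refine ⟨⟨q, e', op, lt_of_getElem? hq, getElem?_snoc.2 (Or.inl hq), h4, h5⟩,
      fun q e' op r hq h6 h7 => ?_⟩
    rcases getElem?_snoc.1 hq with hq | ⟨rfl, rfl⟩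
    · exact absurd (h6 ▸ mem_history_rsp hq h7) (h3 op r)
    · exact absurd h7 (h1 op r)

theorem realTime_snoc {e : HEvent Obj K V} (h : RealTime (H ++ [e]) i j) :
    RealTime H i j ∨ (∃ op, e = .inv j op) ∧ ∃ op r, HEvent.rsp i op r ∈ H := by
  obtain ⟨p, q, op, op', r, hpq, hp, hq⟩ := h
  have hpl : p < H.length := by
    have := lt_of_getElem? hq
    simp at this
    omega
  rw [getElem?_snoc_of_lt hpl] at hp
  rcases getElem?_snoc.1 hq with hq | ⟨-, rfl⟩
  · exact Or.inl ⟨p, q, op, op', r, hpq, hp, hq⟩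
  · exact Or.inr ⟨⟨op', rfl⟩, op, r, List.mem_of_getElem? hp⟩

theorem seqHistory_inv {a : ℕ} {M : Method Obj K V} (h : S[a]? = some M) :
    (seqHistory S)[2 * a]? = some (.inv M.mid M.op) ∧
      (seqHistory S)[2 * a + 1]? = some (.rsp M.mid M.op M.resp) := by
  induction S generalizing a with
  | nil => simp at h
  | cons N S ih =>
    have hc : seqHistory (N :: S) =
        .inv N.mid N.op :: .rsp N.mid N.op N.resp :: seqHistory S := by simp [seqHistory]
    rw [hc]
    cases a with
    | zero => cases h; exact ⟨rfl, rfl⟩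
    | succ a => exact ih (by simpa using h)

theorem mem_seqHistory {e : HEvent Obj K V} : e ∈ seqHistory S ↔
    ∃ M ∈ S, e = .inv M.mid M.op ∨ e = .rsp M.mid M.op M.resp := by
  simp [seqHistory, List.mem_flatMap]

theorem seqHistory_nodup (h : (S.map fun M => M.mid).Nodup) : (seqHistory S).Nodup := by
  refine List.nodup_flatMap.2 ⟨fun M _ => by simp, ?_⟩
  refine (List.pairwise_map.1 h).imp fun {M N} hne => ?_
  intro e h1 h2
  simp only [List.mem_cons, List.not_mem_nil, or_false] at h1 h2
  rcases h1 with rfl | rfl <;> rcases h2 with h2 | h2 <;> injection h2 <;> contradiction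

theorem eq_of_mid_eq (h : (S.map fun M => M.mid).Nodup) {M N : Method Obj K V} (hM : M ∈ S)
    (hN : N ∈ S) (he : M.mid = N.mid) : M = N :=
  List.inj_on_of_nodup_map h hM hN he

/-- The methods in `S` are the complete methods of a completion of `H`. -/
theorem perm_completion (hH : H.Nodup) (hS : (S.map fun M => M.mid).Nodup)
    (hinj : ∀ i op op', HEvent.inv i op ∈ H → HEvent.inv i op' ∈ H → op = op')
    (hrsp : ∀ i op r, HEvent.rsp i op r ∈ H → (⟨i, op, r⟩ : Method Obj K V) ∈ S)
    (hinv : ∀ M ∈ S, HEvent.inv M.mid M.op ∈ H) :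
    ∃ H', IsCompletion H H' ∧ (seqHistory S).Perm H' := by
  classical
  set R : List (HEvent Obj K V) :=
    (S.filter fun M => decide (HEvent.rsp M.mid M.op M.resp ∉ H)).map
      fun M => .rsp M.mid M.op M.resp with hR
  have memR : ∀ e, e ∈ R ↔ ∃ M ∈ S, HEvent.rsp M.mid M.op M.resp ∉ H ∧
      e = .rsp M.mid M.op M.resp := by
    intro e
    simp only [hR, List.mem_map, List.mem_filter, decide_eq_true_eq]
    exact ⟨fun ⟨M, h, h'⟩ => ⟨M, h.1, h.2, h'.symm⟩, fun ⟨M, h, h', h''⟩ => ⟨M, ⟨h, h'⟩, h''.symm⟩⟩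
  have hRmid : (R.map HEvent.mid).Nodup := by
    rw [hR, List.map_map]
    exact hS.sublist (List.filter_sublist.map _)
  refine ⟨_, ⟨R, fun e he => ?_, hRmid, rfl⟩, ?_⟩
  · obtain ⟨M, hM, hn, rfl⟩ := (memR e).1 he
    refine ⟨M.mid, M.op, M.resp, rfl, hinv M hM, fun op' r' h' => hn ?_⟩
    have := eq_of_mid_eq hS hM (hrsp _ _ _ h') rfl
    rw [this]
    exact h'
  have hrsp' : ∀ i op r, HEvent.rsp i op r ∈ H ++ R ↔ (⟨i, op, r⟩ : Method Obj K V) ∈ S := by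
    intro i op r
    rw [List.mem_append, memR]
    constructor
    · rintro (h | ⟨M, hM, -, h⟩)
      · exact hrsp i op r h
      · cases h; exact hM
    · intro h
      by_cases h' : HEvent.rsp i op r ∈ H
      exacts [Or.inl h', Or.inr ⟨_, h, h', rfl⟩]
  have hinv' : ∀ i op, HEvent.inv i op ∈ H ++ R ↔ HEvent.inv i op ∈ H := by
    intro i op
    rw [List.mem_append, memR]
    refine ⟨fun h => h.resolve_right ?_, Or.inl⟩
    rintro ⟨M, -, -, h⟩
    cases h
  have hnd : (H ++ R).Nodup := by
    refine List.nodup_append'.2 ⟨hH, hRmid.of_map _, fun e h1 h2 => ?_⟩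
    obtain ⟨M, -, hn, rfl⟩ := (memR e).1 h2
    exact hn h1
  refine (List.perm_ext_iff_of_nodup (seqHistory_nodup hS) (hnd.filter _)).2 fun e => ?_
  rw [mem_seqHistory, List.mem_filter, List.any_eq_true]
  simp only [Bool.and_eq_true, decide_eq_true_eq]
  constructor
  · rintro ⟨M, hM, h⟩
    have h1 : HEvent.rsp M.mid M.op M.resp ∈ H ++ R := (hrsp' _ _ _).2 hM
    rcases h with rfl | rfl
    · exact ⟨(hinv' _ _).2 (hinv M hM), _, h1, rfl, rfl⟩
    · exact ⟨h1, _, h1, rfl, rfl⟩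
  · rintro ⟨h1, e', h2, h3, h4⟩
    cases e' with
    | inv i op => cases h3
    | rsp i op r =>
      have hM := (hrsp' _ _ _).1 h2
      cases e with
      | inv i' op' =>
        cases h4
        refine ⟨_, hM, Or.inl ?_⟩
        rw [hinj _ _ _ ((hinv' _ _).1 h1) (hinv _ hM)]
      | rsp i' op' r' => exact ⟨_, (hrsp' _ _ _).1 h1, Or.inr rfl⟩

end Histories

section HistInv

variable {Obj K V : Type*} [DecidableEq Obj] [LinearOrder K] {m : ℕ}

/-- The methods `S` that are past their linearization point agree with the history, with the
local states of the transactions and with the committed contents. -/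
structure HistInv (H : List (HEvent Obj K V)) (loc : Tx → Local Obj K V (Bucket Obj m))
    (abs : Obj → K → Option V) (S : List (Method Obj K V)) : Prop where
  nodup_hist : H.Nodup
  nodup : (S.map fun M => M.mid).Nodup
  inv_of : ∀ t j op, HEvent.inv (t, j) op ∈ H →
    j < (loc t).idx ∨ j = (loc t).idx ∧ Active (loc t).pc ∧ op = (loc t).op
  inv_inj : ∀ i op op', HEvent.inv i op ∈ H → HEvent.inv i op' ∈ H → op = op'
  rsp_of : ∀ t j op r, HEvent.rsp (t, j) op r ∈ H →
    j < (loc t).idx ∧ (⟨(t, j), op, r⟩ : Method Obj K V) ∈ S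
  sound_inv : ∀ M ∈ S, HEvent.inv M.mid M.op ∈ H
  sound : ∀ t j op r, (⟨(t, j), op, r⟩ : Method Obj K V) ∈ S →
    j < (loc t).idx ∨ j = (loc t).idx ∧ post (loc t).pc = some r
  active : ∀ t, Active (loc t).pc → HEvent.inv (t, (loc t).idx) (loc t).op ∈ H
  posted : ∀ t r, post (loc t).pc = some r →
    (⟨(t, (loc t).idx), (loc t).op, r⟩ : Method Obj K V) ∈ S
  finished : ∀ t j r, (⟨(t, j), .tryC, r⟩ : Method Obj K V) ∈ S → j < (loc t).idx →
    (loc t).pc = .finished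
  realTime : ∀ i j, RealTime H i j → ∀ (b : ℕ) (N : Method Obj K V), S[b]? = some N → N.mid = j →
    ∃ (a : ℕ) (M : Method Obj K V), a < b ∧ S[a]? = some M ∧ M.mid = i
  log : ∀ t, (loc t).pc = .finished ∨ post (loc t).pc = some .abort ∨
    LogMatch S t (vlog (loc t))
  abs : AbsMatch S abs
  legal : Legal S

variable {H : List (HEvent Obj K V)} {loc : Tx → Local Obj K V (Bucket Obj m)}
  {abs abs' : Obj → K → Option V} {S : List (Method Obj K V)} {t : Tx}
  {l' : Local Obj K V (Bucket Obj m)}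

theorem HistInv.init : HistInv (Obj := Obj) (K := K) (V := V) (m := m) []
    (Config.init Obj K V m).loc (fun _ _ => none) [] := by
  constructor
  · exact List.nodup_nil
  · exact List.nodup_nil
  · intro t j op h; cases h
  · intro i op op' h; cases h
  · intro t j op r h; cases h
  · intro M h; cases h
  · intro t j op r h; cases h
  · intro t h; exact h.elim
  · intro t r h; cases h
  · intro t j r h; cases h
  · rintro i j ⟨p, q, op, op', r, -, h, -⟩; simp at h
  · exact fun t => Or.inr (Or.inr fun o k => by simp [Config.init, vlog, findInLL, EntryMatch])
  · intro o k
    refine Or.inr ?_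
    rintro ⟨x, d, ⟨U, hU, -⟩, -⟩
    cases hU
  · intro i M o k v h; simp at h

theorem HistInv.uncommitted (h : HistInv H loc abs S) (hp : post (loc t).pc = none)
    (hf : (loc t).pc ≠ .finished) : Uncommitted S t := by
  rintro c ⟨⟨⟨t', j⟩, op, r⟩, hC, h1, h2, h3⟩
  obtain rfl : t' = t := h1
  obtain rfl : op = .tryC := h2
  have hC := List.mem_of_getElem? hC
  rcases h.sound _ _ _ _ hC with h4 | ⟨-, h4⟩
  · exact hf (h.finished _ _ _ hC h4)
  · rw [hp] at h4; cases h4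

/-- A step inside a method that is not its linearization point. -/
theorem HistInv.internal (h : HistInv H loc abs S) (hact : Active (loc t).pc)
    (hact' : Active l'.pc) (hi : l'.idx = (loc t).idx) (ho : l'.op = (loc t).op)
    (hpost : post l'.pc = post (loc t).pc) (hv : vlog l' = vlog (loc t)) :
    HistInv H (Function.update loc t l') abs S := by
  have hfin : ∀ {l : Local Obj K V (Bucket Obj m)}, Active l.pc → l.pc ≠ .finished := by
    intro l hl e
    rw [e] at hl
    exact hl
  have key : ∀ u, (Function.update loc t l' u).idx = (loc u).idx ∧
      (Function.update loc t l' u).op = (loc u).op ∧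
      (Active (Function.update loc t l' u).pc ↔ Active (loc u).pc) ∧
      post (Function.update loc t l' u).pc = post (loc u).pc ∧
      ((Function.update loc t l' u).pc = .finished ↔ (loc u).pc = .finished) ∧
      vlog (Function.update loc t l' u) = vlog (loc u) := by
    intro u
    rcases eq_or_ne u t with rfl | hu
    · simp only [Function.update_self]
      exact ⟨hi, ho, iff_of_true hact' hact, hpost, iff_of_false (hfin hact') (hfin hact), hv⟩
    · simp [Function.update_of_ne hu]
  have k1 := fun u => (key u).1
  have k2 := fun u => (key u).2.1
  have k3 := fun u => (key u).2.2.1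
  have k4 := fun u => (key u).2.2.2.1
  have k5 := fun u => (key u).2.2.2.2.1
  have k6 := fun u => (key u).2.2.2.2.2
  constructor
  · exact h.nodup_hist
  · exact h.nodup
  · simpa only [k1, k2, k3] using h.inv_of
  · exact h.inv_inj
  · simpa only [k1] using h.rsp_of
  · exact h.sound_inv
  · simpa only [k1, k4] using h.sound
  · simpa only [k1, k2, k3] using h.active
  · simpa only [k1, k2, k4] using h.posted
  · simpa only [k1, k5] using h.finished
  · exact h.realTime
  · simpa only [k4, k5, k6] using h.log
  · exact h.abs
  · exact h.legal

/-- The linearization point of a method. -/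
theorem HistInv.lin (h : HistInv H loc abs S) {r : Resp V} (hact : Active (loc t).pc)
    (hi : l'.idx = (loc t).idx) (ho : l'.op = (loc t).op) (hpost : post (loc t).pc = none)
    (hpost' : post l'.pc = some r)
    (heff : LPEffect (loc t).log abs l'.op (vlog l') abs' r) :
    HistInv H (Function.update loc t l') abs' (S ++ [⟨(t, (loc t).idx), (loc t).op, r⟩]) := by
  have hf : (loc t).pc ≠ .finished := fun e => by rw [e] at hact; exact hact
  have hun := h.uncommitted hpost hf
  have hact' := active_of_post hpost'
  have hl : LogMatch S t (loc t).log := by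
    rcases h.log t with h1 | h1 | h1
    · exact absurd h1 hf
    · rw [hpost] at h1; cases h1
    · rwa [vlog_of_post_none hpost] at h1
  rw [ho] at heff
  obtain ⟨e1, e2, e3⟩ := LPEffect.legal (M := ⟨(t, (loc t).idx), (loc t).op, r⟩) heff hun hl
    h.abs h.legal
  have hnew : ∀ op r', (⟨(t, (loc t).idx), op, r'⟩ : Method Obj K V) ∉ S := by
    intro op r' hS
    rcases h.sound _ _ _ _ hS with h1 | ⟨-, h1⟩
    · exact absurd h1 (lt_irrefl _)
    · rw [hpost] at h1; cases h1
  constructor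
  · exact h.nodup_hist
  · rw [List.map_append, List.map_singleton]
    refine List.nodup_append'.2 ⟨h.nodup, List.nodup_singleton _, fun i h1 h2 => ?_⟩
    obtain ⟨⟨mid, op, r'⟩, hM, rfl⟩ := List.mem_map.1 h1
    cases List.mem_singleton.1 h2
    exact hnew op r' hM
  · intro u j op hin
    rcases eq_or_ne u t with rfl | hu
    · rw [Function.update_self, hi, ho]
      exact (h.inv_of _ _ _ hin).imp id fun h => ⟨h.1, hact', h.2.2⟩
    · rw [Function.update_of_ne hu]
      exact h.inv_of _ _ _ hin
  · exact h.inv_inj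
  · intro u j op r' hr
    obtain ⟨h1, h2⟩ := h.rsp_of _ _ _ _ hr
    refine ⟨?_, List.mem_append_left _ h2⟩
    rcases eq_or_ne u t with rfl | hu
    · rw [Function.update_self, hi]; exact h1
    · rw [Function.update_of_ne hu]; exact h1
  · intro M hM
    rcases List.mem_append.1 hM with hM | hM
    · exact h.sound_inv M hM
    · cases List.mem_singleton.1 hM
      exact h.active t hact
  · intro u j op r' hM
    rcases List.mem_append.1 hM with hM' | hM'
    · rcases eq_or_ne u t with rfl | hu
      · rw [Function.update_self, hi]
        refine Or.inl ((h.sound _ _ _ _ hM').resolve_right fun h1 => ?_)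
        have h2 := h1.2
        rw [hpost] at h2; cases h2
      · rw [Function.update_of_ne hu]
        exact h.sound _ _ _ _ hM'
    · cases List.mem_singleton.1 hM'
      rw [Function.update_self, hi]
      exact Or.inr ⟨rfl, hpost'⟩
  · intro u hu'
    rcases eq_or_ne u t with rfl | hu
    · rw [Function.update_self, hi, ho]; exact h.active _ hact
    · rw [Function.update_of_ne hu] at hu' ⊢; exact h.active u hu'
  · intro u r' hu'
    rcases eq_or_ne u t with rfl | hu
    · rw [Function.update_self] at hu' ⊢
      rw [hi, ho]
      rw [hpost'] at hu'; cases hu'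
      exact List.mem_append_right _ (List.mem_singleton_self _)
    · rw [Function.update_of_ne hu] at hu' ⊢
      exact List.mem_append_left _ (h.posted u r' hu')
  · intro u j r' hM hj
    rcases List.mem_append.1 hM with hM' | hM'
    · rcases eq_or_ne u t with rfl | hu
      · rw [Function.update_self, hi] at hj
        exact absurd (h.finished _ _ _ hM' hj) hf
      · rw [Function.update_of_ne hu] at hj ⊢
        exact h.finished _ _ _ hM' hj
    · have h1 := List.mem_singleton.1 hM'
      injection h1 with h1
      cases h1
      rw [Function.update_self, hi] at hj
      exact absurd hj (lt_irrefl _)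
  · intro i j hrt b N hb hN
    rcases getElem?_snoc.1 hb with hb | ⟨rfl, rfl⟩
    · obtain ⟨a, M, h1, h2, h3⟩ := h.realTime i j hrt b N hb hN
      exact ⟨a, M, h1, getElem?_snoc.2 (Or.inl h2), h3⟩
    · obtain ⟨p, q, op, op', r', -, hp, -⟩ := hrt
      obtain ⟨a, ha⟩ := List.mem_iff_getElem?.1
        (h.rsp_of i.1 i.2 op r' (List.mem_of_getElem? hp)).2
      exact ⟨a, _, lt_of_getElem? ha, getElem?_snoc.2 (Or.inl ha), rfl⟩
  · intro u
    rcases eq_or_ne u t with rfl | hu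
    · rw [Function.update_self]
      rcases e1 with e1 | e1
      · cases e1; exact Or.inr (Or.inl hpost')
      · exact Or.inr (Or.inr e1)
    · rw [Function.update_of_ne hu]
      refine (h.log u).imp id (Or.imp id fun h1 => h1.snoc ?_)
      rintro o k ⟨h2, -⟩
      exact hu h2.symm
  · exact e2
  · exact e3

/-- The response of a method. -/
theorem HistInv.respond (h : HistInv H loc abs S) {r : Resp V} {pc' : PC Obj K V (Bucket Obj m)}
    (hr : (loc t).pc = .respond r)
    (hpc : pc' = .finished ∨ pc' = .ready ∧ r ≠ .abort ∧ (loc t).op ≠ .tryC) :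
    HistInv (H ++ [.rsp (t, (loc t).idx) (loc t).op r])
      (Function.update loc t { loc t with pc := pc', idx := (loc t).idx + 1 }) abs S := by
  have hpost : post (loc t).pc = some r := by rw [hr]; rfl
  have hpost' : post pc' = none := by rcases hpc with rfl | ⟨rfl, -⟩ <;> rfl
  have hact' : ¬ Active pc' := by rcases hpc with rfl | ⟨rfl, -⟩ <;> exact id
  constructor
  · refine List.nodup_append'.2 ⟨h.nodup_hist, List.nodup_singleton _, fun e h1 h2 => ?_⟩
    cases List.mem_singleton.1 h2
    exact absurd (h.rsp_of _ _ _ _ h1).1 (lt_irrefl _)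
  · exact h.nodup
  · intro u j op hin
    replace hin : HEvent.inv (u, j) op ∈ H := by simpa using hin
    rcases eq_or_ne u t with rfl | hu
    · rw [Function.update_self]
      have := h.inv_of _ _ _ hin
      left
      change j < (loc u).idx + 1
      omega
    · rw [Function.update_of_ne hu]
      exact h.inv_of _ _ _ hin
  · intro i op op' h1 h2
    exact h.inv_inj i op op' (by simpa using h1) (by simpa using h2)
  · intro u j op r' hin
    rcases List.mem_append.1 hin with hin | hin
    · obtain ⟨h1, h2⟩ := h.rsp_of _ _ _ _ hin
      refine ⟨?_, h2⟩
      rcases eq_or_ne u t with rfl | hu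
      · rw [Function.update_self]; exact Nat.lt_succ_of_lt h1
      · rw [Function.update_of_ne hu]; exact h1
    · cases List.mem_singleton.1 hin
      rw [Function.update_self]
      exact ⟨Nat.lt_succ_self _, h.posted _ _ hpost⟩
  · exact fun M hM => List.mem_append_left _ (h.sound_inv M hM)
  · intro u j op r' hM
    have h1 := h.sound _ _ _ _ hM
    rcases eq_or_ne u t with rfl | hu
    · rw [Function.update_self]
      left
      change j < (loc u).idx + 1
      omega
    · rw [Function.update_of_ne hu]
      exact h1
  · intro u hu'
    rcases eq_or_ne u t with rfl | hu
    · rw [Function.update_self] at hu'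
      exact absurd hu' hact'
    · rw [Function.update_of_ne hu] at hu' ⊢
      exact List.mem_append_left _ (h.active u hu')
  · intro u r' hu'
    rcases eq_or_ne u t with rfl | hu
    · rw [Function.update_self] at hu'
      exact absurd (hpost'.symm.trans hu') (by simp)
    · rw [Function.update_of_ne hu] at hu' ⊢
      exact h.posted u r' hu'
  · intro u j r' hM hj
    rcases eq_or_ne u t with rfl | hu
    · rw [Function.update_self] at hj ⊢
      rcases hpc with rfl | ⟨rfl, -, hop⟩
      · rfl
      · exfalso
        change j < (loc u).idx + 1 at hj
        rcases h.sound _ _ _ _ hM with h1 | ⟨rfl, -⟩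
        · have := h.finished _ _ _ hM h1
          rw [hr] at this; cases this
        · refine hop ?_
          have := eq_of_mid_eq h.nodup hM (h.posted _ _ hpost) rfl
          injection this with _ h2
          exact h2.symm
    · rw [Function.update_of_ne hu] at hj ⊢
      exact h.finished _ _ _ hM hj
  · intro i j hrt
    rcases realTime_snoc hrt with hrt | ⟨⟨op, h1⟩, -⟩
    · exact h.realTime i j hrt
    · cases h1
  · intro u
    rcases eq_or_ne u t with rfl | hu
    · rw [Function.update_self]
      rcases hpc with rfl | ⟨rfl, hab, -⟩
      · exact Or.inl rfl
      · rcases h.log u with h1 | h1 | h1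
        · rw [hr] at h1; cases h1
        · rw [hpost] at h1; exact absurd (Option.some_injective _ h1) hab
        · refine Or.inr (Or.inr ?_)
          have e : vlog (loc u) = (loc u).log := by unfold vlog; rw [hr]
          rwa [e] at h1
    · rw [Function.update_of_ne hu]
      exact h.log u
  · exact h.abs
  · exact h.legal

/-- The invocation of a method. -/
theorem HistInv.invoke (h : HistInv H loc abs S) {op : Op Obj K V}
    (hc : CanInvoke (loc t).pc op) :
    HistInv (H ++ [.inv (t, (loc t).idx) op])
      (Function.update loc t { loc t with pc := .invoked, op := op }) abs S := by
  have hact : ¬ Active (loc t).pc := by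
    cases hp : (loc t).pc <;> rw [hp] at hc <;> first | exact id | (cases op <;> exact hc.elim)
  have hpost : post (loc t).pc = none := by
    by_contra hne
    obtain ⟨r, hr⟩ := Option.ne_none_iff_exists'.1 hne
    exact hact (active_of_post hr)
  have hf : (loc t).pc ≠ .finished := fun e => by rw [e] at hc; exact hc
  have hnew : ∀ op', HEvent.inv (t, (loc t).idx) op' ∉ H := by
    intro op' hin
    rcases h.inv_of _ _ _ hin with h1 | ⟨-, h1, -⟩
    exacts [absurd h1 (lt_irrefl _), hact h1]
  have hlt : ∀ j op' r', (⟨(t, j), op', r'⟩ : Method Obj K V) ∈ S → j < (loc t).idx := by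
    intro j op' r' hM
    refine (h.sound _ _ _ _ hM).resolve_right fun h1 => ?_
    have h2 := h1.2
    rw [hpost] at h2; cases h2
  constructor
  · refine List.nodup_append'.2 ⟨h.nodup_hist, List.nodup_singleton _, fun e h1 h2 => ?_⟩
    cases List.mem_singleton.1 h2
    exact hnew _ h1
  · exact h.nodup
  · intro u j op' hin
    rcases List.mem_append.1 hin with hin' | hin'
    · rcases eq_or_ne u t with rfl | hu
      · rw [Function.update_self]
        exact Or.inl ((h.inv_of _ _ _ hin').resolve_right fun h1 => hact h1.2.1)
      · rw [Function.update_of_ne hu]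
        exact h.inv_of _ _ _ hin'
    · cases List.mem_singleton.1 hin'
      rw [Function.update_self]
      exact Or.inr ⟨rfl, trivial, rfl⟩
  · intro i op₁ op₂ h1 h2
    rcases List.mem_append.1 h1 with h1 | h1 <;> rcases List.mem_append.1 h2 with h2 | h2
    · exact h.inv_inj i op₁ op₂ h1 h2
    · cases List.mem_singleton.1 h2; exact absurd h1 (hnew _)
    · cases List.mem_singleton.1 h1; exact absurd h2 (hnew _)
    · cases List.mem_singleton.1 h1; cases List.mem_singleton.1 h2; rfl
  · intro u j op' r' hin
    replace hin : HEvent.rsp (u, j) op' r' ∈ H := by simpa using hin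
    rcases eq_or_ne u t with rfl | hu
    · rw [Function.update_self]; exact h.rsp_of _ _ _ _ hin
    · rw [Function.update_of_ne hu]; exact h.rsp_of _ _ _ _ hin
  · exact fun M hM => List.mem_append_left _ (h.sound_inv M hM)
  · intro u j op' r' hM
    rcases eq_or_ne u t with rfl | hu
    · rw [Function.update_self]
      exact Or.inl (hlt _ _ _ hM)
    · rw [Function.update_of_ne hu]
      exact h.sound _ _ _ _ hM
  · intro u hu'
    rcases eq_or_ne u t with rfl | hu
    · rw [Function.update_self]
      exact List.mem_append_right _ (List.mem_singleton_self _)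
    · rw [Function.update_of_ne hu] at hu' ⊢
      exact List.mem_append_left _ (h.active u hu')
  · intro u r' hu'
    rcases eq_or_ne u t with rfl | hu
    · rw [Function.update_self] at hu'
      cases hu'
    · rw [Function.update_of_ne hu] at hu' ⊢
      exact h.posted u r' hu'
  · intro u j r' hM hj
    rcases eq_or_ne u t with rfl | hu
    · exact absurd (h.finished _ _ _ hM (hlt _ _ _ hM)) hf
    · rw [Function.update_of_ne hu] at hj ⊢
      exact h.finished _ _ _ hM hj
  · intro i j hrt b N hb hN
    rcases realTime_snoc hrt with hrt | ⟨⟨op', h1⟩, -⟩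
    · exact h.realTime i j hrt b N hb hN
    · cases h1
      obtain ⟨mid, op', r'⟩ := N
      cases hN
      exact absurd (hlt _ _ _ (List.mem_of_getElem? hb)) (lt_irrefl _)
  · intro u
    rcases eq_or_ne u t with rfl | hu
    · rw [Function.update_self]
      rcases h.log u with h1 | h1 | h1
      · exact absurd h1 hf
      · rw [hpost] at h1; cases h1
      · rw [vlog_of_post_none hpost] at h1
        exact Or.inr (Or.inr h1)
    · rw [Function.update_of_ne hu]
      exact h.log u
  · exact h.abs
  · exact h.legal

/-! ### Executions -/

/-- The state after the execution `E`, in which the methods `S` have been linearized. -/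
structure Linearized (hash : Obj → K → Fin m) (E : List (Event Obj K V (Bucket Obj m)))
    (c : Config Obj K V m) (g : Ghost Obj K V m) (S : List (Method Obj K V)) : Prop where
  inv : Inv hash c g
  unreleased : ∀ t, Unreleased (c.loc t).pc
  hist : HistInv (history E) c.loc g.abs S
  order : (E.filter fun e => e.lp).map (fun e => e.mid) = S.map fun M => M.mid
  within : Within E

theorem Run.linearized {hash : Obj → K → Fin m} {E : List (Event Obj K V (Bucket Obj m))}
    {c : Config Obj K V m} (h : Run hash E c) : ∃ g S, Linearized hash E c g S := by
  induction h with
  | nil =>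
    exact ⟨_, [], Inv.init hash, fun _ => trivial, HistInv.init, rfl, fun p e he => by simp at he⟩
  | snoc E c c' e _ he ih =>
    obtain ⟨g, S, h⟩ := ih
    cases he with
    | invoke t op hc =>
      refine ⟨g, S, h.inv.invoke hc, fun u => ?_, ?_, ?_, h.within.snoc (by simp)⟩
      · change Unreleased (Function.update c.loc t _ u).pc
        rcases eq_or_ne u t with rfl | hu
        · rw [Function.update_self]; trivial
        · rw [Function.update_of_ne hu]; exact h.unreleased u
      · rw [history_snoc]
        exact h.hist.invoke hc
      · simpa using h.order
    | exec t l' s' act lp hs =>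
      obtain ⟨g', hg', hlp⟩ := step_ok h.inv hs
      obtain ⟨hk, hu'⟩ := step_kind (h.unreleased t) hs
      have hact := active_of_step hs
      have hun : ∀ u, Unreleased (Function.update c.loc t l' u).pc := by
        intro u
        rcases eq_or_ne u t with rfl | hu
        · rw [Function.update_self]; exact hu'
        · rw [Function.update_of_ne hu]; exact h.unreleased u
      have hint : act.Internal → ∀ lp, (Event.hist (B := Bucket Obj m)
          ⟨(t, (c.loc t).idx), act, lp⟩) = none := by
        intro ha lp
        cases act <;> first | rfl | exact ha.elim
      cases hk with
      | internal l' act ha hi ho hpost hact' hv =>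
        refine ⟨g', S, hg', hun, ?_, ?_, h.within.snoc (by simp)⟩
        · rw [history_snoc, hint ha, show g'.abs = g.abs from hlp]
          simpa using h.hist.internal hact hact' hi ho hpost hv
        · simpa using h.order
      | lin l' act ha hi ho hpost =>
        obtain ⟨r, hr, heff⟩ := hlp
        refine ⟨g', S ++ [⟨(t, (c.loc t).idx), (c.loc t).op, r⟩], hg', hun, ?_, ?_,
          h.within.snoc fun _ => ⟨?_, ?_, ?_⟩⟩
        · rw [history_snoc, hint ha]
          simpa using h.hist.lin hact hi ho hpost hr heff
        · simpa using h.order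
        · rintro op r' rfl; exact ha
        · exact ⟨_, h.hist.active t hact⟩
        · exact fun op r' hin => absurd (h.hist.rsp_of _ _ _ _ hin).1 (lt_irrefl _)
      | respond r pc' hr hpc =>
        refine ⟨g', S, hg', hun, ?_, ?_, h.within.snoc (by simp)⟩
        · rw [history_snoc, show g'.abs = g.abs from hlp]
          exact h.hist.respond hr hpc
        · simpa using h.order

theorem Linearized.isLinearization {hash : Obj → K → Fin m}
    {E : List (Event Obj K V (Bucket Obj m))} {c : Config Obj K V m} {g : Ghost Obj K V m}
    {S : List (Method Obj K V)} (h : Linearized hash E c g S) : IsLinearization E S := by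
  refine ⟨h.within, h.order, h.hist.nodup, ?_, ?_⟩
  · exact perm_completion h.hist.nodup_hist h.hist.nodup h.hist.inv_inj
      (fun i op r hin => (h.hist.rsp_of i.1 i.2 op r hin).2) h.hist.sound_inv
  · rintro i j hrt ⟨N, hN, hj⟩
    obtain ⟨b, hb⟩ := List.mem_iff_getElem?.1 hN
    obtain ⟨a, M, hab, ha, hi⟩ := h.hist.realTime i j hrt b N hb hj
    refine ⟨2 * a + 1, 2 * b, M.op, N.op, M.resp, by omega, ?_, ?_⟩
    · rw [(seqHistory_inv ha).2, hi]
    · rw [(seqHistory_inv hb).1, hj]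

end HistInv

end HTOSTM

theorem mainTheorem4 {Obj K V : Type*} [DecidableEq Obj] [LinearOrder K] {m : ℕ}
    (hash : Obj → K → Fin m) (E : List (HTOSTM.Event Obj K V (HTOSTM.Bucket Obj m)))
    (hE : HTOSTM.IsExecution hash E) :
    ∃ S : List (HTOSTM.Method Obj K V), HTOSTM.IsLinearization E S ∧ HTOSTM.Legal S := by
  obtain ⟨c, hc⟩ := hE
  obtain ⟨g, S, h⟩ := hc.linearized
  exact ⟨S, h.isLinearization, h.hist.legal⟩
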